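/- **Quotient maps on a disk.** Let $D$ be a closed disk. A quotient map on $D$ is a nonempty finite connected graph (loops and multiple edges allowed) embedded in $D$ such that every vertex lies in the interior or on the boundary of $D$; every edge is either a *complete edge* (both ends are vertices, interior of the edge inside the interior of $D$), or a *halfedge* (it starts at a vertex, ends at a point of $\partial D$ that is not a vertex, and otherwise runs in the interior of $D$), or a *boundary edge* (it is contained in $\partial D$ and both its ends are vertices); and every face is either an open disk contained in the interior of $D$ or a half-disk that meets $\partial D$ in exactly one open arc. The number of *darts* is twice the number of complete edges plus the number of halfedges plus the number of boundary edges. Maps on the sphere have only complete edges, and all their faces are open disks. Rooted maps are counted up to root-preserving and orientation-preserving homeomorphism. (Formally, a map is given by its flags, the triangles of its barycentric subdivision, with the three involutions that send a flag to its neighbour across each side and fix it if that side lies on the boundary; the number of darts is half the number of flags, and the surface is recognised by connectedness, orientability and Euler characteristic.) **Counting functions** (for integers $n,k\ge 0$). * $d^{(0)}_{n,k}$ is the number of quotient maps on the disk with $n$ darts and a distinguished root vertex $x\in\partial D$ that is incident to no boundary edge and to exactly $k$ darts (a loop contributes two); for $n\ge 1$ the root dart is the leftmost dart at $x$. The map consisting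 of a single vertex on $\partial D$ gives $d^{(0)}_{0,0}=1$. * $d^{(1)}_{n,k}$ is the number of quotient maps on the disk with $n$ darts whose root dart belongs to a boundary edge, being the leftmost dart at the root vertex, such that besides this boundary dart the root vertex is incident to exactly $k$ darts, none of which lies on the boundary. * $s_{n,k}$ is the number of rooted maps on the sphere with $n$ darts (that is, $n/2$ edges) and root vertex of degree $k$; the one-vertex map without edges gives $s_{0,0}=1$. **Proposition.** For all integers $n\ge 1$ and $k\ge 1$, $$ d^{(0)}_{n,k}=d^{(0)}_{n-1,k-1}+\sum_{k'=0}^{n-k-1}d^{(0)}_{n-2,\,k-1+k'}+\sum_{n'=0}^{n-2}\sum_{k'=0}^{k-2}d^{(0)}_{n',k'}\, s_{n-n'-2,\,k-k'-2} $$ $$ +\sum_{n'=0}^{n-2}\sum_{k'=0}^{n-k-1}\sum_{k''=0}^{k'}\sum_{i_1=0}^{1}\sum_{i_2=0}^{1}d^{(i_1)}_{n-2-n',\,k+k''-1}\; d^{(i_2)}_{n',\,k'-k''}, $$ where sums whose upper limit is smaller than the lower limit are zero. -/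

import Mathlib

/-!
Quotient maps are encoded by their flags, that is, by the triangles of the barycentric
subdivision of the map (corners: a vertex, the midpoint of an edge, the centre of a face).
-/

/-- A connected map, possibly with boundary, on the set of flags `F`.
`r0 f`, `r1 f`, `r2 f` is the flag on the other side of the side of the triangle `f` that is opposite
to the vertex corner, the edge corner, the face corner; `rᵢ f = f` means that this side of `f` lies
on the boundary of the surface.
Since `r0` and `r2` commute and never agree, every edge is of one of three types:
* a complete edge: four flags `f`, `r0 f`, `r2 f`, `r0 (r2 f)`;
* a halfedge, running from a vertex to a point of the boundary: two flags `f`, `r2 f`, fixed by `r0`;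
* a boundary edge, contained in the boundary: two flags `f`, `r0 f`, fixed by `r2`. -/
structure FlagMap (F : Type) where
  r0 : Equiv.Perm F
  r1 : Equiv.Perm F
  r2 : Equiv.Perm F
  r0_invol : ∀ f, r0 (r0 f) = f
  r1_invol : ∀ f, r1 (r1 f) = f
  r2_invol : ∀ f, r2 (r2 f) = f
  r0_r2_comm : ∀ f, r0 (r2 f) = r2 (r0 f)
  /-- no edge ends in a branch point or has its midpoint at a corner of the boundary -/
  r0_ne_r2 : ∀ f, r0 f ≠ r2 f
  connected : ∀ f g, ∃ σ ∈ Subgroup.closure ({r0, r1, r2} : Set (Equiv.Perm F)), σ f = g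

/-- The orbit of `f` under the group generated by a set of permutations. -/
def orbitUnder {F : Type} (S : Set (Equiv.Perm F)) (f : F) : Set F :=
  {g | ∃ σ ∈ Subgroup.closure S, σ f = g}

/-- The number of orbits of the group generated by a set of permutations. -/
noncomputable def numOrbits {F : Type} (S : Set (Equiv.Perm F)) : ℕ :=
  (Set.range (orbitUnder S)).ncard

namespace FlagMap

variable {F : Type}

/-- The flags around the vertex of the flag `f`. -/
def vertexFlags (M : FlagMap F) (f : F) : Set F := orbitUnder {M.r1, M.r2} f

/-- The Euler characteristic of the surface, computed from its triangulation by the flags: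
vertices, edge midpoints and face centres, minus sides of triangles, plus triangles. -/
noncomputable def eulerChar (M : FlagMap F) : ℤ :=
  ((numOrbits {M.r1, M.r2} : ℤ) + numOrbits {M.r0, M.r2} + numOrbits {M.r0, M.r1})
    - ((numOrbits {M.r0} : ℤ) + numOrbits {M.r1} + numOrbits {M.r2})
    + Nat.card F

/-- The surface is orientable: the flags can be coloured by two colours so that distinct flags
sharing a side have different colours. -/
def Orientable (M : FlagMap F) : Prop :=
  ∃ c : F → Bool, ∀ f,
    (M.r0 f ≠ f → c (M.r0 f) ≠ c f) ∧ (M.r1 f ≠ f → c (M.r1 f) ≠ c f) ∧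
      (M.r2 f ≠ f → c (M.r2 f) ≠ c f)

/-- The surface has no boundary. -/
def Closed (M : FlagMap F) : Prop :=
  ∀ f, M.r0 f ≠ f ∧ M.r1 f ≠ f ∧ M.r2 f ≠ f

/-- The surface is a sphere. -/
def OnSphere (M : FlagMap F) : Prop := M.Closed ∧ M.Orientable ∧ M.eulerChar = 2

/-- The surface is a disk. -/
def OnDisk (M : FlagMap F) : Prop := ¬ M.Closed ∧ M.Orientable ∧ M.eulerChar = 1

/-- The number of ends of boundary edges at the vertex of `f`; such an end carries one flag. -/
noncomputable def boundaryEnds (M : FlagMap F) (f : F) : ℕ :=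
  {g ∈ M.vertexFlags f | M.r2 g = g}.ncard

/-- The vertex of `f` is incident to exactly `k` darts not lying on the boundary (ends of complete
edges, a loop having two of them, and halfedges); such a dart carries two flags `g`, `r2 g`. -/
def HasInnerDegree (M : FlagMap F) (f : F) (k : ℕ) : Prop :=
  {g ∈ M.vertexFlags f | M.r2 g ≠ g}.ncard = 2 * k

end FlagMap

/-- Isomorphism of maps with a distinguished flag. -/
def rootedSetoid (F : Type) : Setoid (FlagMap F × F) where
  r p q := ∃ e : Equiv.Perm F, e p.2 = q.2 ∧ ∀ f, e (p.1.r0 f) = q.1.r0 (e f) ∧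
    e (p.1.r1 f) = q.1.r1 (e f) ∧ e (p.1.r2 f) = q.1.r2 (e f)
  iseqv :=
    { refl := fun _ => ⟨1, rfl, fun _ => ⟨rfl, rfl, rfl⟩⟩
      symm := by
        rintro p q ⟨e, h, H⟩
        refine ⟨e.symm, by simp [← h], fun f => ?_⟩
        obtain ⟨h0, h1, h2⟩ := H (e.symm f)
        simp only [Equiv.apply_symm_apply] at h0 h1 h2
        simp [← h0, ← h1, ← h2]
      trans := by
        rintro p q r ⟨e, h, H⟩ ⟨e', h', H'⟩
        refine ⟨e.trans e', by simp [h, h'], fun f => ?_⟩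
        simp [(H f).1, (H f).2.1, (H f).2.2, (H' (e f)).1, (H' (e f)).2.1, (H' (e f)).2.2] }

/-- The number of isomorphism classes of maps with `n` darts (two for each complete edge, one for
each halfedge or boundary edge; hence `2 * n` flags) with a root flag satisfying `P`.

On an orientable surface a root flag amounts to a root dart, counted up to orientation-preserving
isomorphism: the orientation is the one in which the root flag is positive, and each dart
contains exactly one positive flag. -/
noncomputable def numRooted (n : ℕ) (P : FlagMap (Fin (2 * n)) → Fin (2 * n) → Prop) : ℕ :=
  ((fun p => Quotient.mk (rootedSetoid (Fin (2 * n))) p) '' {p | P p.1 p.2}).ncard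

/-- `s_{n,k}`: the number of rooted maps on the sphere with `n` darts and root vertex of
degree `k`. The one-vertex map without edges is counted for `n = k = 0`; it has no flags. -/
noncomputable def sphereCount (n k : ℕ) : ℕ :=
  if n = 0 then (if k = 0 then 1 else 0)
  else numRooted n fun M f => M.OnSphere ∧ M.HasInnerDegree f k

/-- `d^{(0)}_{n,k}`: the number of rooted quotient maps on the disk with `n` darts whose root vertex
lies on the boundary, is not incident to a boundary edge, and has degree `k`, the root dart being
the leftmost dart at the root vertex (`r1 f = f`: next to the root flag `f` there is the boundary).
The map consisting of one vertex on the boundary is counted for `n = k = 0`; it has no flags. -/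
noncomputable def diskCount0 (n k : ℕ) : ℕ :=
  if n = 0 then (if k = 0 then 1 else 0)
  else numRooted n fun M f =>
    M.OnDisk ∧ M.r1 f = f ∧ M.boundaryEnds f = 0 ∧ M.HasInnerDegree f k

/-- `d^{(1)}_{n,k}`: the number of rooted quotient maps on the disk with `n` darts whose root dart
lies on a boundary edge (`r2 f = f` for the root flag `f`) and whose root vertex is incident to
exactly `k` other darts, all of them inner (so that there is no other boundary edge end there). -/
noncomputable def diskCount1 (n k : ℕ) : ℕ :=
  numRooted n fun M f =>
    M.OnDisk ∧ M.r2 f = f ∧ M.boundaryEnds f = 1 ∧ M.HasInnerDegree f k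

/-- `d^{(i)}_{n,k}` for `i = 0, 1`. -/
noncomputable def diskCount (i : Fin 2) (n k : ℕ) : ℕ :=
  if i = 0 then diskCount0 n k else diskCount1 n k

/-!
The recursion comes from decomposing a rooted map on the disk by its root edge, the first edge at a
root vertex `x` on the boundary that is not incident to boundary edges. The root flag is next to the
boundary, so the first side of the root edge faces the boundary.

*Folded edges.* The decomposition takes place among maps that may be disconnected and may contain
folded edges, which consist of two flags with `r0 f = r2 f` (`PMap`). A folded edge does not affect
the surface and marks a corner; inserting or deleting it is a bijection (`cnt_ins`). Thus maps with one
folded edge at the first corner of a boundary vertex, or at a corner of a spherical map, are counted by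
`diskCount` and `sphereCount` (`cnt_G`, `cnt_GS`), where the folded edge alone stands for the map
without edges.

*Cutting.* If the root edge is complete, it can be cut lengthwise (`Cut`), which leaves the flags and
their `r0`, `r1` in place and turns both sides of the edge into folded edges. The vertices at the ends of
the edge are regrouped from the *pieces* into which the paths or cycles of flags there fall (`bs`), and
the Euler characteristic increases by one more than the number of vertices (`Cut.chi_eq`). A connected
map has Euler characteristic at most `2`, and at most `1` if it has a boundary; this is seen by counting
dimensions of cochains over `ZMod 2` (`chi_le`). The additivity of the Euler characteristic and these
bounds show in which cases the cut separates the map and what the components are.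
Conversely two connected maps with folded edges can be glued (`cnt_glue`).

*The four cases.*
* The root edge is a halfedge. It can be deleted (`cnt_half`).
* The root edge ends at an inner vertex. The face on its first side is adjacent to the boundary at `x`,
  and slitting it open up to the other end of the edge turns this end into a boundary vertex without
  boundary edges where the root edge comes first (`cnt_unzip`). Cutting the edge then splits off a single
  folded edge, so this case reduces to a special form of the last one (`cnt_firstOuter`).
* The root edge is a loop. Cutting it separates a disk, on the first side, from the sphere enclosed by
  the loop; each of them marks a corner, at the first dart of `x` for the disk (`cnt_enclosing`).
* The root edge ends at another boundary vertex. Cutting it leaves two disks (`cnt_outer`). In the first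
  one the marked corner is the first one at its vertex, of arbitrary degree. In the second one there are
  `k - 1` darts between the marked corner and the boundary. Since the flags at a boundary vertex form a
  path (`path_ends`), such a corner exists once for every end of a path with at least `k - 1` inner darts
  (`cnt_Pos`), which gives a sum over all degrees from `k - 1` on.

The sums so obtained run over independent degrees at the two ends; as there are no maps with more than
`n` darts at the root vertex (`diskCount_eq_zero`), they agree with the convolution in the recursion
(`sum_convolution`).
-/

open Function

/-! ### Equivalence relations generated by maps -/

/-- The equivalence relation whose classes are the orbits of the self-map `σ`. -/
def step {F : Type} (σ : F → F) : Setoid F := Relation.EqvGen.setoid fun x y => σ x = y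

/-- The equivalence relation that identifies `a` with `b` and nothing else. -/
def pair {F : Type} (a b : F) : Setoid F := Relation.EqvGen.setoid fun x y => x = a ∧ y = b

/-- The number of classes of an equivalence relation. -/
noncomputable def numC {F : Type} (s : Setoid F) : ℕ := Nat.card (Quotient s)

section Setoids

variable {F : Type}

theorem step_rel (σ : F → F) (x : F) : step σ x (σ x) := Relation.EqvGen.rel _ _ rfl

theorem step_le {σ : F → F} {s : Setoid F} : step σ ≤ s ↔ ∀ x, s x (σ x) := by
  refine ⟨fun h x => h (step_rel σ x), fun h => Setoid.eqvGen_le ?_⟩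
  rintro x _ rfl
  exact h x

theorem pair_le {a b : F} {s : Setoid F} : pair a b ≤ s ↔ s a b := by
  refine ⟨fun h => h (Relation.EqvGen.rel _ _ ⟨rfl, rfl⟩), fun h => Setoid.eqvGen_le ?_⟩
  rintro x y ⟨rfl, rfl⟩
  exact h

theorem pair_rel (a b : F) : pair a b a b := Relation.EqvGen.rel _ _ ⟨rfl, rfl⟩

/-- The classes of `a` and `b` are merged, the others are unchanged. -/
theorem sup_pair_iff {s : Setoid F} {a b x y : F} :
    (s ⊔ pair a b) x y ↔ s x y ∨ (s x a ∧ s b y) ∨ (s x b ∧ s a y) := by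
  constructor
  · let t : Setoid F :=
      { r := fun x y => s x y ∨ (s x a ∧ s b y) ∨ (s x b ∧ s a y)
        iseqv :=
          { refl := fun x => Or.inl (s.refl' x)
            symm := by
              rintro x y (h | ⟨h, h'⟩ | ⟨h, h'⟩)
              · exact Or.inl (s.symm' h)
              · exact Or.inr (Or.inr ⟨s.symm' h', s.symm' h⟩)
              · exact Or.inr (Or.inl ⟨s.symm' h', s.symm' h⟩)
            trans := by
              have T := fun {x y z : F} (h : s x y) (h' : s y z) => s.trans' h h'
              have S := fun {x y : F} (h : s x y) => s.symm' h
              rintro x y z (h | ⟨h, h'⟩ | ⟨h, h'⟩) (k | ⟨k, k'⟩ | ⟨k, k'⟩)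
              · exact Or.inl (T h k)
              · exact Or.inr (Or.inl ⟨T h k, k'⟩)
              · exact Or.inr (Or.inr ⟨T h k, k'⟩)
              · exact Or.inr (Or.inl ⟨h, T h' k⟩)
              · exact Or.inr (Or.inl ⟨h, k'⟩)
              · exact Or.inl (T h k')
              · exact Or.inr (Or.inr ⟨h, T h' k⟩)
              · exact Or.inl (T h k')
              · exact Or.inr (Or.inr ⟨h, k'⟩) } }
    have h1 : s ⊔ pair a b ≤ t := by
      refine sup_le (fun {x y} h => Or.inl h) (pair_le.2 ?_)
      exact Or.inr (Or.inl ⟨s.refl' a, s.refl' b⟩)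
    exact fun h => h1 h
  · have h1 : s ≤ s ⊔ pair a b := le_sup_left
    have h2 : (s ⊔ pair a b) a b := (le_sup_right : pair a b ≤ _) (pair_rel a b)
    have T := fun {x y z : F} (h : (s ⊔ pair a b) x y) (h' : (s ⊔ pair a b) y z) =>
      Setoid.trans' _ h h'
    rintro (h | ⟨h, h'⟩ | ⟨h, h'⟩)
    · exact h1 h
    · exact T (T (h1 h) h2) (h1 h')
    · exact T (T (h1 h) (Setoid.symm' _ h2)) (h1 h')

theorem sup_pair_eq {s : Setoid F} {a b : F} (h : s a b) : s ⊔ pair a b = s :=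
  sup_eq_left.2 (pair_le.2 h)

/-- Identifying two inequivalent elements lowers the number of classes by one. -/
theorem numC_sup_pair [Finite F] {s : Setoid F} {a b : F} (h : ¬ s a b) :
    numC (s ⊔ pair a b) + 1 = numC s := by
  classical
  let f : {q : Quotient s // q ≠ Quotient.mk s b} → Quotient (s ⊔ pair a b) := fun q =>
    Quotient.map' (s₁ := s) (s₂ := s ⊔ pair a b) id
      (fun _ _ h => (le_sup_left : s ≤ s ⊔ pair a b) h) q.1
  have hf : Function.Bijective f := by
    constructor
    · rintro ⟨q, hq⟩ ⟨q', hq'⟩ e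
      induction q using Quotient.inductionOn with | _ x => ?_
      induction q' using Quotient.inductionOn with | _ y => ?_
      have hx : ¬ s x b := fun h => hq (Quotient.sound h)
      have hy : ¬ s y b := fun h => hq' (Quotient.sound h)
      have e' : (s ⊔ pair a b) x y := Quotient.exact e
      rcases sup_pair_iff.1 e' with e' | ⟨_, e'⟩ | ⟨e', _⟩
      · exact Subtype.ext (Quotient.sound e')
      · exact absurd (s.symm' e') hy
      · exact absurd e' hx
    · intro q
      induction q using Quotient.inductionOn with | _ x => ?_
      by_cases hx : s x b
      · refine ⟨⟨Quotient.mk s a, fun e => h (Quotient.exact e)⟩, Quotient.sound ?_⟩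
        exact sup_pair_iff.2 (Or.inr (Or.inl ⟨s.refl' _, s.symm' hx⟩))
      · exact ⟨⟨Quotient.mk s x, fun e => hx (Quotient.exact e)⟩, rfl⟩
  have := Fintype.ofFinite (Quotient s)
  have h1 := Nat.card_congr (Equiv.ofBijective f hf)
  have h2 : Nat.card {q : Quotient s // q ≠ Quotient.mk s b} + 1 = Nat.card (Quotient s) := by
    simp only [Nat.card_eq_fintype_card, Fintype.card_subtype_compl, Fintype.card_unique,
      ne_eq]
    have h0 : 0 < Fintype.card (Quotient s) := Fintype.card_pos_iff.2 ⟨Quotient.mk s b⟩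
    omega
  unfold numC
  omega

/-- A map that preserves and reflects equivalence and meets every class matches the classes. -/
theorem numC_congr {A B : Type} {s : Setoid A} {t : Setoid B} (f : A → B)
    (hf : ∀ x y, t (f x) (f y) ↔ s x y) (hs : ∀ b, ∃ a, t (f a) b) : numC s = numC t := by
  let g : Quotient s → Quotient t := Quotient.map' f fun x y h => (hf x y).2 h
  refine Nat.card_congr (Equiv.ofBijective g ⟨fun p q => ?_, fun q => ?_⟩)
  · induction p using Quotient.inductionOn with | _ x => ?_
    induction q using Quotient.inductionOn with | _ y => ?_
    exact fun e => Quotient.sound ((hf x y).1 (Quotient.exact e))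
  · induction q using Quotient.inductionOn with | _ b => ?_
    obtain ⟨a, ha⟩ := hs b
    exact ⟨Quotient.mk s a, Quotient.sound ha⟩

/-- An invariant set contains with an element its whole orbit. -/
theorem rel_mem {s : Setoid F} {σ τ : F → F} {T : Set F} (hs : s = step σ ⊔ step τ)
    (h1 : ∀ x, σ x ∈ T ↔ x ∈ T) (h2 : ∀ x, τ x ∈ T ↔ x ∈ T) {x y : F} (h : s x y) :
    x ∈ T ↔ y ∈ T := by
  have : s ≤ Setoid.ker (fun x => x ∈ T) := by
    rw [hs]
    refine sup_le (step_le.2 fun x => ?_) (step_le.2 fun x => ?_)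
    · exact propext (h1 x).symm
    · exact propext (h2 x).symm
  exact iff_of_eq (this h)

theorem rel_left (σ τ : F → F) (x : F) : (step σ ⊔ step τ) x (σ x) :=
  (le_sup_left : step σ ≤ _) (step_rel σ x)

theorem rel_right (σ τ : F → F) (x : F) : (step σ ⊔ step τ) x (τ x) :=
  (le_sup_right : step τ ≤ _) (step_rel τ x)

/-- A map intertwining two pairs of involutions maps orbits onto orbits. -/
theorem rel_map_iff {A B : Type} {σ τ : A → A} {σ' τ' : B → B} (hσ : Involutive σ')
    (hτ : Involutive τ') {j : A → B} (h1 : ∀ x, j (σ x) = σ' (j x))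
    (h2 : ∀ x, j (τ x) = τ' (j x)) (x : A) (y : B) :
    (step σ' ⊔ step τ') (j x) y ↔ ∃ z, j z = y ∧ (step σ ⊔ step τ) x z := by
  have key : ∀ (ρ : A → A) (ρ' : B → B), Involutive ρ' → (∀ x, j (ρ x) = ρ' (j x)) →
      (∀ z, (step σ ⊔ step τ) z (ρ z)) → ∀ w,
      ((ρ' w ∈ {y | ∃ z, j z = y ∧ (step σ ⊔ step τ) x z}) ↔
        w ∈ {y | ∃ z, j z = y ∧ (step σ ⊔ step τ) x z}) := by
    intro ρ ρ' hρ h hr w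
    have : ∀ w, w ∈ {y | ∃ z, j z = y ∧ (step σ ⊔ step τ) x z} →
        ρ' w ∈ {y | ∃ z, j z = y ∧ (step σ ⊔ step τ) x z} := by
      rintro _ ⟨z, rfl, hz⟩
      exact ⟨ρ z, h z, Setoid.trans' _ hz (hr z)⟩
    exact ⟨fun hw => by simpa [hρ w] using this _ hw, this w⟩
  constructor
  · intro h
    exact (rel_mem rfl (key σ σ' hσ h1 (rel_left σ τ)) (key τ τ' hτ h2 (rel_right σ τ)) h).1
      ⟨x, rfl, Setoid.refl' _ x⟩
  · rintro ⟨z, rfl, hz⟩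
    have : step σ ⊔ step τ ≤ Setoid.comap j (step σ' ⊔ step τ') := by
      refine sup_le (step_le.2 fun x => ?_) (step_le.2 fun x => ?_)
      · rw [Setoid.comap_rel, h1]; exact rel_left _ _ _
      · rw [Setoid.comap_rel, h2]; exact rel_right _ _ _
    exact this hz

theorem rel_map_iff' {A B : Type} {σ τ : A → A} {σ' τ' : B → B} (hσ : Involutive σ')
    (hτ : Involutive τ') {j : A → B} (hj : Injective j) (h1 : ∀ x, j (σ x) = σ' (j x))
    (h2 : ∀ x, j (τ x) = τ' (j x)) (x y : A) :
    (step σ' ⊔ step τ') (j x) (j y) ↔ (step σ ⊔ step τ) x y := by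
  rw [rel_map_iff hσ hτ h1 h2]
  exact ⟨fun ⟨z, hz, h⟩ => hj hz ▸ h, fun h => ⟨y, rfl, h⟩⟩

/-- The number of orbits is additive under disjoint unions. -/
theorem numC_sum {A B F : Type} [Finite A] [Finite B] {σ τ : F → F} (hσ : Involutive σ)
    (hτ : Involutive τ) {σ₁ τ₁ : A → A} {σ₂ τ₂ : B → B} (e : A ⊕ B ≃ F)
    (h1 : ∀ x, e (.inl (σ₁ x)) = σ (e (.inl x))) (h2 : ∀ x, e (.inl (τ₁ x)) = τ (e (.inl x)))
    (h3 : ∀ x, e (.inr (σ₂ x)) = σ (e (.inr x))) (h4 : ∀ x, e (.inr (τ₂ x)) = τ (e (.inr x))) :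
    numC (step σ ⊔ step τ) = numC (step σ₁ ⊔ step τ₁) + numC (step σ₂ ⊔ step τ₂) := by
  have i1 : Injective fun x : A => e (.inl x) := e.injective.comp Sum.inl_injective
  have i2 : Injective fun x : B => e (.inr x) := e.injective.comp Sum.inr_injective
  have r1 := rel_map_iff hσ hτ (j := fun x : A => e (.inl x)) h1 h2
  have r2 := rel_map_iff hσ hτ (j := fun x : B => e (.inr x)) h3 h4
  have r1' := rel_map_iff' hσ hτ i1 h1 h2
  have r2' := rel_map_iff' hσ hτ i2 h3 h4
  let f : Quotient (step σ₁ ⊔ step τ₁) ⊕ Quotient (step σ₂ ⊔ step τ₂) →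
      Quotient (step σ ⊔ step τ) :=
    Sum.elim (Quotient.map' (fun x => e (.inl x)) fun x y h => (r1' x y).2 h)
      (Quotient.map' (fun x => e (.inr x)) fun x y h => (r2' x y).2 h)
  have hf : Bijective f := by
    constructor
    · rintro (p | p) (q | q) <;>
      · induction p using Quotient.inductionOn with | _ x => ?_
        induction q using Quotient.inductionOn with | _ y => ?_
        intro h
        have h' := Quotient.exact h
        first
        | exact congrArg Sum.inl (Quotient.sound ((r1' x y).1 h'))
        | exact congrArg Sum.inr (Quotient.sound ((r2' x y).1 h'))
        | (obtain ⟨z, hz, -⟩ := (r1 _ _).1 h'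
           exact absurd (e.injective hz) (by simp))
        | (obtain ⟨z, hz, -⟩ := (r2 _ _).1 h'
           exact absurd (e.injective hz) (by simp))
    · intro q
      induction q using Quotient.inductionOn with | _ x => ?_
      obtain ⟨x | x, rfl⟩ := e.surjective x
      · exact ⟨.inl (Quotient.mk _ x), rfl⟩
      · exact ⟨.inr (Quotient.mk _ x), rfl⟩
  unfold numC
  rw [← Nat.card_congr (Equiv.ofBijective f hf), Nat.card_sum]

theorem step_iff {σ : F → F} (hσ : Involutive σ) {x y : F} : step σ x y ↔ y = x ∨ y = σ x := by
  constructor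
  · intro h
    have := rel_mem (s := step σ) (T := {z | z = x ∨ z = σ x}) (sup_idem (step σ)).symm
      (fun z => ?_) (fun z => ?_) h
    · exact this.1 (Or.inl rfl)
    all_goals
      simp only [Set.mem_ofPred_eq]
      constructor
      · rintro (h | h)
        · exact Or.inr (by rw [← h, hσ])
        · exact Or.inl (hσ.injective h)
      · rintro (rfl | rfl)
        · exact Or.inr rfl
        · exact Or.inl (hσ x)
  · rintro (rfl | rfl)
    · exact Setoid.refl' _ _
    · exact step_rel σ x

/-- Orbits of an involution have two elements, or one if it is a fixed point. -/
theorem two_mul_numC_step [Finite F] {σ : F → F} (hσ : Involutive σ) :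
    2 * numC (step σ) = Nat.card F + {x | σ x = x}.ncard := by
  classical
  have := Fintype.ofFinite F
  have hq : ∀ q : Quotient (step σ), Fintype.card {x // Quotient.mk (step σ) x = q} +
      Fintype.card {x // Quotient.mk (step σ) x = q ∧ σ x = x} = 2 := by
    intro q
    induction q using Quotient.inductionOn with | _ a => ?_
    have e : ∀ x, (Quotient.mk (step σ) x = Quotient.mk (step σ) a) ↔ x = a ∨ x = σ a := fun x =>
      Quotient.eq.trans ((Setoid.comm' _).trans (step_iff hσ))
    simp only [e, Fintype.card_subtype]
    by_cases ha : σ a = a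
    · have h1 : ({x | x = a ∨ x = σ a} : Finset F) = {a} := by ext; simp [ha]
      have h2 : ({x | (x = a ∨ x = σ a) ∧ σ x = x} : Finset F) = {a} := by
        ext x; simp only [ha, or_self, Finset.mem_filter, Finset.mem_univ, true_and,
          Finset.mem_singleton]
        exact ⟨fun h => h.1, fun h => ⟨h, h ▸ ha⟩⟩
      rw [h1, h2]; rfl
    · have h1 : ({x | x = a ∨ x = σ a} : Finset F) = {a, σ a} := by ext; simp
      have h2 : ({x | (x = a ∨ x = σ a) ∧ σ x = x} : Finset F) = ∅ := by
        ext x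
        simp only [Finset.mem_filter, Finset.mem_univ, true_and, Finset.notMem_empty, iff_false]
        rintro ⟨rfl | rfl, h⟩
        · exact ha h
        · exact ha (hσ.injective h)
      rw [h1, h2, Finset.card_pair (Ne.symm ha)]; rfl
  have h1 : Fintype.card F = ∑ q : Quotient (step σ),
      Fintype.card {x // Quotient.mk (step σ) x = q} := by
    rw [← Fintype.card_sigma]
    exact Fintype.card_congr (Equiv.sigmaFiberEquiv _).symm
  have h2 : {x | σ x = x}.ncard = ∑ q : Quotient (step σ),
      Fintype.card {x // Quotient.mk (step σ) x = q ∧ σ x = x} := by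
    rw [← Fintype.card_sigma, ← Nat.card_coe_set_eq, Nat.card_eq_fintype_card]
    refine Fintype.card_congr
      { toFun := fun x => ⟨Quotient.mk _ x.1, x.1, rfl, x.2⟩
        invFun := fun p => ⟨p.2.1, p.2.2.2⟩
        left_inv := fun x => rfl
        right_inv := ?_ }
    rintro ⟨q, x, rfl, hx⟩
    rfl
  rw [numC, Nat.card_eq_fintype_card, Nat.card_eq_fintype_card, h1, h2, ← Finset.sum_add_distrib,
    Finset.sum_congr rfl fun q _ => hq q]
  simp [mul_comm]

/-! ### Orbits of two involutions through a fixed point -/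

/-- The walk from `x` that applies `τ` and `σ` alternately, beginning with `τ`. -/
def walk (σ τ : F → F) (x : F) : ℕ → F
  | 0 => x
  | n + 1 => if Even n then τ (walk σ τ x n) else σ (walk σ τ x n)

theorem walk_even (σ τ : F → F) (x : F) {n : ℕ} (h : Even n) :
    walk σ τ x (n + 1) = τ (walk σ τ x n) := by simp [walk, h]

theorem walk_odd (σ τ : F → F) (x : F) {n : ℕ} (h : ¬ Even n) :
    walk σ τ x (n + 1) = σ (walk σ τ x n) := by simp [walk, h]

/-- A walk that starts at a fixed point of `σ` does not meet itself before it stops. -/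
theorem walk_ne {σ τ : F → F} (hσ : Involutive σ) (hτ : Involutive τ) {x : F} (hx : σ x = x)
    {m : ℕ} (hm : ∀ j < m, walk σ τ x (j + 1) ≠ walk σ τ x j) :
    ∀ i j, i < j → j ≤ m → walk σ τ x i ≠ walk σ τ x j := by
  have back : ∀ i j, (Even i ↔ Even j) → walk σ τ x (i + 1) = walk σ τ x (j + 1) →
      walk σ τ x i = walk σ τ x j := by
    intro i j hij e
    by_cases hi : Even i
    · rw [walk_even _ _ _ hi, walk_even _ _ _ (hij.1 hi)] at e
      exact hτ.injective e
    · rw [walk_odd _ _ _ hi, walk_odd _ _ _ (fun h => hi (hij.2 h))] at e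
      exact hσ.injective e
  have opp : ∀ d i, i + 2 * d + 1 ≤ m → walk σ τ x i ≠ walk σ τ x (i + 2 * d + 1) := by
    intro d
    induction d with
    | zero => intro i hi; exact (hm i (by omega)).symm
    | succ d ih =>
      intro i hi e
      refine ih (i + 1) (by omega) ?_
      have hp : (Even i ↔ Even (i + 2 * (d + 1))) := by
        simp [Nat.even_add]
      have e2 : i + 1 + 2 * d + 1 = i + 2 * (d + 1) := by ring
      rw [e2]
      by_cases hi : Even i
      · rw [walk_even _ _ _ (hp.1 hi)] at e
        rw [walk_even _ _ _ hi, e, hτ]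
      · rw [walk_odd _ _ _ (fun h => hi (hp.2 h))] at e
        rw [walk_odd _ _ _ hi, e, hσ]
  have same : ∀ i d, i + 2 * (d + 1) ≤ m → walk σ τ x i ≠ walk σ τ x (i + 2 * (d + 1)) := by
    intro i
    induction i with
    | zero =>
      intro d hd e
      have e2 : 0 + 2 * (d + 1) = (2 * d + 1) + 1 := by ring
      have ho : ¬ Even (2 * d + 1) := by simp
      rw [e2] at e
      refine hm (2 * d + 1) (by omega) (e.symm.trans ?_)
      rw [walk_odd _ _ _ ho] at e
      have e3 : walk σ τ x (2 * d + 1) = x := by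
        apply hσ.injective; rw [← e]; exact hx.symm
      rw [e3]; rfl
    | succ i ih =>
      intro d hd e
      refine ih d (by omega) (back _ _ (by simp [Nat.even_add]) ?_)
      rw [e]; congr 1; ring
  intro i j hij hj
  rcases Nat.even_or_odd' (j - i) with ⟨d, hd | hd⟩
  · obtain ⟨d, rfl⟩ : ∃ d', d = d' + 1 := ⟨d - 1, by omega⟩
    have : j = i + 2 * (d + 1) := by omega
    subst this; exact same i d hj
  · have : j = i + 2 * d + 1 := by omega
    subst this; exact opp d i hj

/-- If the walk stops, it has run through the whole orbit. -/
theorem rel_iff_walk {σ τ : F → F} (hσ : Involutive σ) (hτ : Involutive τ) {x : F} (hx : σ x = x)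
    {m : ℕ} (hm : walk σ τ x (m + 1) = walk σ τ x m) (y : F) :
    (step σ ⊔ step τ) x y ↔ ∃ j ≤ m, walk σ τ x j = y := by
  constructor
  · have key : ∀ ρ : F → F, Involutive ρ → (∀ j ≤ m, ∃ i ≤ m, walk σ τ x i = ρ (walk σ τ x j)) →
        ∀ y, ρ y ∈ {y | ∃ j ≤ m, walk σ τ x j = y} ↔ y ∈ {y | ∃ j ≤ m, walk σ τ x j = y} := by
      intro ρ hρ h y
      have h' : ∀ y, y ∈ {y | ∃ j ≤ m, walk σ τ x j = y} →
          ρ y ∈ {y | ∃ j ≤ m, walk σ τ x j = y} := by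
        rintro _ ⟨j, hj, rfl⟩; exact h j hj
      exact ⟨fun hy => by simpa [hρ y] using h' _ hy, h' y⟩
    intro h
    refine (rel_mem rfl (key σ hσ ?_) (key τ hτ ?_) h).1 ⟨0, by omega, rfl⟩
    · intro j hj
      by_cases h : Even j
      · rcases j with _ | j
        · exact ⟨0, by omega, hx.symm⟩
        · refine ⟨j, by omega, ?_⟩
          rw [walk_odd _ _ _ (by simpa [Nat.even_add_one] using h), hσ]
      · rcases hj.eq_or_lt with rfl | hj
        · refine ⟨j, le_rfl, ?_⟩
          rw [← walk_odd σ τ x h, hm]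
        · exact ⟨j + 1, hj, walk_odd _ _ _ h⟩
    · intro j hj
      by_cases h : Even j
      · rcases hj.eq_or_lt with rfl | hj
        · refine ⟨j, le_rfl, ?_⟩
          rw [← walk_even σ τ x h, hm]
        · exact ⟨j + 1, hj, walk_even _ _ _ h⟩
      · rcases j with _ | j
        · simp at h
        · refine ⟨j, by omega, ?_⟩
          rw [walk_even _ _ _ (by simpa [Nat.even_add_one] using h), hτ]
  · rintro ⟨j, -, rfl⟩
    induction j with
    | zero => exact Setoid.refl' _ _
    | succ j ih =>
      refine Setoid.trans' _ ih ?_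
      by_cases h : Even j
      · rw [walk_even _ _ _ h]; exact rel_right _ _ _
      · rw [walk_odd _ _ _ h]; exact rel_left _ _ _

theorem exists_walk_stop [Finite F] {σ τ : F → F} (hσ : Involutive σ) (hτ : Involutive τ) {x : F}
    (hx : σ x = x) : ∃ m, walk σ τ x (m + 1) = walk σ τ x m ∧
      ∀ j < m, walk σ τ x (j + 1) ≠ walk σ τ x j := by
  classical
  have h : ∃ m, walk σ τ x (m + 1) = walk σ τ x m := by
    by_contra! h
    refine not_injective_infinite_finite (walk σ τ x) fun i j e => ?_
    by_contra hij
    rcases Nat.lt_or_gt_of_ne hij with hij | hij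
    · exact walk_ne hσ hτ hx (m := j) (fun _ _ => h _) i j hij le_rfl e
    · exact walk_ne hσ hτ hx (m := i) (fun _ _ => h _) j i hij le_rfl e.symm
  exact ⟨Nat.find h, Nat.find_spec h, fun j hj => Nat.find_min h hj⟩

theorem walk_ncard {σ τ : F → F} (hσ : Involutive σ) (hτ : Involutive τ) {x : F}
    (hx : σ x = x) {m : ℕ} (hm : walk σ τ x (m + 1) = walk σ τ x m)
    (hm' : ∀ j < m, walk σ τ x (j + 1) ≠ walk σ τ x j) :
    {y | (step σ ⊔ step τ) x y}.ncard = m + 1 := by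
  have h : {y | (step σ ⊔ step τ) x y} = walk σ τ x '' (Finset.range (m + 1) : Set ℕ) := by
    ext y
    rw [Set.mem_ofPred_eq, rel_iff_walk hσ hτ hx hm]
    simp
  rw [h, Set.InjOn.ncard_image, Set.ncard_coe_finset, Finset.card_range]
  intro i hi j hj e
  simp only [Finset.coe_range, Set.mem_Iio] at hi hj
  by_contra hij
  rcases Nat.lt_or_gt_of_ne hij with hij | hij
  · exact walk_ne hσ hτ hx hm' i j hij (by omega) e
  · exact walk_ne hσ hτ hx hm' j i hij (by omega) e.symm

/-- The orbit of a fixed point of `σ` under two involutions is a path. At its other end there is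
a fixed point of `τ` if the orbit is odd, and of `σ` if it is even; there are no further fixed
points. In the even case the two ends have different colours in a 2-colouring of the path. -/
theorem path_ends [Finite F] {σ τ : F → F} (hσ : Involutive σ) (hτ : Involutive τ) {x : F}
    (hx : σ x = x) :
    (∃ z, (step σ ⊔ step τ) x z ∧ Odd {y | (step σ ⊔ step τ) x y}.ncard ∧
      ∀ y, (step σ ⊔ step τ) x y → (σ y = y ↔ y = x) ∧ (τ y = y ↔ y = z)) ∨
    (∃ z, (step σ ⊔ step τ) x z ∧ z ≠ x ∧ Even {y | (step σ ⊔ step τ) x y}.ncard ∧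
      (∀ y, (step σ ⊔ step τ) x y → (σ y = y ↔ y = x ∨ y = z) ∧ τ y ≠ y) ∧
      ∀ c : F → Bool, (∀ y, (σ y ≠ y → c (σ y) ≠ c y) ∧ (τ y ≠ y → c (τ y) ≠ c y)) →
        c z ≠ c x) := by
  obtain ⟨m, hm, hm'⟩ := exists_walk_stop (τ := τ) hσ hτ hx
  have hc := walk_ncard hσ hτ hx hm hm'
  have hr := rel_iff_walk hσ hτ hx hm
  set w := walk σ τ x with hw
  have ne := walk_ne hσ hτ hx hm'
  have hend : (step σ ⊔ step τ) x (w m) := (hr _).2 ⟨m, le_rfl, rfl⟩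
  have f1 : ∀ j ≤ m, (w j = x ↔ j = 0) := fun j hj =>
    ⟨fun e => by
      by_contra h0
      exact ne 0 j (by omega) hj e.symm, fun e => by rw [e, hw]; rfl⟩
  have f2 : ∀ j ≤ m, (w j = w m ↔ j = m) := fun j hj =>
    ⟨fun e => by
      by_contra h0
      exact ne j m (by omega) le_rfl e, fun e => by rw [e]⟩
  have g1 : ∀ j ≤ m, ¬ Even j → (σ (w j) = w j ↔ j = m) := fun j hj h => by
    rw [hw, ← walk_odd σ τ x h]
    rcases hj.eq_or_lt with rfl | hj
    · simpa using hm
    · exact ⟨fun e => absurd e (hm' j hj), fun e => by omega⟩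
  have g2 : ∀ j ≤ m, Even j → (τ (w j) = w j ↔ j = m) := fun j hj h => by
    rw [hw, ← walk_even σ τ x h]
    rcases hj.eq_or_lt with rfl | hj
    · simpa using hm
    · exact ⟨fun e => absurd e (hm' j hj), fun e => by omega⟩
  have g3 : ∀ j ≤ m, Even j → (σ (w j) = w j ↔ j = 0) := fun j hj h => by
    rcases j with _ | j
    · simp only [iff_true]; exact hx
    · have : ¬ Even j := by simpa [Nat.even_add_one] using h
      rw [hw, walk_odd _ _ _ this, hσ]
      exact ⟨fun e => absurd (e.trans (walk_odd _ _ _ this).symm).symm (hm' j (by omega)),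
        fun e => by omega⟩
  have g4 : ∀ j ≤ m, ¬ Even j → τ (w j) ≠ w j := fun j hj h => by
    rcases j with _ | j
    · simp at h
    · have : Even j := by simpa [Nat.even_add_one] using h
      rw [hw, walk_even _ _ _ this, hτ]
      exact fun e => hm' j (by omega) ((walk_even _ _ _ this).trans e.symm)
  by_cases hp : Even m
  · refine Or.inl ⟨w m, hend, by rw [hc]; exact hp.add_one, fun y hy => ?_⟩
    obtain ⟨j, hj, rfl⟩ := (hr y).1 hy
    rw [f1 j hj, f2 j hj]
    by_cases h : Even j
    · exact ⟨g3 j hj h, g2 j hj h⟩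
    · have : j ≠ m := fun e => h (e ▸ hp)
      refine ⟨?_, ?_⟩
      · rw [g1 j hj h]; exact ⟨fun e => absurd e this, fun e => by subst e; simp at h⟩
      · exact ⟨fun e => absurd e (g4 j hj h), fun e => absurd e this⟩
  · refine Or.inr ⟨w m, hend, ?_, ?_, fun y hy => ?_, fun c hcol => ?_⟩
    · rw [Ne, f1 m le_rfl]; rintro rfl; simp at hp
    · rw [hc]; exact (Nat.not_even_iff_odd.1 hp).add_one
    · obtain ⟨j, hj, rfl⟩ := (hr y).1 hy
      rw [f1 j hj, f2 j hj]
      by_cases h : Even j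
      · have : j ≠ m := fun e => hp (e ▸ h)
        exact ⟨(g3 j hj h).trans (by simp [this]), fun e => this ((g2 j hj h).1 e)⟩
      · exact ⟨(g1 j hj h).trans ⟨Or.inr, by rintro (rfl | e); simp at h; exact e⟩, g4 j hj h⟩
    · have : ∀ j ≤ m, c (w j) = if Even j then c x else !(c x) := by
        intro j
        induction j with
        | zero => intro _; simp; rfl
        | succ j ih =>
          intro hj
          have ne := hm' j (by omega)
          by_cases h : Even j
          · rw [hw, walk_even _ _ _ h] at ne
            have := (hcol _).2 ne
            rw [← hw, ih (by omega)] at this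
            rw [hw, walk_even _ _ _ h, ← hw]
            simp only [h, if_true, Nat.even_add_one, not_true, if_false] at this ⊢
            revert this; generalize c (τ (w j)) = p; cases p <;> cases c x <;> simp
          · rw [hw, walk_odd _ _ _ h] at ne
            have := (hcol _).1 ne
            rw [← hw, ih (by omega)] at this
            rw [hw, walk_odd _ _ _ h, ← hw]
            simp only [h, if_false, Nat.even_add_one, not_false_eq_true, if_true] at this ⊢
            revert this; generalize c (σ (w j)) = p; cases p <;> cases c x <;> simp
      rw [this m le_rfl]
      simp [hp]

end Setoids

/-! ### Maps with folded edges, not necessarily connected -/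

/-- A map, possibly with boundary and not necessarily connected, given by its flags as in
`FlagMap`, in which *folded* edges are also allowed: these consist of two flags `f`, `r0 f = r2 f`.
Around its vertex and along its face, a folded edge merely sits between two consecutive flags,
so it does not change the surface; it serves to mark a corner. -/
@[ext]
structure PMap (F : Type) where
  r0 : F → F
  r1 : F → F
  r2 : F → F
  i0 : Involutive r0
  i1 : Involutive r1
  i2 : Involutive r2
  comm : ∀ f, r0 (r2 f) = r2 (r0 f)
  nofix : ∀ f, r0 f = f → r2 f ≠ f

namespace PMap

variable {F A B : Type}

/-- Two flags are equivalent if they lie at the same vertex. -/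
def vs (M : PMap F) : Setoid F := step M.r1 ⊔ step M.r2

/-- Two flags are equivalent if they lie at the same edge. -/
def es (M : PMap F) : Setoid F := step M.r0 ⊔ step M.r2

/-- Two flags are equivalent if they lie in the same face. -/
def fs (M : PMap F) : Setoid F := step M.r0 ⊔ step M.r1

/-- Two flags are equivalent if they lie in the same connected component. -/
def cs (M : PMap F) : Setoid F := step M.r0 ⊔ (step M.r1 ⊔ step M.r2)

/-- The surface is connected. -/
def Conn (M : PMap F) : Prop := ∀ x y, M.cs x y

/-- The Euler characteristic. -/
noncomputable def chi (M : PMap F) : ℤ :=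
  ((numC M.vs : ℤ) + numC M.es + numC M.fs)
    - ((numC (step M.r0) : ℤ) + numC (step M.r1) + numC (step M.r2)) + Nat.card F

/-- `c` is a 2-colouring of the flags in which neighbours have different colours. -/
def IsCol (M : PMap F) (c : F → Bool) : Prop :=
  ∀ f, (M.r0 f ≠ f → c (M.r0 f) ≠ c f) ∧ (M.r1 f ≠ f → c (M.r1 f) ≠ c f) ∧
    (M.r2 f ≠ f → c (M.r2 f) ≠ c f)

/-- The surface is orientable. -/
def Ori (M : PMap F) : Prop := ∃ c, M.IsCol c

/-- The surface is a disk. That it has a boundary need not be required: a triangulated closed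
orientable surface has even Euler characteristic. In the counts below, a disk comes with a flag next
to the boundary anyway. -/
def Disk (M : PMap F) : Prop := M.Conn ∧ M.Ori ∧ M.chi = 1

/-- The surface is a sphere. It has no boundary, by `chi_le`. -/
def Sph (M : PMap F) : Prop := M.Conn ∧ M.Ori ∧ M.chi = 2

/-- The flags of the folded edges. -/
def fold (M : PMap F) : Set F := {f | M.r0 f = M.r2 f}

/-- The number of ends of boundary edges at the vertex of `f`. -/
noncomputable def be (M : PMap F) (f : F) : ℕ := {g | M.vs f g ∧ M.r2 g = g}.ncard

/-- The number of flags on inner darts at the vertex of `f`. -/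
noncomputable def inn (M : PMap F) (f : F) : ℕ := {g | M.vs f g ∧ M.r2 g ≠ g}.ncard

/-- The map `j` of flags is a morphism. -/
structure Hom (M : PMap A) (N : PMap B) (j : A → B) : Prop where
  h0 : ∀ x, j (M.r0 x) = N.r0 (j x)
  h1 : ∀ x, j (M.r1 x) = N.r1 (j x)
  h2 : ∀ x, j (M.r2 x) = N.r2 (j x)

theorem cs_r0 (M : PMap F) (x : F) : M.cs x (M.r0 x) := (le_sup_left : step M.r0 ≤ _) (step_rel _ x)

theorem vs_le_cs (M : PMap F) : M.vs ≤ M.cs := le_sup_right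

theorem vs_r1 (M : PMap F) (x : F) : M.vs x (M.r1 x) := rel_left _ _ x

theorem vs_r2 (M : PMap F) (x : F) : M.vs x (M.r2 x) := rel_right _ _ x

theorem cs_r1 (M : PMap F) (x : F) : M.cs x (M.r1 x) := M.vs_le_cs (M.vs_r1 x)

theorem cs_r2 (M : PMap F) (x : F) : M.cs x (M.r2 x) := M.vs_le_cs (M.vs_r2 x)

theorem cs_le {M : PMap F} {s : Setoid F} (h0 : ∀ x, s x (M.r0 x)) (h1 : ∀ x, s x (M.r1 x))
    (h2 : ∀ x, s x (M.r2 x)) : M.cs ≤ s :=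
  sup_le (step_le.2 h0) (sup_le (step_le.2 h1) (step_le.2 h2))

theorem cs_mem {M : PMap F} {T : Set F} (h0 : ∀ x ∈ T, M.r0 x ∈ T) (h1 : ∀ x ∈ T, M.r1 x ∈ T)
    (h2 : ∀ x ∈ T, M.r2 x ∈ T) {x y : F} (h : M.cs x y) : x ∈ T ↔ y ∈ T := by
  have : M.cs ≤ Setoid.ker (fun x => x ∈ T) :=
    cs_le (fun x => propext ⟨h0 x, fun h => by simpa [M.i0 x] using h0 _ h⟩)
      (fun x => propext ⟨h1 x, fun h => by simpa [M.i1 x] using h1 _ h⟩)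
      (fun x => propext ⟨h2 x, fun h => by simpa [M.i2 x] using h2 _ h⟩)
  exact iff_of_eq (this h)

namespace Hom

variable {M : PMap A} {N : PMap B} {j : A → B}

theorem cs_iff (h : Hom M N j) (x : A) (y : B) : N.cs (j x) y ↔ ∃ z, j z = y ∧ M.cs x z := by
  constructor
  · intro hy
    refine (cs_mem (T := {y | ∃ z, j z = y ∧ M.cs x z}) ?_ ?_ ?_ hy).1 ⟨x, rfl, Setoid.refl' _ _⟩
    · rintro _ ⟨z, rfl, hz⟩; exact ⟨M.r0 z, h.h0 z, Setoid.trans' _ hz (M.cs_r0 z)⟩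
    · rintro _ ⟨z, rfl, hz⟩; exact ⟨M.r1 z, h.h1 z, Setoid.trans' _ hz (M.cs_r1 z)⟩
    · rintro _ ⟨z, rfl, hz⟩; exact ⟨M.r2 z, h.h2 z, Setoid.trans' _ hz (M.cs_r2 z)⟩
  · rintro ⟨z, rfl, hz⟩
    have : M.cs ≤ Setoid.comap j N.cs :=
      cs_le (fun x => by rw [Setoid.comap_rel, h.h0]; exact N.cs_r0 _)
        (fun x => by rw [Setoid.comap_rel, h.h1]; exact N.cs_r1 _)
        (fun x => by rw [Setoid.comap_rel, h.h2]; exact N.cs_r2 _)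
    exact this hz

theorem vs_iff (h : Hom M N j) (x : A) (y : B) : N.vs (j x) y ↔ ∃ z, j z = y ∧ M.vs x z :=
  rel_map_iff N.i1 N.i2 h.h1 h.h2 x y

theorem vs_iff' (h : Hom M N j) (hj : Injective j) (x y : A) : N.vs (j x) (j y) ↔ M.vs x y :=
  rel_map_iff' N.i1 N.i2 hj h.h1 h.h2 x y

theorem cs_iff' (h : Hom M N j) (hj : Injective j) (x y : A) : N.cs (j x) (j y) ↔ M.cs x y := by
  rw [h.cs_iff]
  exact ⟨fun ⟨z, hz, h⟩ => hj hz ▸ h, fun h => ⟨y, rfl, h⟩⟩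

theorem vs_set (h : Hom M N j) (x : A) (p : B → Prop) :
    {g | N.vs (j x) g ∧ p g} = j '' {g | M.vs x g ∧ p (j g)} := by
  ext y
  constructor
  · rintro ⟨hy, hp⟩
    obtain ⟨z, rfl, hz⟩ := (h.vs_iff x y).1 hy
    exact ⟨z, ⟨hz, hp⟩, rfl⟩
  · rintro ⟨z, ⟨hz, hp⟩, rfl⟩
    exact ⟨(h.vs_iff x _).2 ⟨z, rfl, hz⟩, hp⟩

theorem be_eq (h : Hom M N j) (hj : Injective j) (x : A) : N.be (j x) = M.be x := by
  rw [be, h.vs_set x, Set.ncard_image_of_injective _ hj, be]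
  simp only [← h.h2, hj.eq_iff]

theorem inn_eq (h : Hom M N j) (hj : Injective j) (x : A) : N.inn (j x) = M.inn x := by
  rw [inn, h.vs_set x, Set.ncard_image_of_injective _ hj, inn]
  simp only [ne_eq, ← h.h2, hj.eq_iff]

theorem mem_fold (h : Hom M N j) (hj : Injective j) (x : A) : j x ∈ N.fold ↔ x ∈ M.fold := by
  change N.r0 (j x) = N.r2 (j x) ↔ _
  rw [← h.h0, ← h.h2, hj.eq_iff]
  rfl

theorem isCol (h : Hom M N j) {c : B → Bool} (hj : Injective j) (hc : N.IsCol c) :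
    M.IsCol (c ∘ j) := by
  intro x
  obtain ⟨h0, h1, h2⟩ := hc (j x)
  simp only [← h.h0, ← h.h1, ← h.h2, ne_eq, hj.eq_iff] at h0 h1 h2
  exact ⟨h0, h1, h2⟩

theorem ori (h : Hom M N j) (hj : Injective j) : N.Ori → M.Ori := fun ⟨c, hc⟩ =>
  ⟨c ∘ j, h.isCol hj hc⟩

theorem comp {C : Type} {L : PMap C} {k : B → C} (h : Hom M N j) (h' : Hom N L k) :
    Hom M L (k ∘ j) :=
  ⟨fun x => by simp [h.h0, h'.h0], fun x => by simp [h.h1, h'.h1], fun x => by simp [h.h2, h'.h2]⟩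

end Hom

theorem Hom.symm {M : PMap A} {N : PMap B} {e : A ≃ B} (h : Hom M N e) : Hom N M e.symm :=
  ⟨fun x => by rw [Equiv.symm_apply_eq, h.h0, e.apply_symm_apply],
    fun x => by rw [Equiv.symm_apply_eq, h.h1, e.apply_symm_apply],
    fun x => by rw [Equiv.symm_apply_eq, h.h2, e.apply_symm_apply]⟩

section Iso

variable {M : PMap A} {N : PMap B} {e : A ≃ B}

theorem Hom.conn_iff (h : Hom M N e) : N.Conn ↔ M.Conn := by
  constructor
  · intro H x y; exact (h.cs_iff' e.injective x y).1 (H _ _)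
  · intro H x y
    obtain ⟨x, rfl⟩ := e.surjective x
    obtain ⟨y, rfl⟩ := e.surjective y
    exact (h.cs_iff' e.injective x y).2 (H _ _)

theorem Hom.chi_eq (h : Hom M N e) : N.chi = M.chi := by
  have c : ∀ {σ τ : A → A} {σ' τ' : B → B}, Involutive σ' → Involutive τ' →
      (∀ x, e (σ x) = σ' (e x)) → (∀ x, e (τ x) = τ' (e x)) →
      numC (step σ ⊔ step τ) = numC (step σ' ⊔ step τ') := fun hσ hτ h1 h2 =>
    numC_congr e (rel_map_iff' hσ hτ e.injective h1 h2)
      fun b => ⟨e.symm b, by rw [e.apply_symm_apply]⟩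
  have c0 := c N.i0 N.i0 h.h0 h.h0
  have c1 := c N.i1 N.i1 h.h1 h.h1
  have c2 := c N.i2 N.i2 h.h2 h.h2
  simp only [sup_idem] at c0 c1 c2
  unfold chi vs es fs
  rw [c0, c1, c2, c N.i1 N.i2 h.h1 h.h2, c N.i0 N.i2 h.h0 h.h2, c N.i0 N.i1 h.h0 h.h1,
    Nat.card_congr e]

theorem Hom.ori_iff (h : Hom M N e) : N.Ori ↔ M.Ori :=
  ⟨h.ori e.injective, h.symm.ori e.symm.injective⟩

theorem Hom.disk_iff (h : Hom M N e) : N.Disk ↔ M.Disk := by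
  rw [Disk, Disk, h.conn_iff, h.ori_iff, h.chi_eq]

theorem Hom.sph_iff (h : Hom M N e) : N.Sph ↔ M.Sph := by
  rw [Sph, Sph, h.conn_iff, h.ori_iff, h.chi_eq]

/-- Transport of a map along a relabelling of the flags. -/
def map (M : PMap A) (e : A ≃ B) : PMap B where
  r0 x := e (M.r0 (e.symm x))
  r1 x := e (M.r1 (e.symm x))
  r2 x := e (M.r2 (e.symm x))
  i0 x := by simp [M.i0 _]
  i1 x := by simp [M.i1 _]
  i2 x := by simp [M.i2 _]
  comm x := by simp [M.comm]
  nofix x := by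
    simp only [← e.eq_symm_apply, ne_eq]
    exact M.nofix _

theorem hom_map (M : PMap A) (e : A ≃ B) : Hom M (M.map e) e :=
  ⟨fun x => by simp [map], fun x => by simp [map], fun x => by simp [map]⟩

end Iso

/-! ### The Euler characteristic of a connected map is at most two -/

/-- The Euler characteristic of a connected surface is at most `2`, and at most `1` if there is
a boundary. With coefficients in `ZMod 2`, the cochain complex `C⁰ → C¹ → C²` of the triangulation
has one-dimensional kernel on the left and a cokernel of dimension at most one on the right, which
vanishes if there is a boundary. -/
theorem chi_le [Finite F] (M : PMap F) (hM : M.Conn) (f₀ : F) :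
    M.chi ≤ 2 ∧ ((∃ f, M.r0 f = f ∨ M.r1 f = f ∨ M.r2 f = f) → M.chi ≤ 1) := by
  classical
  have := Fintype.ofFinite F
  have := Fintype.ofFinite (Quotient M.vs)
  have := Fintype.ofFinite (Quotient M.es)
  have := Fintype.ofFinite (Quotient M.fs)
  have := Fintype.ofFinite (Quotient (step M.r0))
  have := Fintype.ofFinite (Quotient (step M.r1))
  have := Fintype.ofFinite (Quotient (step M.r2))
  -- corners at the ends of the side opposite to the vertex, edge, face corner
  let p0E : Quotient (step M.r0) → Quotient M.es := Quotient.map' id fun _ _ h =>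
    (le_sup_left : step M.r0 ≤ M.es) h
  let p0G : Quotient (step M.r0) → Quotient M.fs := Quotient.map' id fun _ _ h =>
    (le_sup_left : step M.r0 ≤ M.fs) h
  let p1V : Quotient (step M.r1) → Quotient M.vs := Quotient.map' id fun _ _ h =>
    (le_sup_left : step M.r1 ≤ M.vs) h
  let p1G : Quotient (step M.r1) → Quotient M.fs := Quotient.map' id fun _ _ h =>
    (le_sup_right : step M.r1 ≤ M.fs) h
  let p2V : Quotient (step M.r2) → Quotient M.vs := Quotient.map' id fun _ _ h =>
    (le_sup_right : step M.r2 ≤ M.vs) h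
  let p2E : Quotient (step M.r2) → Quotient M.es := Quotient.map' id fun _ _ h =>
    (le_sup_right : step M.r2 ≤ M.es) h
  -- the coboundary maps `d : C⁰ → C¹` and `L : C¹ → C²`
  let d : (Quotient M.vs ⊕ Quotient M.es ⊕ Quotient M.fs → ZMod 2) →ₗ[(ZMod 2)]
      ((Quotient (step M.r0) ⊕ Quotient (step M.r1) ⊕ Quotient (step M.r2)) → ZMod 2) :=
    { toFun := fun φ => Sum.elim (fun s => φ (.inr (.inl (p0E s))) - φ (.inr (.inr (p0G s))))
        (Sum.elim (fun s => φ (.inr (.inr (p1G s))) - φ (.inl (p1V s)))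
          (fun s => φ (.inl (p2V s)) - φ (.inr (.inl (p2E s)))))
      map_add' := by
        intro φ ψ; ext (s | s | s) <;> simp <;> ring
      map_smul' := by
        intro a φ; ext (s | s | s) <;> simp <;> ring }
  let L : ((Quotient (step M.r0) ⊕ Quotient (step M.r1) ⊕ Quotient (step M.r2)) → ZMod 2)
      →ₗ[(ZMod 2)] (F → ZMod 2) :=
    { toFun := fun ψ f => ψ (.inl (Quotient.mk _ f)) + ψ (.inr (.inl (Quotient.mk _ f))) +
        ψ (.inr (.inr (Quotient.mk _ f)))
      map_add' := by
        intro φ ψ; ext f; simp; ring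
      map_smul' := by
        intro a φ; ext f; simp; ring }
  have hLd : LinearMap.range d ≤ LinearMap.ker L := by
    rintro _ ⟨φ, rfl⟩
    ext f
    change (φ (.inr (.inl (Quotient.mk _ f))) - φ (.inr (.inr (Quotient.mk _ f)))) +
      (φ (.inr (.inr (Quotient.mk _ f))) - φ (.inl (Quotient.mk _ f))) +
      (φ (.inl (Quotient.mk _ f)) - φ (.inr (.inl (Quotient.mk _ f)))) = 0
    ring
  have hkd : Module.finrank (ZMod 2) (LinearMap.ker d) ≤ 1 := by
    let ev : LinearMap.ker d →ₗ[(ZMod 2)] (ZMod 2) :=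
      (LinearMap.proj (.inl (Quotient.mk _ f₀) :
        Quotient M.vs ⊕ Quotient M.es ⊕ Quotient M.fs)).comp (Submodule.subtype _)
    have hev : Injective ev := by
      rw [← LinearMap.ker_eq_bot, LinearMap.ker_eq_bot']
      rintro ⟨φ, hφ⟩ h0
      have h0' : φ (.inl (Quotient.mk _ f₀)) = 0 := h0
      have hd : ∀ s, d φ s = 0 := fun s => congrFun hφ s
      have e0 : ∀ f, φ (.inr (.inl (Quotient.mk _ f))) = φ (.inr (.inr (Quotient.mk _ f))) :=
        fun f => sub_eq_zero.1 (hd (.inl (Quotient.mk _ f)))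
      have e1 : ∀ f, φ (.inr (.inr (Quotient.mk _ f))) = φ (.inl (Quotient.mk _ f)) :=
        fun f => sub_eq_zero.1 (hd (.inr (.inl (Quotient.mk _ f))))
      have hc : M.cs ≤ Setoid.ker fun f => φ (.inl (Quotient.mk _ f)) := by
        refine cs_le (fun f => ?_) (fun f => ?_) (fun f => ?_)
        · change φ (.inl (Quotient.mk _ f)) = φ (.inl (Quotient.mk _ (M.r0 f)))
          rw [← e1, ← e1]
          exact congrArg (fun q => φ (.inr (.inr q))) (Quotient.sound (rel_left _ _ f))
        · exact congrArg (fun q => φ (.inl q)) (Quotient.sound (M.vs_r1 f))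
        · exact congrArg (fun q => φ (.inl q)) (Quotient.sound (M.vs_r2 f))
      have hz : ∀ f, φ (.inl (Quotient.mk _ f)) = 0 := fun f => (hc (hM f₀ f)).symm.trans h0'
      refine Subtype.ext (funext ?_)
      rintro (q | q | q) <;> induction q using Quotient.inductionOn with | _ f => ?_
      · exact hz f
      · exact (e0 f).trans ((e1 f).trans (hz f))
      · exact (e1 f).trans (hz f)
    simpa using LinearMap.finrank_le_finrank_of_injective hev
  -- functionals that vanish on the image of `L` have equal values at neighbouring flags
  have key : ∀ l ∈ (LinearMap.range L).dualAnnihilator,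
      (∀ f g, l (Pi.single f 1) = l (Pi.single g 1)) ∧
      ((∃ f, M.r0 f = f ∨ M.r1 f = f ∨ M.r2 f = f) → ∃ f, l (Pi.single f 1) = 0) := by
    intro l hl
    have hl' : ∀ ψ, l (L ψ) = 0 := fun ψ =>
      (Submodule.mem_dualAnnihilator l).1 hl _ ⟨ψ, rfl⟩
    have nb : ∀ (r : F → F), Involutive r → ∀ (i : Quotient (step r) →
        Quotient (step M.r0) ⊕ Quotient (step M.r1) ⊕ Quotient (step M.r2)),
        (∀ f g, L (Pi.single (i (Quotient.mk _ f)) 1) g =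
          if (Quotient.mk (step r) g) = Quotient.mk _ f then 1 else 0) →
        ∀ f, (r f = f → l (Pi.single f 1) = 0) ∧ l (Pi.single f 1) = l (Pi.single (r f) 1) := by
      intro r hr i hi f
      have e : ∀ g, (Quotient.mk (step r) g = Quotient.mk (step r) f) ↔ g = f ∨ g = r f := fun g =>
        Quotient.eq.trans ((Setoid.comm' _).trans (step_iff hr))
      have h0 := hl' (Pi.single (i (Quotient.mk _ f)) 1)
      by_cases hf : r f = f
      · rw [hf]
        refine ⟨fun _ => ?_, rfl⟩
        convert h0 using 2
        ext g
        simp [hi, e g, hf, Pi.single_apply]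
      · refine ⟨fun h => absurd h hf, ?_⟩
        have : L (Pi.single (i (Quotient.mk _ f)) 1) = Pi.single f 1 + Pi.single (r f) 1 := by
          ext g
          rw [hi, if_congr (e g) rfl rfl, Pi.add_apply, Pi.single_apply, Pi.single_apply]
          by_cases h1 : g = f
          · subst h1; simp [Ne.symm hf]
          · simp [h1]
        rw [this, map_add] at h0
        exact CharTwo.add_eq_zero.1 h0
    have n0 := nb M.r0 M.i0 .inl (fun f g => by simp [L, Pi.single_apply])
    have n1 := nb M.r1 M.i1 (.inr ∘ .inl) (fun f g => by simp [L, Pi.single_apply])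
    have n2 := nb M.r2 M.i2 (.inr ∘ .inr) (fun f g => by simp [L, Pi.single_apply])
    constructor
    · intro f g
      have : M.cs ≤ Setoid.ker fun f => l (Pi.single f 1) :=
        cs_le (fun f => (n0 f).2) (fun f => (n1 f).2) (fun f => (n2 f).2)
      exact this (hM f g)
    · rintro ⟨f, h | h | h⟩
      · exact ⟨f, (n0 f).1 h⟩
      · exact ⟨f, (n1 f).1 h⟩
      · exact ⟨f, (n2 f).1 h⟩
  let ev : (LinearMap.range L).dualAnnihilator →ₗ[(ZMod 2)] (ZMod 2) :=
    { toFun := fun l => l.1 (Pi.single f₀ 1)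
      map_add' := fun _ _ => rfl
      map_smul' := fun _ _ => rfl }
  have hev : Injective ev := by
    rw [← LinearMap.ker_eq_bot, LinearMap.ker_eq_bot']
    rintro ⟨l, hl⟩ h0
    refine Subtype.ext (LinearMap.pi_ext' fun f => LinearMap.ext_ring ?_)
    simpa using ((key l hl).1 f f₀).trans h0
  have hdim := Subspace.finrank_add_finrank_dualAnnihilator_eq (LinearMap.range L)
  have h1 := LinearMap.finrank_range_add_finrank_ker d
  have h2 := LinearMap.finrank_range_add_finrank_ker L
  have h3 := Submodule.finrank_mono hLd
  have h4 : Module.finrank (ZMod 2) (LinearMap.range L).dualAnnihilator ≤ 1 := by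
    simpa using LinearMap.finrank_le_finrank_of_injective hev
  simp only [Module.finrank_fintype_fun_eq_card, Fintype.card_sum] at h1 h2 hdim
  have h5 : M.chi ≤ 1 + Module.finrank (ZMod 2) (LinearMap.range L).dualAnnihilator := by
    simp only [chi, numC, Nat.card_eq_fintype_card]
    omega
  refine ⟨by omega, fun hb => ?_⟩
  have h6 : Module.finrank (ZMod 2) (LinearMap.range L).dualAnnihilator = 0 := by
    rw [Submodule.finrank_eq_zero, eq_bot_iff]
    intro l hl
    obtain ⟨k1, k2⟩ := key l hl
    obtain ⟨f, hf⟩ := k2 hb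
    refine (Submodule.mem_bot (ZMod 2)).2 (LinearMap.pi_ext' fun g => LinearMap.ext_ring ?_)
    simpa using (k1 g f).trans hf
  omega

end PMap

/-! ### Comparison with `FlagMap` -/

/-- The orbits of the group generated by `S` are the classes of the least equivalence relation that
relates every `x` to `σ x` for `σ ∈ S`. -/
theorem exists_mem_closure_iff {F : Type} {S : Set (Equiv.Perm F)} {s : Setoid F}
    (h1 : ∀ σ ∈ S, ∀ x, s x (σ x))
    (h2 : ∀ t : Setoid F, (∀ σ ∈ S, ∀ x, t x (σ x)) → s ≤ t) (x y : F) :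
    (∃ σ ∈ Subgroup.closure S, σ x = y) ↔ s x y := by
  constructor
  · rintro ⟨σ, hσ, rfl⟩
    have : ∀ x, s x (σ x) := by
      induction hσ using Subgroup.closure_induction with
      | mem σ h => exact h1 σ h
      | one => exact fun x => s.refl' x
      | mul σ τ _ _ hσ hτ => exact fun x => s.trans' (hτ x) (hσ (τ x))
      | inv σ _ hσ =>
        intro x
        have := hσ (σ⁻¹ x)
        rw [show σ (σ⁻¹ x) = x from σ.apply_symm_apply x] at this
        exact s.symm' this
    exact this x
  · let t : Setoid F :=
      { r := fun x y => ∃ σ ∈ Subgroup.closure S, σ x = y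
        iseqv :=
          { refl := fun x => ⟨1, one_mem _, rfl⟩
            symm := by
              rintro x _ ⟨σ, hσ, rfl⟩
              exact ⟨σ⁻¹, inv_mem hσ, by simp⟩
            trans := by
              rintro x _ _ ⟨σ, hσ, rfl⟩ ⟨τ, hτ, rfl⟩
              exact ⟨τ * σ, mul_mem hτ hσ, by simp⟩ } }
    have : s ≤ t := h2 t fun σ hσ x => ⟨σ, Subgroup.subset_closure hσ, rfl⟩
    exact fun h => this h

theorem orbitUnder_pair {F : Type} (σ τ : Equiv.Perm F) (x : F) :
    orbitUnder {σ, τ} x = {y | (step σ ⊔ step τ) x y} := by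
  ext y
  refine exists_mem_closure_iff (s := step σ ⊔ step τ) ?_ ?_ x y
  · rintro ρ (rfl | rfl) x
    · exact rel_left _ _ x
    · exact rel_right _ _ x
  · exact fun t h => sup_le (step_le.2 (h σ (by simp))) (step_le.2 (h τ (by simp)))

theorem numOrbits_pair {F : Type} (σ τ : Equiv.Perm F) :
    numOrbits {σ, τ} = numC (step σ ⊔ step τ) := by
  unfold numOrbits numC
  rw [← Nat.card_coe_set_eq]
  symm
  have e : ∀ x y, orbitUnder {σ, τ} x = orbitUnder {σ, τ} y ↔ (step σ ⊔ step τ) x y := by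
    intro x y
    rw [orbitUnder_pair, orbitUnder_pair]
    constructor
    · intro h
      have : y ∈ {z | (step σ ⊔ step τ) y z} := Setoid.refl' (step σ ⊔ step τ) y
      rw [← h] at this
      exact this
    · intro h
      ext z
      exact ⟨fun k => Setoid.trans' _ (Setoid.symm' _ h) k, fun k => Setoid.trans' _ h k⟩
  let f : Quotient (step σ ⊔ step τ) → Set.range (orbitUnder {σ, τ}) :=
    Quotient.lift (fun x => ⟨orbitUnder {σ, τ} x, x, rfl⟩)
      fun x y h => Subtype.ext ((e x y).2 h)
  refine Nat.card_congr (Equiv.ofBijective f ⟨fun p q => ?_, ?_⟩)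
  · induction p using Quotient.inductionOn with | _ x => ?_
    induction q using Quotient.inductionOn with | _ y => ?_
    exact fun h => Quotient.sound ((e x y).1 (congrArg Subtype.val h))
  · rintro ⟨_, x, rfl⟩
    exact ⟨Quotient.mk _ x, rfl⟩

theorem numOrbits_singleton {F : Type} (σ : Equiv.Perm F) : numOrbits {σ} = numC (step σ) := by
  rw [← Set.pair_eq_singleton, numOrbits_pair, sup_idem]

namespace FlagMap

variable {F : Type}

/-- A connected map, regarded as one that might have folded edges or several components. -/
def toPMap (M : FlagMap F) : PMap F where
  r0 := M.r0
  r1 := M.r1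
  r2 := M.r2
  i0 := M.r0_invol
  i1 := M.r1_invol
  i2 := M.r2_invol
  comm := M.r0_r2_comm
  nofix f h h' := M.r0_ne_r2 f (h.trans h'.symm)

theorem toPMap_conn (M : FlagMap F) : M.toPMap.Conn := by
  intro x y
  refine (exists_mem_closure_iff (s := M.toPMap.cs) ?_ ?_ x y).1 (M.connected x y)
  · rintro ρ (rfl | rfl | rfl) x
    · exact M.toPMap.cs_r0 x
    · exact M.toPMap.cs_r1 x
    · exact M.toPMap.cs_r2 x
  · exact fun t h => PMap.cs_le (h _ (by simp)) (h _ (by simp)) (h _ (by simp))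

theorem toPMap_fold (M : FlagMap F) : M.toPMap.fold = ∅ := by
  ext f
  exact iff_of_false (M.r0_ne_r2 f) id

theorem toPMap_chi (M : FlagMap F) : M.toPMap.chi = M.eulerChar := by
  unfold eulerChar PMap.chi
  simp only [numOrbits_pair, numOrbits_singleton]
  rfl

theorem toPMap_ori (M : FlagMap F) : M.toPMap.Ori ↔ M.Orientable := Iff.rfl

theorem mem_vertexFlags (M : FlagMap F) (f g : F) : g ∈ M.vertexFlags f ↔ M.toPMap.vs f g := by
  unfold vertexFlags
  rw [orbitUnder_pair]
  rfl

theorem toPMap_be (M : FlagMap F) (f : F) : M.toPMap.be f = M.boundaryEnds f := by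
  unfold boundaryEnds PMap.be
  simp only [mem_vertexFlags]
  rfl

theorem toPMap_inn (M : FlagMap F) (f : F) (k : ℕ) :
    M.toPMap.inn f = 2 * k ↔ M.HasInnerDegree f k := by
  unfold HasInnerDegree PMap.inn
  simp only [mem_vertexFlags]
  rfl

end FlagMap

namespace PMap

/-- A connected map without folded edges. -/
def toFlagMap {F : Type} (M : PMap F) (h : M.Conn) (hf : M.fold = ∅) : FlagMap F where
  r0 := M.i0.toPerm
  r1 := M.i1.toPerm
  r2 := M.i2.toPerm
  r0_invol := M.i0
  r1_invol := M.i1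
  r2_invol := M.i2
  r0_r2_comm := M.comm
  r0_ne_r2 f e := by
    have : f ∈ M.fold := e
    simp [hf] at this
  connected f g := by
    refine (exists_mem_closure_iff (s := M.cs) ?_ ?_ f g).2 (h f g)
    · rintro ρ (rfl | rfl | rfl) x
      · exact M.cs_r0 x
      · exact M.cs_r1 x
      · exact M.cs_r2 x
    · exact fun t h => PMap.cs_le (h M.i0.toPerm (by simp)) (h M.i1.toPerm (by simp))
        (h M.i2.toPerm (by simp))

/-! ### Counting isomorphism classes -/

/-- Isomorphism of maps with a distinguished flag. -/
def rooted (F : Type) : Setoid (PMap F × F) where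
  r p q := ∃ e : F ≃ F, Hom p.1 q.1 e ∧ e p.2 = q.2
  iseqv :=
    { refl := fun _ => ⟨Equiv.refl _, ⟨fun _ => rfl, fun _ => rfl, fun _ => rfl⟩, rfl⟩
      symm := by
        rintro p q ⟨e, h, h'⟩
        exact ⟨e.symm, h.symm, by rw [← h', e.symm_apply_apply]⟩
      trans := by
        rintro p q r ⟨e, h, h'⟩ ⟨d, k, k'⟩
        exact ⟨e.trans d, h.comp k, by rw [← k', ← h']; rfl⟩ }

/-- The number of isomorphism classes of maps with `n` darts and a distinguished flag that
satisfy `P`. -/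
noncomputable def cnt (n : ℕ) (P : PMap (Fin (2 * n)) → Fin (2 * n) → Prop) : ℕ :=
  (Quotient.mk (rooted (Fin (2 * n))) '' {p | P p.1 p.2}).ncard

end PMap

/-- Two sets of isomorphism classes have the same size if a relation between representatives
matches them. -/
theorem ncard_transfer {α β : Type} {s : Setoid α} {t : Setoid β} {P : Set α} {Q : Set β}
    (R : α → β → Prop) (h1 : ∀ x ∈ P, ∃ y ∈ Q, R x y) (h2 : ∀ y ∈ Q, ∃ x ∈ P, R x y)
    (h3 : ∀ x ∈ P, ∀ x' ∈ P, ∀ y ∈ Q, ∀ y' ∈ Q, R x y → R x' y' → (s x x' ↔ t y y')) :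
    (Quotient.mk s '' P).ncard = (Quotient.mk t '' Q).ncard := by
  rcases P.eq_empty_or_nonempty with rfl | ⟨x₀, hx₀⟩
  · have : Q = ∅ := Set.eq_empty_of_forall_notMem fun y hy => (h2 y hy).elim fun x hx => hx.1
    simp [this]
  have : Nonempty β := ⟨(h1 x₀ hx₀).choose⟩
  choose! f hf using h1
  have pick : ∀ q : Quotient s, ∃ x, q ∈ Quotient.mk s '' P → x ∈ P ∧ Quotient.mk s x = q := by
    intro q
    by_cases hq : q ∈ Quotient.mk s '' P
    · obtain ⟨x, hx, e⟩ := hq; exact ⟨x, fun _ => ⟨hx, e⟩⟩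
    · exact ⟨q.out, fun h => absurd h hq⟩
  choose g hg using pick
  refine Set.ncard_congr (fun q _ => Quotient.mk t (f (g q))) ?_ ?_ ?_
  · exact fun q hq => ⟨_, (hf _ (hg q hq).1).1, rfl⟩
  · intro q q' hq hq' e
    rw [← (hg q hq).2, ← (hg q' hq').2]
    have a := hf _ (hg q hq).1
    have b := hf _ (hg q' hq').1
    exact Quotient.sound ((h3 _ (hg q hq).1 _ (hg q' hq').1 _ a.1 _ b.1 a.2 b.2).2
      (Quotient.exact e))
  · rintro _ ⟨y, hy, rfl⟩
    obtain ⟨x, hx, hxy⟩ := h2 y hy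
    have hq : Quotient.mk s x ∈ Quotient.mk s '' P := ⟨x, hx, rfl⟩
    refine ⟨_, hq, Quotient.sound ?_⟩
    have a := hf _ (hg _ hq).1
    exact (h3 _ (hg _ hq).1 _ hx _ a.1 _ hy a.2 hxy).1 (Quotient.exact (hg _ hq).2)

theorem ncard_image_prod {α β : Type} (s : Setoid α) (t : Setoid β) (P : Set α) (Q : Set β) :
    (Quotient.mk (s.prod t) '' (P ×ˢ Q)).ncard =
      (Quotient.mk s '' P).ncard * (Quotient.mk t '' Q).ncard := by
  rw [← Set.ncard_prod]
  have : (Quotient.mk s '' P) ×ˢ (Quotient.mk t '' Q) =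
      (Setoid.prodQuotientEquiv s t).symm '' (Quotient.mk (s.prod t) '' (P ×ˢ Q)) := by
    ext ⟨p, q⟩
    constructor
    · rintro ⟨⟨x, hx, rfl⟩, ⟨y, hy, rfl⟩⟩
      exact ⟨_, ⟨(x, y), ⟨hx, hy⟩, rfl⟩, rfl⟩
    · rintro ⟨_, ⟨⟨x, y⟩, ⟨hx, hy⟩, rfl⟩, e⟩
      cases e
      exact ⟨⟨x, hx, rfl⟩, ⟨y, hy, rfl⟩⟩
  rw [this, Set.ncard_image_of_injective _ (Equiv.injective _)]

namespace PMap

/-- A property of maps with a distinguished flag, stable under isomorphism. -/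
def Inv (P : ∀ {F : Type}, PMap F → F → Prop) : Prop :=
  ∀ {A B : Type} {M : PMap A} {N : PMap B} {e : A ≃ B}, Hom M N e → ∀ a, P M a → P N (e a)

instance {F : Type} [Finite F] : Finite (PMap F) :=
  Finite.of_injective (fun M : PMap F => (M.r0, M.r1, M.r2)) fun M N h => by
    simp only [Prod.mk.injEq] at h
    exact PMap.ext h.1 h.2.1 h.2.2

theorem cnt_congr {n : ℕ} {P Q : PMap (Fin (2 * n)) → Fin (2 * n) → Prop}
    (h : ∀ M f, P M f ↔ Q M f) : cnt n P = cnt n Q := by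
  have : P = Q := by ext M f; exact h M f
  rw [this]

theorem cnt_eq_zero {n : ℕ} {P : PMap (Fin (2 * n)) → Fin (2 * n) → Prop}
    (h : ∀ M f, ¬ P M f) : cnt n P = 0 := by
  have : {p : PMap (Fin (2 * n)) × Fin (2 * n) | P p.1 p.2} = ∅ := by
    ext p; exact iff_of_false (h _ _) id
  rw [cnt, this, Set.image_empty, Set.ncard_empty]

/-- The classes are sorted by the value of an invariant `φ`. -/
theorem cnt_sum {n : ℕ} {ι : Type} [DecidableEq ι] (S : Finset ι)
    (P : PMap (Fin (2 * n)) → Fin (2 * n) → Prop)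
    (φ : PMap (Fin (2 * n)) → Fin (2 * n) → ι) (hS : ∀ M f, P M f → φ M f ∈ S)
    (hφ : ∀ M N f, ∀ e : Fin (2 * n) ≃ Fin (2 * n), Hom M N e → P M f → φ N (e f) = φ M f) :
    cnt n P = ∑ i ∈ S, cnt n fun M f => P M f ∧ φ M f = i := by
  classical
  have h1 : (Quotient.mk (rooted (Fin (2 * n))) '' {p | P p.1 p.2}) =
      ⋃ i ∈ S, Quotient.mk (rooted (Fin (2 * n))) '' {p | P p.1 p.2 ∧ φ p.1 p.2 = i} := by
    ext q
    simp only [Set.mem_iUnion]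
    constructor
    · rintro ⟨p, hp, rfl⟩
      exact ⟨φ p.1 p.2, hS _ _ hp, p, ⟨hp, rfl⟩, rfl⟩
    · rintro ⟨i, -, p, hp, rfl⟩
      exact ⟨p, hp.1, rfl⟩
  have fin : ∀ T : Set (Quotient (rooted (Fin (2 * n)))), T.Finite := fun T => Set.toFinite T
  unfold cnt
  rw [h1]
  clear hS h1
  induction S using Finset.induction_on with
  | empty => simp
  | insert i S hi ih =>
    rw [Finset.sum_insert hi, Finset.set_biUnion_insert, Set.ncard_union_eq _ (fin _) (fin _), ih]
    rw [Set.disjoint_left]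
    rintro _ ⟨p, hp, rfl⟩ h
    simp only [Set.mem_iUnion] at h
    obtain ⟨j, hj, q, hq, e⟩ := h
    obtain ⟨d, hd, hd'⟩ : (rooted _) q p := Quotient.exact e
    refine hi ?_
    rw [← hp.2, ← hd', hφ _ _ _ d hd hq.1, hq.2]
    exact hj

theorem cnt_add {n : ℕ} (P Q : PMap (Fin (2 * n)) → Fin (2 * n) → Prop)
    (hQ : ∀ M N f, ∀ e : Fin (2 * n) ≃ Fin (2 * n), Hom M N e → P M f → (Q N (e f) ↔ Q M f)) :
    cnt n P = cnt n (fun M f => P M f ∧ Q M f) + cnt n (fun M f => P M f ∧ ¬ Q M f) := by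
  classical
  rw [cnt_sum (Finset.univ : Finset Bool) P (fun M f => decide (Q M f)) (fun _ _ _ => Finset.mem_univ _)
    (fun M N f e he hP => by simp [hQ M N f e he hP])]
  simp

/-- Changing the distinguished flag, or the map on a fixed set of flags. -/
theorem cnt_transfer {n : ℕ} {P Q : PMap (Fin (2 * n)) → Fin (2 * n) → Prop}
    (R : PMap (Fin (2 * n)) → Fin (2 * n) → PMap (Fin (2 * n)) → Fin (2 * n) → Prop)
    (h1 : ∀ M f, P M f → ∃ N g, Q N g ∧ R M f N g) (h2 : ∀ N g, Q N g → ∃ M f, P M f ∧ R M f N g)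
    (h3 : ∀ M f M' f' N g N' g', P M f → P M' f' → Q N g → Q N' g' → R M f N g → R M' f' N' g' →
      ∀ e : Fin (2 * n) ≃ Fin (2 * n), (Hom M M' e ∧ e f = f') ↔ (Hom N N' e ∧ e g = g')) :
    cnt n P = cnt n Q := by
  refine ncard_transfer (fun p q => R p.1 p.2 q.1 q.2) ?_ ?_ ?_
  · rintro ⟨M, f⟩ h
    obtain ⟨N, g, hQ, hR⟩ := h1 M f h
    exact ⟨(N, g), hQ, hR⟩
  · rintro ⟨N, g⟩ h
    obtain ⟨M, f, hP, hR⟩ := h2 N g h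
    exact ⟨(M, f), hP, hR⟩
  · intro x hx x' hx' y hy y' hy' k k'
    exact exists_congr fun e => h3 _ _ _ _ _ _ _ _ hx hx' hy hy' k k' e

/-- The distinguished flag may be replaced by another one if each of the two determines the other in
an isomorphism-invariant way. -/
theorem cnt_reroot {n : ℕ} {P Q : PMap (Fin (2 * n)) → Fin (2 * n) → Prop}
    (R : PMap (Fin (2 * n)) → Fin (2 * n) → Fin (2 * n) → Prop)
    (hR : ∀ M N f g, ∀ e : Fin (2 * n) ≃ Fin (2 * n), Hom M N e → R M f g → R N (e f) (e g))
    (h1 : ∀ M f, P M f → ∃ g, Q M g ∧ R M f g) (h2 : ∀ M g, Q M g → ∃ f, P M f ∧ R M f g)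
    (u1 : ∀ M f g g', P M f → R M f g → R M f g' → Q M g → Q M g' → g = g')
    (u2 : ∀ M f f' g, Q M g → R M f g → R M f' g → P M f → P M f' → f = f')
    (iP : ∀ M N f, ∀ e : Fin (2 * n) ≃ Fin (2 * n), Hom M N e → P M f → P N (e f))
    (iQ : ∀ M N f, ∀ e : Fin (2 * n) ≃ Fin (2 * n), Hom M N e → Q M f → Q N (e f)) :
    cnt n P = cnt n Q := by
  refine cnt_transfer (fun M f N g => M = N ∧ R M f g) ?_ ?_ ?_
  · intro M f h
    obtain ⟨g, hg, hr⟩ := h1 M f h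
    exact ⟨M, g, hg, rfl, hr⟩
  · intro M g h
    obtain ⟨f, hf, hr⟩ := h2 M g h
    exact ⟨M, f, hf, rfl, hr⟩
  · rintro M f M' f' _ g _ g' hf hf' hg hg' ⟨rfl, r⟩ ⟨rfl, r'⟩ e
    constructor
    · rintro ⟨he, rfl⟩
      exact ⟨he, u1 _ _ _ _ hf' (hR _ _ _ _ e he r) r' (iQ _ _ _ e he hg) hg'⟩
    · rintro ⟨he, rfl⟩
      exact ⟨he, u2 _ _ _ _ hg' (hR _ _ _ _ e he r) r' (iP _ _ _ e he hf) hf'⟩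

/-- `numRooted` counts connected maps without folded edges. -/
theorem numRooted_eq_cnt (n : ℕ) (P : FlagMap (Fin (2 * n)) → Fin (2 * n) → Prop)
    (Q : PMap (Fin (2 * n)) → Fin (2 * n) → Prop)
    (h : ∀ M f, P M f ↔ Q M.toPMap f) (hQ : ∀ M f, Q M f → M.Conn ∧ M.fold = ∅) :
    numRooted n P = cnt n Q := by
  refine ncard_transfer (fun p q => p.1.toPMap = q.1 ∧ p.2 = q.2) ?_ ?_ ?_
  · rintro ⟨M, f⟩ hP
    exact ⟨(M.toPMap, f), (h M f).1 hP, rfl, rfl⟩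
  · rintro ⟨N, g⟩ hN
    obtain ⟨h1, h2⟩ := hQ N g hN
    exact ⟨(N.toFlagMap h1 h2, g), (h _ _).2 hN, rfl, rfl⟩
  · rintro ⟨M, f⟩ - ⟨M', f'⟩ - ⟨N, g⟩ - ⟨N', g'⟩ - ⟨rfl, rfl⟩ ⟨rfl, rfl⟩
    refine exists_congr fun e => ?_
    constructor
    · rintro ⟨he, H⟩
      exact ⟨⟨fun x => (H x).1, fun x => (H x).2.1, fun x => (H x).2.2⟩, he⟩
    · rintro ⟨H, he⟩
      exact ⟨he, fun x => ⟨H.h0 x, H.h1 x, H.h2 x⟩⟩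

end PMap

namespace PMap

variable {F A B : Type}

/-! ### Inserting a folded edge into a corner -/

open Classical in
/-- The map `M` with a new folded edge `inr true`, `inr false` put between the flag `u` and its
neighbour `M.r1 u`, or between `u` and the boundary if `M.r1 u = u`; the flag `inr true` is next
to `u`. -/
noncomputable def ins (M : PMap F) (u : F) : PMap (F ⊕ Bool) where
  r0 := Sum.map M.r0 not
  r1 := Sum.elim
    (fun x => if x = u then .inr true else if x = M.r1 u then .inr false else .inl (M.r1 x))
    fun b => if b then .inl u else if M.r1 u = u then .inr false else .inl (M.r1 u)
  r2 := Sum.map M.r2 not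
  i0 := by rintro (x | b) <;> simp [M.i0 _]
  i1 := by
    have := M.i1
    have := M.i1.injective
    rintro (x | b)
    · by_cases h1 : x = u
      · simp [h1]
      · by_cases h2 : x = M.r1 u
        · have : M.r1 u ≠ u := fun h => h1 (h2.trans h)
          simp [h2, this]
        · have h3 : M.r1 x ≠ u := fun h => h2 (by rw [← h, M.i1])
          have h4 : M.r1 x ≠ M.r1 u := fun h => h1 (M.i1.injective h)
          simp [h1, h2, h3, h4, M.i1 _]
    · cases b
      · by_cases h : M.r1 u = u <;> simp [h]
      · simp
  i2 := by rintro (x | b) <;> simp [M.i2 _]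
  comm := by rintro (x | b) <;> simp [M.comm]
  nofix := by rintro (x | b) <;> simp; exact M.nofix x

/-- The flags of the new edge sit at the corner of `u`. -/
def corner (u : F) : F ⊕ Bool → F := Sum.elim id fun _ => u

section Ins

variable (M : PMap F) (u : F)

theorem ins_r1_root : (M.ins u).r1 (.inr true) = .inl u := by simp [ins]

theorem ins_r1_u : (M.ins u).r1 (.inl u) = .inr true := by simp [ins]

theorem ins_r1_of_fixed (h : M.r1 u = u) : (M.ins u).r1 (.inr false) = .inr false := by
  simp [ins, h]

theorem ins_r1_of_ne (h : M.r1 u ≠ u) : (M.ins u).r1 (.inr false) = .inl (M.r1 u) := by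
  simp [ins, h]

theorem ins_r1_inl {x : F} (h1 : x ≠ u) (h2 : x ≠ M.r1 u) :
    (M.ins u).r1 (.inl x) = .inl (M.r1 x) := by
  simp [ins, h1, h2]

theorem ins_r1_neighbour (h : M.r1 u ≠ u) : (M.ins u).r1 (.inl (M.r1 u)) = .inr false := by
  simp [ins, h]

theorem corner_r1_rel {s : Setoid F} (hs : ∀ x, s x (M.r1 x)) (x : F ⊕ Bool) :
    s (corner u x) (corner u ((M.ins u).r1 x)) := by
  rcases x with x | b
  · by_cases h1 : x = u
    · subst h1; rw [ins_r1_u]; exact s.refl' _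
    · by_cases h2 : x = M.r1 u
      · subst h2; rw [ins_r1_neighbour _ _ h1]; exact s.symm' (hs u)
      · rw [ins_r1_inl _ _ h1 h2]; exact hs x
  · cases b
    · by_cases h : M.r1 u = u
      · rw [ins_r1_of_fixed _ _ h]
      · rw [ins_r1_of_ne _ _ h]; exact hs u
    · rw [ins_r1_root]; exact s.refl' _

/-- An equivalence relation that identifies the two flags of the new edge and is compatible with `r1`
identifies them with the flag `u`, and is compatible with the original `r1`. -/
theorem rel_corner {t : Setoid (F ⊕ Bool)} (ht : ∀ x, t x ((M.ins u).r1 x))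
    (hp : t (.inr true) (.inr false)) :
    (∀ x, t x (.inl (corner u x))) ∧ ∀ x, t (.inl x) (.inl (M.r1 x)) := by
  have h0 : t (.inr true) (.inl u) := by
    have := ht (.inr true); rwa [ins_r1_root] at this
  refine ⟨?_, fun x => ?_⟩
  · rintro (x | _ | _)
    · exact t.refl' _
    · exact t.trans' (t.symm' hp) h0
    · exact h0
  · have hu : t (.inl u) (.inl (M.r1 u)) := by
      by_cases h : M.r1 u = u
      · rw [h]
      · have := ht (.inr false)
        rw [ins_r1_of_ne _ _ h] at this
        exact t.trans' (t.symm' h0) (t.trans' hp this)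
    by_cases h1 : x = u
    · subst h1; exact hu
    · by_cases h2 : x = M.r1 u
      · subst h2; rw [M.i1 u]; exact t.symm' hu
      · have := ht (.inl x)
        rwa [ins_r1_inl _ _ h1 h2] at this

theorem ins_cs (x y : F ⊕ Bool) : (M.ins u).cs x y ↔ M.cs (corner u x) (corner u y) := by
  constructor
  · have : (M.ins u).cs ≤ Setoid.comap (corner u) M.cs := by
      refine cs_le ?_ (corner_r1_rel M u M.cs_r1) ?_
      · rintro (x | b)
        · exact M.cs_r0 x
        · exact Setoid.refl' M.cs u
      · rintro (x | b)
        · exact M.cs_r2 x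
        · exact Setoid.refl' M.cs u
    exact fun h => this h
  · obtain ⟨h1, h2⟩ := rel_corner M u (t := (M.ins u).cs) (cs_r1 _) (cs_r0 _ (Sum.inr true : F ⊕ Bool))
    have : M.cs ≤ Setoid.comap Sum.inl (M.ins u).cs :=
      cs_le (fun x => (M.ins u).cs_r0 (.inl x)) h2 (fun x => (M.ins u).cs_r2 (.inl x))
    exact fun h => Setoid.trans' _ (h1 x) (Setoid.trans' _ (this h) (Setoid.symm' _ (h1 y)))

theorem ins_rel {τ : F → F} (x y : F ⊕ Bool) :
    (step (M.ins u).r1 ⊔ step (Sum.map τ not)) x y ↔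
      (step M.r1 ⊔ step τ) (corner u x) (corner u y) := by
  constructor
  · have : step (M.ins u).r1 ⊔ step (Sum.map τ not) ≤
        Setoid.comap (corner u) (step M.r1 ⊔ step τ) := by
      refine sup_le (step_le.2 (corner_r1_rel M u (rel_left _ _))) (step_le.2 ?_)
      rintro (x | b)
      · exact rel_right _ _ x
      · exact Setoid.refl' (step M.r1 ⊔ step τ) u
    exact fun h => this h
  · obtain ⟨h1, h2⟩ := rel_corner M u (t := step (M.ins u).r1 ⊔ step (Sum.map τ not))
      (rel_left _ _) (rel_right _ _ (Sum.inr true : F ⊕ Bool))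
    have : step M.r1 ⊔ step τ ≤
        Setoid.comap Sum.inl (step (M.ins u).r1 ⊔ step (Sum.map τ not)) :=
      sup_le (step_le.2 h2) (step_le.2 fun x => rel_right _ (Sum.map τ not) (Sum.inl x : F ⊕ Bool))
    exact fun h => Setoid.trans' _ (h1 x) (Setoid.trans' _ (this h) (Setoid.symm' _ (h1 y)))

theorem ins_vs (x y : F ⊕ Bool) : (M.ins u).vs x y ↔ M.vs (corner u x) (corner u y) :=
  ins_rel M u x y

theorem ins_conn : (M.ins u).Conn ↔ M.Conn := by
  constructor
  · exact fun h x y => (ins_cs M u (.inl x) (.inl y)).1 (h _ _)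
  · exact fun h x y => (ins_cs M u x y).2 (h _ _)

/-- The new edge adds two flags, one edge, and one side of each of the three kinds, but no vertex and
no face. -/
theorem ins_chi [Finite F] : (M.ins u).chi = M.chi := by
  classical
  have hb : numC (step not) = 1 := by
    have := two_mul_numC_step Bool.involutive_not
    have h0 : {x | (!x) = x} = (∅ : Set Bool) := by ext x; simp
    rw [h0] at this
    simp at this
    omega
  have s0 : ∀ σ τ : F → F, Involutive σ → Involutive τ →
      numC (step (Sum.map σ not) ⊔ step (Sum.map τ not)) = numC (step σ ⊔ step τ) + 1 := by
    intro σ τ hσ hτ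
    rw [numC_sum (σ₁ := σ) (τ₁ := τ) (σ₂ := not) (τ₂ := not) ?_ ?_ (Equiv.refl _)
      (fun _ => rfl) (fun _ => rfl) (fun _ => rfl) (fun _ => rfl), sup_idem, hb]
    · rintro (x | b) <;> simp [hσ _]
    · rintro (x | b) <;> simp [hτ _]
  have c : ∀ τ : F → F, numC (step (M.ins u).r1 ⊔ step (Sum.map τ not)) =
      numC (step M.r1 ⊔ step τ) := fun τ =>
    numC_congr (corner u) (fun x y => (ins_rel M u x y).symm)
      fun x => ⟨.inl x, Setoid.refl' _ x⟩
  -- up to exchanging `u` with the second new flag, `r1` is a disjoint union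
  have s1 : numC (step (M.ins u).r1) = numC (step M.r1) + 1 := by
    let e : F ⊕ Bool ≃ F ⊕ Bool := Equiv.swap (Sum.inl u) (Sum.inr false)
    have eu : e (.inl u) = .inr false := Equiv.swap_apply_left _ _
    have ef : e (.inr false) = .inl u := Equiv.swap_apply_right _ _
    have et : e (.inr true) = .inr true := Equiv.swap_apply_of_ne_of_ne (by simp) (by simp)
    have ex : ∀ x, x ≠ u → e (.inl x) = .inl x := fun x hx =>
      Equiv.swap_apply_of_ne_of_ne (by simpa using hx) (by simp)
    have a1 : ∀ x, e (.inl (M.r1 x)) = (M.ins u).r1 (e (.inl x)) := by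
      intro x
      by_cases h1 : x = u
      · subst h1
        by_cases h : M.r1 x = x
        · rw [h, eu, ins_r1_of_fixed _ _ h]
        · rw [eu, ins_r1_of_ne _ _ h, ex _ h]
      · by_cases h2 : x = M.r1 u
        · rw [ex _ h1]; subst h2; rw [M.i1, ins_r1_neighbour _ _ h1, eu]
        · rw [ex _ h1, ins_r1_inl _ _ h1 h2, ex]
          intro h; exact h2 (by rw [← h, M.i1])
    have a2 : ∀ b, e (.inr (!b)) = (M.ins u).r1 (e (.inr b)) := by
      rintro (_ | _)
      · rw [ef, ins_r1_u]; exact et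
      · rw [et, ins_r1_root]; exact ef
    have := numC_sum (M.ins u).i1 (M.ins u).i1 e a1 a1 a2 a2
    rwa [sup_idem, sup_idem, sup_idem, hb] at this
  have c2 : numC (M.ins u).vs = numC M.vs := c M.r2
  have c0 : numC (M.ins u).fs = numC M.fs := by
    rw [fs, fs, sup_comm, sup_comm (step M.r0)]; exact c M.r0
  have s2 : numC (M.ins u).es = numC M.es + 1 := s0 _ _ M.i0 M.i2
  have t0 : numC (step (M.ins u).r0) = numC (step M.r0) + 1 := by
    have := s0 _ _ M.i0 M.i0
    rwa [sup_idem, sup_idem] at this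
  have t2 : numC (step (M.ins u).r2) = numC (step M.r2) + 1 := by
    have := s0 _ _ M.i2 M.i2
    rwa [sup_idem, sup_idem] at this
  rw [chi, chi, c0, c2, s2, t0, t2, s1, Nat.card_sum, Nat.card_eq_fintype_card (α := Bool),
    Fintype.card_bool]
  push_cast
  ring

theorem ins_ori : (M.ins u).Ori ↔ M.Ori := by
  constructor
  · rintro ⟨c, hc⟩
    refine ⟨fun x => c (.inl x), fun x => ?_⟩
    obtain ⟨h0, h1, h2⟩ := hc (.inl x)
    have key : M.r1 u ≠ u → c (.inl (M.r1 u)) ≠ c (.inl u) := by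
      intro h
      have k1 := (hc (.inr true)).2.1
      rw [ins_r1_root] at k1
      have k2 := (hc (.inr false)).2.1
      rw [ins_r1_of_ne _ _ h] at k2
      have k3 := (hc (.inr true)).1
      change (Sum.inr false ≠ Sum.inr true → c (.inr false) ≠ c (.inr true)) at k3
      have k1 := k1 (by simp)
      have k2 := k2 (by simp)
      have k3 := k3 (by simp)
      revert k1 k2 k3
      cases c (.inl (M.r1 u)) <;> cases c (.inl u) <;> cases c (.inr true) <;>
        cases c (.inr false) <;> simp
    refine ⟨fun h => h0 fun e => h (Sum.inl_injective e), fun h => ?_,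
      fun h => h2 fun e => h (Sum.inl_injective e)⟩
    by_cases e1 : x = u
    · subst e1; exact key h
    · by_cases e2 : x = M.r1 u
      · subst e2; rw [M.i1] at h ⊢; exact (key h.symm).symm
      · rw [ins_r1_inl _ _ e1 e2] at h1
        exact h1 fun e => h (Sum.inl_injective e)
  · rintro ⟨c, hc⟩
    refine ⟨Sum.elim c fun b => if b then !c u else c u, ?_⟩
    rintro (x | b)
    · obtain ⟨h0, h1, h2⟩ := hc x
      refine ⟨fun h => h0 fun e => h (congrArg Sum.inl e), fun h => ?_,
        fun h => h2 fun e => h (congrArg Sum.inl e)⟩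
      by_cases e1 : x = u
      · subst e1; rw [ins_r1_u]; simp
      · by_cases e2 : x = M.r1 u
        · subst e2; rw [ins_r1_neighbour _ _ e1]; exact ((hc u).2.1 e1).symm
        · rw [ins_r1_inl _ _ e1 e2] at h ⊢
          exact h1 fun e => h (congrArg Sum.inl e)
    · have k : ∀ b : Bool, (if (!b) then !c u else c u) ≠ (if b then !c u else c u) := by
        intro b; cases b <;> simp
      refine ⟨fun _ => k b, fun h => ?_, fun _ => k b⟩
      cases b
      · by_cases e : M.r1 u = u
        · exact absurd (ins_r1_of_fixed _ _ e) h
        · rw [ins_r1_of_ne _ _ e]; exact (hc u).2.1 e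
      · rw [ins_r1_root]; simp

theorem ins_disk [Finite F] : (M.ins u).Disk ↔ M.Disk := by
  rw [Disk, Disk, ins_conn, ins_ori, ins_chi]

theorem ins_sph [Finite F] : (M.ins u).Sph ↔ M.Sph := by
  rw [Sph, Sph, ins_conn, ins_ori, ins_chi]

theorem ins_fold : (M.ins u).fold = {.inr true, (M.ins u).r2 (.inr true)} ↔ M.fold = ∅ := by
  have h : ∀ x, (.inl x ∈ (M.ins u).fold ↔ x ∈ M.fold) := fun x => Sum.inl_injective.eq_iff
  have h' : ∀ b, (.inr b ∈ (M.ins u).fold) := fun b => rfl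
  change _ = {Sum.inr true, Sum.inr false} ↔ _
  simp only [Set.ext_iff, Sum.forall, h, h']
  simp

theorem ins_be : (M.ins u).be (.inr true) = M.be u := by
  have : {g | (M.ins u).vs (.inr true) g ∧ (M.ins u).r2 g = g} =
      Sum.inl '' {g | M.vs u g ∧ M.r2 g = g} := by
    ext (x | b)
    · simp only [Set.mem_ofPred_eq, ins_vs, Set.mem_image, Sum.inl.injEq, exists_eq_right]
      exact and_congr Iff.rfl Sum.inl_injective.eq_iff
    · simp [ins]
  rw [be, this, Set.ncard_image_of_injective _ Sum.inl_injective, be]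

theorem ins_inn [Finite F] : (M.ins u).inn (.inr true) = M.inn u + 2 := by
  have : {g | (M.ins u).vs (.inr true) g ∧ (M.ins u).r2 g ≠ g} =
      Sum.inl '' {g | M.vs u g ∧ M.r2 g ≠ g} ∪ {.inr true, .inr false} := by
    ext (x | b)
    · simp only [Set.mem_ofPred_eq, ins_vs, Set.mem_image, Sum.inl.injEq, exists_eq_right,
        Set.mem_union, Set.mem_insert_iff, Set.mem_singleton_iff, reduceCtorEq, or_false]
      exact and_congr Iff.rfl Sum.inl_injective.ne_iff
    · simp only [Set.mem_ofPred_eq, ins_vs]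
      refine iff_of_true ⟨Setoid.refl' _ u, by simp [ins]⟩ (Or.inr ?_)
      cases b <;> simp
  rw [inn, this, Set.ncard_union_eq, Set.ncard_image_of_injective _ Sum.inl_injective,
    Set.ncard_pair (by simp), inn]
  rw [Set.disjoint_left]
  rintro _ ⟨x, -, rfl⟩ h
  simp at h

end Ins

/-- Every folded edge whose first flag has a neighbour outside of that edge can be removed. -/
theorem exists_eq_ins (N : PMap (F ⊕ Bool)) (h0 : N.r0 (.inr true) = .inr false)
    (h2 : N.r2 (.inr true) = .inr false) (h1 : N.r1 (.inr true) ≠ .inr true)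
    (h1' : N.r1 (.inr true) ≠ .inr false) : ∃ M u, N = ins M u := by
  have h0' : N.r0 (.inr false) = .inr true := by rw [← h0, N.i0]
  have h2' : N.r2 (.inr false) = .inr true := by rw [← h2, N.i2]
  have x0 : ∀ x, ∃ y, N.r0 (.inl x) = .inl y := by
    intro x
    rcases e : N.r0 (.inl x) with y | _ | _
    · exact ⟨y, rfl⟩
    · have := N.i0 (.inl x); rw [e, h0'] at this; cases this
    · have := N.i0 (.inl x); rw [e, h0] at this; cases this
  have x2 : ∀ x, ∃ y, N.r2 (.inl x) = .inl y := by
    intro x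
    rcases e : N.r2 (.inl x) with y | _ | _
    · exact ⟨y, rfl⟩
    · have := N.i2 (.inl x); rw [e, h2'] at this; cases this
    · have := N.i2 (.inl x); rw [e, h2] at this; cases this
  obtain ⟨u, hu⟩ : ∃ u, N.r1 (.inr true) = .inl u := by
    rcases e : N.r1 (.inr true) with y | _ | _
    · exact ⟨y, rfl⟩
    · exact absurd e h1'
    · exact absurd e h1
  have hu' : N.r1 (.inl u) = .inr true := by rw [← hu, N.i1]
  -- the neighbour of `x` after removal of the edge
  have x1 : ∀ x, ∃ y, N.r1 (.inl x) = .inl y ∨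
      (x = u ∧ (N.r1 (.inr false) = .inl y ∨ (N.r1 (.inr false) = .inr false ∧ y = u))) ∨
      (N.r1 (.inl x) = .inr false ∧ y = u) := by
    intro x
    rcases e : N.r1 (.inl x) with y | _ | _
    · exact ⟨y, Or.inl rfl⟩
    · exact ⟨u, Or.inr (Or.inr ⟨rfl, rfl⟩)⟩
    · have hx : x = u := Sum.inl_injective (N.i1.injective (e.trans hu'.symm))
      rcases e' : N.r1 (.inr false) with y | _ | _
      · exact ⟨y, Or.inr (Or.inl ⟨hx, Or.inl rfl⟩)⟩
      · exact ⟨u, Or.inr (Or.inl ⟨hx, Or.inr ⟨rfl, rfl⟩⟩)⟩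
      · have := N.i1 (.inr false); rw [e', hu] at this; cases this
  choose a0 ha0 using x0
  choose a1 ha1 using x1
  choose a2 ha2 using x2
  have j1 := N.i1
  have j1' := N.i1.injective
  have inl_inj := fun x y => (Sum.inl_injective : Injective (Sum.inl : F → F ⊕ Bool)) (a₁ := x) (a₂ := y)
  let M : PMap F :=
    { r0 := a0
      r1 := a1
      r2 := a2
      i0 := fun x => Sum.inl_injective (by rw [← ha0, ← ha0, N.i0])
      i1 := by
        intro x
        have e1 := ha1 x
        have e2 := ha1 (a1 x)
        have e3 := N.i1 (.inl x)
        have e4 := N.i1 (.inr false)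
        grind
      i2 := fun x => Sum.inl_injective (by rw [← ha2, ← ha2, N.i2])
      comm := fun x => Sum.inl_injective (by rw [← ha0, ← ha2, N.comm, ha0, ha2])
      nofix := fun x hx e => N.nofix (.inl x) (by rw [ha0, hx]) (by rw [ha2, e]) }
  refine ⟨M, u, PMap.ext (funext ?_) (funext ?_) (funext ?_)⟩
  · rintro (x | _ | _)
    · exact ha0 x
    · exact h0'
    · exact h0
  · rintro (x | _ | _)
    · by_cases k1 : x = u
      · subst k1; rw [ins_r1_u]; exact hu'
      · by_cases k2 : x = M.r1 u
        · subst k2; rw [ins_r1_neighbour _ _ k1]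
          have e1 := ha1 u
          have e4 := N.i1 (.inr false)
          change a1 u ≠ u at k1
          change N.r1 (.inl (a1 u)) = _
          grind
        · rw [ins_r1_inl _ _ k1 k2]
          have e1 := ha1 x
          have e2 := ha1 u
          have e4 := N.i1 (.inl x)
          change x ≠ a1 u at k2
          change _ = Sum.inl (a1 x)
          grind
    · have e1 := ha1 u
      by_cases k : M.r1 u = u
      · rw [ins_r1_of_fixed _ _ k]
        change a1 u = u at k
        have e4 := N.i1 (.inr false)
        grind
      · rw [ins_r1_of_ne _ _ k]
        change a1 u ≠ u at k
        change _ = Sum.inl (a1 u)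
        grind
    · rw [ins_r1_root]; exact hu
  · rintro (x | _ | _)
    · exact ha2 x
    · exact h2'
    · exact h2

theorem Hom.ins {M : PMap A} {N : PMap B} {e : A ≃ B} (h : Hom M N e) (u : A) :
    Hom (M.ins u) (N.ins (e u)) (Equiv.sumCongr e (Equiv.refl Bool)) := by
  refine ⟨?_, ?_, ?_⟩
  · rintro (x | b)
    · exact congrArg Sum.inl (h.h0 x)
    · rfl
  · have hf : M.r1 u = u ↔ N.r1 (e u) = e u := by rw [← h.h1, e.injective.eq_iff]
    rintro (x | _ | _)
    · by_cases k1 : x = u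
      · subst k1
        change _ = (N.ins (e x)).r1 (.inl (e x))
        rw [ins_r1_u, ins_r1_u]; rfl
      · by_cases k2 : x = M.r1 u
        · subst k2
          change _ = (N.ins (e u)).r1 (.inl (e (M.r1 u)))
          rw [ins_r1_neighbour _ _ k1, h.h1, ins_r1_neighbour _ _ (fun k => k1 (hf.2 k))]; rfl
        · change _ = (N.ins (e u)).r1 (.inl (e x))
          rw [ins_r1_inl _ _ k1 k2, ins_r1_inl _ _ (fun k => k1 (e.injective k)), ← h.h1]
          · rfl
          · rw [← h.h1]; exact fun k => k2 (e.injective k)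
    · change _ = (N.ins (e u)).r1 (.inr false)
      by_cases k : M.r1 u = u
      · rw [ins_r1_of_fixed _ _ k, ins_r1_of_fixed _ _ (hf.1 k)]; rfl
      · rw [ins_r1_of_ne _ _ k, ins_r1_of_ne _ _ (fun k' => k (hf.2 k')), ← h.h1]; rfl
    · change _ = (N.ins (e u)).r1 (.inr true)
      rw [ins_r1_root, ins_r1_root]; rfl
  · rintro (x | b)
    · exact congrArg Sum.inl (h.h2 x)
    · rfl

/-- An isomorphism that preserves the inserted edges comes from an isomorphism of the original
maps. -/
theorem Hom.of_ins {M : PMap A} {N : PMap B} {u : A} {v : B} {d : A ⊕ Bool ≃ B ⊕ Bool}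
    (h : Hom (M.ins u) (N.ins v) d) (hd : d (.inr true) = .inr true) :
    ∃ e : A ≃ B, Hom M N e ∧ e u = v := by
  have hd' : d (.inr false) = .inr false := by
    have := h.h0 (.inr true); rw [hd] at this; exact this
  have g : ∀ x, ∃ y, d (.inl x) = .inl y := by
    intro x
    rcases k : d (.inl x) with y | _ | _
    · exact ⟨y, rfl⟩
    · exact absurd (d.injective (k.trans hd'.symm)) (by simp)
    · exact absurd (d.injective (k.trans hd.symm)) (by simp)
  choose f hf using g
  have bij : Bijective f := by
    constructor
    · intro x y k
      exact Sum.inl_injective (d.injective (by rw [hf, hf, k]))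
    · intro y
      obtain ⟨x | _ | _, hx⟩ := d.surjective (.inl y)
      · exact ⟨x, Sum.inl_injective (by rw [← hf, hx])⟩
      · rw [hd'] at hx; cases hx
      · rw [hd] at hx; cases hx
  have h1 := h.h1
  have fu : f u = v := by
    have := h1 (.inr true)
    rw [hd, ins_r1_root, ins_r1_root, hf] at this
    exact Sum.inl_injective this
  have fu' : f (M.r1 u) = N.r1 v := by
    have := h1 (.inr false)
    rw [hd'] at this
    by_cases k : M.r1 u = u
    · rw [ins_r1_of_fixed _ _ k, hd'] at this
      by_cases k' : N.r1 v = v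
      · rw [k, k', fu]
      · rw [ins_r1_of_ne _ _ k'] at this; cases this
    · rw [ins_r1_of_ne _ _ k, hf] at this
      by_cases k' : N.r1 v = v
      · rw [ins_r1_of_fixed _ _ k'] at this; cases this
      · rw [ins_r1_of_ne _ _ k'] at this; exact Sum.inl_injective this
  refine ⟨Equiv.ofBijective f bij, ⟨fun x => ?_, fun x => ?_, fun x => ?_⟩, fu⟩
  · have := h.h0 (.inl x)
    rw [hf] at this
    exact Sum.inl_injective ((hf _).symm.trans this)
  · change f (M.r1 x) = N.r1 (f x)
    by_cases k1 : x = u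
    · rw [k1, fu', fu]
    · by_cases k2 : x = M.r1 u
      · rw [k2, fu', M.i1, N.i1, fu]
      · have := h1 (.inl x)
        rw [ins_r1_inl _ _ k1 k2, hf, hf, ins_r1_inl] at this
        · exact Sum.inl_injective this
        · rw [← fu]; exact fun k => k1 (bij.1 k)
        · rw [← fu']; exact fun k => k2 (bij.1 k)
  · have := h.h2 (.inl x)
    rw [hf] at this
    exact Sum.inl_injective ((hf _).symm.trans this)

/-- Maps with a distinguished corner correspond to maps with a distinguished folded edge. -/
theorem cnt_ins {n : ℕ} {P Q : ∀ {F : Type}, PMap F → F → Prop} (hQ : Inv Q)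
    (h : ∀ {F : Type} [Finite F] (M : PMap F) (u : F), P M u ↔ Q (M.ins u) (.inr true)) :
    cnt n P = cnt (n + 1) fun N p =>
      Q N p ∧ N.r0 p = N.r2 p ∧ N.r1 p ≠ p ∧ N.r1 p ≠ N.r2 p := by
  have hc : Nat.card (Fin (2 * n) ⊕ Bool) = Nat.card (Fin (2 * (n + 1))) := by
    simp [mul_add]
  have E : Fin (2 * n) ⊕ Bool ≃ Fin (2 * (n + 1)) := (Finite.card_eq.1 hc).some
  refine ncard_transfer (fun x y => ∃ j : Fin (2 * n) ⊕ Bool ≃ Fin (2 * (n + 1)),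
    Hom (x.1.ins x.2) y.1 j ∧ j (.inr true) = y.2) ?_ ?_ ?_
  · rintro ⟨M, u⟩ hP
    refine ⟨((M.ins u).map E, E (.inr true)), ⟨?_, ?_, ?_, ?_⟩, E, hom_map _ _, rfl⟩
    · exact hQ (hom_map _ _) _ ((h M u).1 hP)
    · simp [map, ins]
    · simp [map, ins]
    · simp [map, ins]
  · rintro ⟨N, p⟩ ⟨hN, k0, k1, k2⟩
    have hp : N.r2 p ≠ p := fun e => N.nofix p (k0.trans e) e
    obtain ⟨j, hj, hj'⟩ : ∃ j : Fin (2 * n) ⊕ Bool ≃ Fin (2 * (n + 1)),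
        j (.inr true) = p ∧ j (.inr false) = N.r2 p := by
      let j₁ := E.trans (Equiv.swap (E (.inr true)) p)
      have h1 : j₁ (.inr true) = p := Equiv.swap_apply_left _ _
      refine ⟨j₁.trans (Equiv.swap (j₁ (.inr false)) (N.r2 p)), ?_, Equiv.swap_apply_left _ _⟩
      change Equiv.swap (j₁ (.inr false)) (N.r2 p) (j₁ (.inr true)) = p
      rw [h1]
      refine Equiv.swap_apply_of_ne_of_ne (fun e => ?_) hp.symm
      exact absurd (j₁.injective (h1.trans e)) (by simp)
    have s1 : j.symm p = .inr true := by rw [← hj, j.symm_apply_apply]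
    have s2 : j.symm (N.r2 p) = .inr false := by rw [← hj', j.symm_apply_apply]
    have hom := hom_map N j.symm
    obtain ⟨M, u, e⟩ := exists_eq_ins (N.map j.symm)
      (by rw [← s1, ← hom.h0, k0, s2]) (by rw [← s1, ← hom.h2, s2])
      (by rw [← s1, ← hom.h1]; exact j.symm.injective.ne k1)
      (by rw [← s1, ← hom.h1, ← s2]; exact j.symm.injective.ne k2)
    rw [e] at hom
    refine ⟨(M, u), (h M u).2 ?_, j, hom.symm, hj⟩
    have := hQ hom _ hN
    rwa [s1] at this
  · rintro ⟨M, u⟩ - ⟨M', u'⟩ - ⟨N, p⟩ - ⟨N', p'⟩ - ⟨j, hj, e⟩ ⟨j', hj', e'⟩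
    dsimp only at hj hj' e e'
    constructor
    · rintro ⟨d, hd, rfl⟩
      refine ⟨(j.symm.trans (Equiv.sumCongr d (Equiv.refl Bool))).trans j',
        (hj.symm.comp (hd.ins u)).comp hj', ?_⟩
      change j' (Equiv.sumCongr d (Equiv.refl Bool) (j.symm p)) = p'
      rw [← e, j.symm_apply_apply]; exact e'
    · rintro ⟨d, hd, k⟩
      have := Hom.of_ins (d := (j.trans d).trans j'.symm) ((hj.comp hd).comp hj'.symm) ?_
      · exact this
      · change j'.symm (d (j (.inr true))) = _
        rw [e, k]; dsimp only; rw [← e', j'.symm_apply_apply]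

end PMap

/-! ### Cutting the root edge lengthwise -/

open Classical in
/-- The map `r` made to fix the elements of `S`. -/
noncomputable def off {F : Type} (r : F → F) (S : Set F) (x : F) : F := if x ∈ S then x else r x

section Off

variable {F A B : Type} {r : F → F} {S : Set F}

theorem off_mem {x : F} (h : x ∈ S) : off r S x = x := if_pos h

theorem off_notMem {x : F} (h : x ∉ S) : off r S x = r x := if_neg h

theorem off_invol (hr : Involutive r) (hS : ∀ x ∈ S, r x ∈ S) : Involutive (off r S) := by
  intro x
  by_cases h : x ∈ S
  · rw [off_mem h, off_mem h]
  · have h' : r x ∉ S := fun k => h (by simpa [hr x] using hS _ k)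
    rw [off_notMem h, off_notMem h', hr]

theorem step_off_le : step (off r S) ≤ step r := by
  refine step_le.2 fun x => ?_
  by_cases h : x ∈ S
  · rw [off_mem h]
  · rw [off_notMem h]; exact step_rel r x

theorem off_map {j : A → B} {r : A → A} {r' : B → B} {S : Set A} {S' : Set B}
    (h : ∀ x, j (r x) = r' (j x)) (hS : ∀ x, j x ∈ S' ↔ x ∈ S) (x : A) :
    j (off r S x) = off r' S' (j x) := by
  by_cases hx : x ∈ S
  · rw [off_mem hx, off_mem ((hS x).2 hx)]
  · rw [off_notMem hx, off_notMem (fun k => hx ((hS x).1 k)), h]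

end Off

namespace PMap

variable {F A B : Type}

/-- The map `N` arises from `M` by cutting the complete edge with the flags `a`, `b = r0 a`,
`c = r2 a`, `d = r0 c` lengthwise: its two sides become folded edges `a`, `b` and `c`, `d`. -/
structure Cut (M N : PMap F) (a b c d : F) : Prop where
  r0 : N.r0 = M.r0
  r1 : N.r1 = M.r1
  ab : M.r0 a = b
  cd : M.r0 c = d
  ac : M.r2 a = c
  bd : M.r2 b = d
  nab : N.r2 a = b
  ncd : N.r2 c = d
  r2 : ∀ x, x ≠ a → x ≠ b → x ≠ c → x ≠ d → N.r2 x = M.r2 x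
  ne : a ≠ b ∧ a ≠ c ∧ a ≠ d ∧ b ≠ c ∧ b ≠ d ∧ c ≠ d

open Classical in
theorem exists_cut (M : PMap F) (a : F) (h0 : M.r0 a ≠ a) (h2 : M.r2 a ≠ a)
    (h : M.r0 a ≠ M.r2 a) : ∃ N, Cut M N a (M.r0 a) (M.r2 a) (M.r0 (M.r2 a)) := by
  have j0 := M.i0
  have j2 := M.i2
  have i0 : ∀ x y, M.r0 x = M.r0 y → x = y := fun x y e => M.i0.injective e
  have i2 : ∀ x y, M.r2 x = M.r2 y → x = y := fun x y e => M.i2.injective e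
  have cm := M.comm a
  let S : Set F := {a, M.r0 a, M.r2 a, M.r0 (M.r2 a)}
  have hS : ∀ x, x ∈ S ↔ x = a ∨ x = M.r0 a ∨ x = M.r2 a ∨ x = M.r0 (M.r2 a) := fun x => Iff.rfl
  have S0 : ∀ x, M.r0 x ∈ S ↔ x ∈ S := by
    intro x; rw [hS, hS]; have := j0 x; have := j0 a; have := j0 (M.r2 a); grind
  have S2 : ∀ x, M.r2 x ∈ S ↔ x ∈ S := by
    intro x; rw [hS, hS]; have := j2 x; have := j2 a; have := j2 (M.r0 a); grind
  have hn : M.r0 (M.r2 a) ≠ a := fun e => h (by rw [← j0 (M.r2 a), e])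
  have hn2 : M.r0 (M.r2 a) ≠ M.r2 a := by rw [cm]; exact fun e => h0 (i2 _ _ e)
  let N : PMap F :=
    { r0 := M.r0
      r1 := M.r1
      r2 := fun x => if x ∈ S then M.r0 x else M.r2 x
      i0 := M.i0
      i1 := M.i1
      i2 := by
        intro x
        by_cases hx : x ∈ S
        · simp [hx, S0, M.i0 x]
        · simp [hx, S2, M.i2 x]
      comm := by
        intro x
        by_cases hx : x ∈ S
        · simp [hx, S0]
        · simp [hx, S0, M.comm]
      nofix := by
        intro x hx
        have : x ∉ S := by
          rw [hS]; rintro (rfl | rfl | rfl | rfl)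
          · exact h0 hx
          · exact h0 (i0 _ _ hx)
          · exact hn2 hx
          · exact hn2 (i0 _ _ hx)
        simp only [this, if_false]
        exact M.nofix x hx }
  refine ⟨N, rfl, rfl, rfl, rfl, rfl, ?_, ?_, ?_, ?_, ?_⟩
  · rw [cm]
  · exact if_pos ((hS _).2 (Or.inl rfl))
  · exact if_pos ((hS _).2 (Or.inr (Or.inr (Or.inl rfl))))
  · intro x h1 h2 h3 h4
    exact if_neg (by rw [hS]; tauto)
  · exact ⟨h0.symm, h2.symm, hn.symm, h, fun e => h2 (i0 _ _ e.symm), hn2.symm⟩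

open Classical in
/-- The inverse of cutting: two folded edges are glued to a complete edge. -/
theorem exists_glue (N : PMap F) (a c : F) (ha : N.r0 a = N.r2 a) (hc : N.r0 c = N.r2 c)
    (h1 : c ≠ a) (h2 : c ≠ N.r0 a) : ∃ M, Cut M N a (N.r0 a) c (N.r0 c) := by
  have j0 := N.i0
  have j2 := N.i2
  have i0 : ∀ x y, N.r0 x = N.r0 y → x = y := fun x y e => N.i0.injective e
  have na : N.r0 a ≠ a := fun e => N.nofix a e (ha ▸ e)
  have nc : N.r0 c ≠ c := fun e => N.nofix c e (hc ▸ e)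
  have n1 : N.r0 c ≠ a := fun e => h2 (by rw [← e, N.i0])
  have n2 : N.r0 c ≠ N.r0 a := fun e => h1 (i0 _ _ e)
  let r2 : F → F := fun x => if x = a then c else if x = c then a else
    if x = N.r0 a then N.r0 c else if x = N.r0 c then N.r0 a else N.r2 x
  have e1 : r2 a = c := by simp [r2]
  have e2 : r2 c = a := by simp [r2, h1]
  have e3 : r2 (N.r0 a) = N.r0 c := by simp [r2, na, h2.symm]
  have e4 : r2 (N.r0 c) = N.r0 a := by simp [r2, n1, nc, n2]
  have e5 : ∀ x, x ≠ a → x ≠ N.r0 a → x ≠ c → x ≠ N.r0 c → r2 x = N.r2 x := by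
    intro x k1 k2 k3 k4; simp [r2, k1, k2, k3, k4]
  clear_value r2
  let M : PMap F :=
    { r0 := N.r0
      r1 := N.r1
      r2 := r2
      i0 := N.i0
      i1 := N.i1
      i2 := by
        intro x
        have := j2 x
        have := j2 a
        have := j2 c
        have := e5 x
        have := e5 (N.r2 x)
        by_cases k1 : x = a
        · grind
        by_cases k2 : x = N.r0 a
        · grind
        by_cases k3 : x = c
        · grind
        by_cases k4 : x = N.r0 c
        · grind
        have m1 : N.r2 x ≠ a := fun e => k2 (by rw [ha, ← e, j2 x])
        have m2 : N.r2 x ≠ N.r0 a := fun e => k1 (N.i2.injective (e.trans ha))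
        have m3 : N.r2 x ≠ c := fun e => k4 (by rw [hc, ← e, j2 x])
        have m4 : N.r2 x ≠ N.r0 c := fun e => k3 (N.i2.injective (e.trans hc))
        rw [e5 x k1 k2 k3 k4, e5 _ m1 m2 m3 m4, j2]
      comm := by
        intro x
        have := N.comm x
        have := e5 x
        have := e5 (N.r0 x)
        have := j0 x
        have := j0 a
        have := j0 c
        by_cases k1 : x = a
        · grind
        by_cases k2 : x = N.r0 a
        · grind
        by_cases k3 : x = c
        · grind
        by_cases k4 : x = N.r0 c
        · grind
        grind
      nofix := by
        intro x hx
        have := N.nofix x hx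
        have := e5 x
        have := j0 a
        have := j0 c
        by_cases k1 : x = a
        · grind
        by_cases k2 : x = N.r0 a
        · grind
        by_cases k3 : x = c
        · grind
        by_cases k4 : x = N.r0 c
        · grind
        grind }
  exact ⟨M, rfl, rfl, rfl, rfl, e1, e3, ha.symm, hc.symm,
    fun x k1 k2 k3 k4 => (e5 x k1 k2 k3 k4).symm,
    na.symm, h1.symm, n1.symm, h2.symm, n2.symm, nc.symm⟩

/-- The flags of the edge of `f`, if it is a complete edge. -/
def edge (M : PMap F) (f : F) : Set F := {f, M.r0 f, M.r2 f, M.r0 (M.r2 f)}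

/-- The classes are the pieces into which the flags at a vertex fall when the sides of the flags
in the edge of `f` are disconnected. -/
noncomputable def bs (M : PMap F) (f : F) : Setoid F := step M.r1 ⊔ step (off M.r2 (M.edge f))

/-- The classes are the connected components that remain when the edge of `f` is cut lengthwise. -/
noncomputable def gs (M : PMap F) (f : F) : Setoid F := step M.r0 ⊔ M.bs f

theorem Cut.edge_eq {M N : PMap F} {a b c d : F} (h : Cut M N a b c d) :
    M.edge a = {a, b, c, d} := by rw [edge, h.ac, h.ab, h.cd]

namespace Cut

variable {M N : PMap F} {a b c d : F} (h : Cut M N a b c d)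
include h

theorem ba : M.r0 b = a := by rw [← h.ab, M.i0]
theorem dc : M.r0 d = c := by rw [← h.cd, M.i0]
theorem ca : M.r2 c = a := by rw [← h.ac, M.i2]
theorem db : M.r2 d = b := by rw [← h.bd, M.i2]
theorem nba : N.r2 b = a := by rw [← h.nab, N.i2]
theorem ndc : N.r2 d = c := by rw [← h.ncd, N.i2]

theorem mem_edge {x : F} : x ∈ M.edge a ↔ x = a ∨ x = b ∨ x = c ∨ x = d := by
  rw [h.edge_eq]; rfl

theorem r2_mem_edge {x : F} (hx : x ∈ M.edge a) : M.r2 x ∈ M.edge a := by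
  rw [h.mem_edge] at hx ⊢
  rcases hx with rfl | rfl | rfl | rfl
  · rw [h.ac]; tauto
  · rw [h.bd]; tauto
  · rw [h.ca]; tauto
  · rw [h.db]; tauto

theorem off_inv : Involutive (off M.r2 (M.edge a)) := off_invol M.i2 fun _ => h.r2_mem_edge

theorem n_off_le : step (off M.r2 (M.edge a)) ≤ step N.r2 := by
  refine step_le.2 fun x => ?_
  by_cases hx : x ∈ M.edge a
  · rw [off_mem hx]
  · rw [off_notMem hx]
    rw [h.mem_edge] at hx
    rw [← h.r2 x (by tauto) (by tauto) (by tauto) (by tauto)]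
    exact step_rel _ x

theorem step_m : step M.r2 = step (off M.r2 (M.edge a)) ⊔ pair a c ⊔ pair b d := by
  apply le_antisymm
  · refine step_le.2 fun x => ?_
    have l1 : pair a c ≤ step (off M.r2 (M.edge a)) ⊔ pair a c ⊔ pair b d :=
      le_sup_right.trans le_sup_left
    have l2 : pair b d ≤ step (off M.r2 (M.edge a)) ⊔ pair a c ⊔ pair b d := le_sup_right
    by_cases hx : x ∈ M.edge a
    · rcases h.mem_edge.1 hx with rfl | rfl | rfl | rfl
      · rw [h.ac]; exact l1 (pair_rel _ _)
      · rw [h.bd]; exact l2 (pair_rel _ _)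
      · rw [h.ca]; exact Setoid.symm' _ (l1 (pair_rel _ _))
      · rw [h.db]; exact Setoid.symm' _ (l2 (pair_rel _ _))
    · have := step_rel (off M.r2 (M.edge a)) x
      rw [off_notMem hx] at this
      exact ((le_sup_left.trans le_sup_left :
        step (off M.r2 (M.edge a)) ≤ step (off M.r2 (M.edge a)) ⊔ pair a c ⊔ pair b d)) this
  · refine sup_le (sup_le step_off_le (pair_le.2 ?_)) (pair_le.2 ?_)
    · rw [← h.ac]; exact step_rel _ _
    · rw [← h.bd]; exact step_rel _ _

theorem step_n : step N.r2 = step (off M.r2 (M.edge a)) ⊔ pair a b ⊔ pair c d := by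
  apply le_antisymm
  · refine step_le.2 fun x => ?_
    have l1 : pair a b ≤ step (off M.r2 (M.edge a)) ⊔ pair a b ⊔ pair c d :=
      le_sup_right.trans le_sup_left
    have l2 : pair c d ≤ step (off M.r2 (M.edge a)) ⊔ pair a b ⊔ pair c d := le_sup_right
    by_cases hx : x ∈ M.edge a
    · rcases h.mem_edge.1 hx with rfl | rfl | rfl | rfl
      · rw [h.nab]; exact l1 (pair_rel _ _)
      · rw [h.nba]; exact Setoid.symm' _ (l1 (pair_rel _ _))
      · rw [h.ncd]; exact l2 (pair_rel _ _)
      · rw [h.ndc]; exact Setoid.symm' _ (l2 (pair_rel _ _))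
    · have := step_rel (off M.r2 (M.edge a)) x
      rw [off_notMem hx] at this
      rw [h.mem_edge] at hx
      rw [h.r2 x (by tauto) (by tauto) (by tauto) (by tauto)]
      exact ((le_sup_left.trans le_sup_left :
        step (off M.r2 (M.edge a)) ≤ step (off M.r2 (M.edge a)) ⊔ pair a b ⊔ pair c d)) this
  · refine sup_le (sup_le h.n_off_le (pair_le.2 ?_)) (pair_le.2 ?_)
    · rw [← h.nab]; exact step_rel _ _
    · rw [← h.ncd]; exact step_rel _ _

theorem m_vs : M.vs = M.bs a ⊔ pair a c ⊔ pair b d := by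
  rw [vs, h.step_m, bs, sup_assoc, sup_assoc, sup_assoc]

theorem n_vs : N.vs = M.bs a ⊔ pair a b ⊔ pair c d := by
  rw [vs, h.step_n, h.r1, bs, sup_assoc, sup_assoc, sup_assoc]

theorem n_cs : N.cs = M.gs a := by
  have l0 : step M.r0 ≤ M.gs a := le_sup_left
  change step N.r0 ⊔ N.vs = M.gs a
  rw [h.n_vs, h.r0]
  refine le_antisymm (sup_le le_sup_left (sup_le (sup_le le_sup_right (pair_le.2 ?_))
    (pair_le.2 ?_))) (sup_le le_sup_left ?_)
  · rw [← h.ab]; exact l0 (step_rel _ _)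
  · rw [← h.cd]; exact l0 (step_rel _ _)
  · exact le_sup_left.trans (le_sup_left.trans le_sup_right)

theorem m_cs : M.cs = M.gs a ⊔ pair a c := by
  have l0 : step M.r0 ≤ M.gs a := le_sup_left
  have hab : M.gs a a b := by rw [← h.ab]; exact l0 (step_rel _ _)
  have hcd : M.gs a c d := by rw [← h.cd]; exact l0 (step_rel _ _)
  have l1 : M.gs a ≤ M.gs a ⊔ pair a c := le_sup_left
  have l2 : (M.gs a ⊔ pair a c) a c := (le_sup_right : pair a c ≤ _) (pair_rel _ _)
  change step M.r0 ⊔ M.vs = _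
  rw [h.m_vs]
  refine le_antisymm (sup_le (l0.trans l1) (sup_le (sup_le ?_ le_sup_right) (pair_le.2 ?_))) ?_
  · exact (le_sup_right : M.bs a ≤ M.gs a).trans l1
  · exact Setoid.trans' _ (Setoid.symm' _ (l1 hab)) (Setoid.trans' _ l2 (l1 hcd))
  · refine sup_le (sup_le le_sup_left ?_) (pair_le.2 ?_)
    · exact le_sup_left.trans (le_sup_left.trans le_sup_right)
    · exact (le_sup_right.trans (le_sup_left.trans le_sup_right) :
        pair a c ≤ step M.r0 ⊔ (M.bs a ⊔ pair a c ⊔ pair b d)) (pair_rel _ _)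

/-- The original map is connected iff cutting leaves no component besides those of the two sides. -/
theorem conn_iff : M.Conn ↔ ∀ x, N.cs a x ∨ N.cs c x := by
  have S := fun {x y} (k : N.cs x y) => Setoid.symm' _ k
  have T := fun {x y z} (k : N.cs x y) (k' : N.cs y z) => Setoid.trans' _ k k'
  constructor
  · intro k x
    have := k a x
    rw [h.m_cs, ← h.n_cs, sup_pair_iff] at this
    tauto
  · intro k x y
    rw [h.m_cs, ← h.n_cs, sup_pair_iff]
    rcases k x with k1 | k1 <;> rcases k y with k2 | k2
    · exact Or.inl (T (S k1) k2)
    · exact Or.inr (Or.inl ⟨S k1, k2⟩)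
    · exact Or.inr (Or.inr ⟨S k1, k2⟩)
    · exact Or.inl (T (S k1) k2)

theorem isCol {col : F → Bool} (hc : M.IsCol col) : N.IsCol col := by
  intro x
  obtain ⟨h0, h1, h2⟩ := hc x
  rw [h.r0, h.r1]
  refine ⟨h0, h1, ?_⟩
  by_cases hx : x ∈ M.edge a
  · rcases h.mem_edge.1 hx with rfl | rfl | rfl | rfl
    · rw [h.nab, ← h.ab]; exact h0
    · rw [h.nba, ← h.ba]; exact h0
    · rw [h.ncd, ← h.cd]; exact h0
    · rw [h.ndc, ← h.dc]; exact h0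
  · rw [h.mem_edge] at hx
    rw [h.r2 x (by tauto) (by tauto) (by tauto) (by tauto)]; exact h2

/-- A colouring of the cut map is one of the original map if the two sides fit together. -/
theorem isCol' {col : F → Bool} (hc : N.IsCol col) (hac : col a ≠ col c) : M.IsCol col := by
  have kab := (hc a).1
  have kcd := (hc c).1
  rw [h.r0, h.ab] at kab
  rw [h.r0, h.cd] at kcd
  have kab := kab h.ne.1.symm
  have kcd := kcd h.ne.2.2.2.2.2.symm
  have kbd : col b ≠ col d := by
    revert kab kcd hac
    cases col a <;> cases col b <;> cases col c <;> cases col d <;> simp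
  intro x
  obtain ⟨h0, h1, h2⟩ := hc x
  rw [h.r0] at h0
  rw [h.r1] at h1
  refine ⟨h0, h1, ?_⟩
  by_cases hx : x ∈ M.edge a
  · rcases h.mem_edge.1 hx with rfl | rfl | rfl | rfl
    · rw [h.ac]; exact fun _ => hac.symm
    · rw [h.bd]; exact fun _ => kbd.symm
    · rw [h.ca]; exact fun _ => hac
    · rw [h.db]; exact fun _ => kbd
  · rw [h.mem_edge] at hx
    rw [← h.r2 x (by tauto) (by tauto) (by tauto) (by tauto)]; exact h2

theorem fold_eq : N.fold = M.fold ∪ {a, b, c, d} := by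
  ext x
  by_cases hx : x ∈ M.edge a
  · rw [h.edge_eq] at hx
    refine iff_of_true ?_ (Or.inr hx)
    change N.r0 x = N.r2 x
    rw [h.r0]
    rcases hx with rfl | rfl | rfl | rfl
    · rw [h.nab, h.ab]
    · rw [h.nba, h.ba]
    · rw [h.ncd, h.cd]
    · rw [h.ndc, h.dc]
  · have hx' := hx
    rw [h.edge_eq] at hx'
    rw [h.mem_edge] at hx
    rw [Set.mem_union, or_iff_left hx']
    change N.r0 x = N.r2 x ↔ M.r0 x = M.r2 x
    rw [h.r0, h.r2 x (by tauto) (by tauto) (by tauto) (by tauto)]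

theorem fold_disj {x : F} (hx : x ∈ M.fold) : x ≠ a ∧ x ≠ b ∧ x ≠ c ∧ x ≠ d := by
  obtain ⟨n1, n2, n3, n4, n5, n6⟩ := h.ne
  have hx : M.r0 x = M.r2 x := hx
  refine ⟨?_, ?_, ?_, ?_⟩
  · rintro rfl; rw [h.ab, h.ac] at hx; exact n4 hx
  · rintro rfl; rw [h.ba, h.bd] at hx; exact n3 hx
  · rintro rfl; rw [h.cd, h.ca] at hx; exact n3 hx.symm
  · rintro rfl; rw [h.dc, h.db] at hx; exact n4 hx.symm

theorem r2_fixed_iff (x : F) : N.r2 x = x ↔ M.r2 x = x := by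
  obtain ⟨n1, n2, n3, n4, n5, n6⟩ := h.ne
  by_cases hx : x ∈ M.edge a
  · rcases h.mem_edge.1 hx with rfl | rfl | rfl | rfl
    · rw [h.nab, h.ac]; exact iff_of_false n1.symm n2.symm
    · rw [h.nba, h.bd]; exact iff_of_false n1 n5.symm
    · rw [h.ncd, h.ca]; exact iff_of_false n6.symm n2
    · rw [h.ndc, h.db]; exact iff_of_false n6 n5
  · rw [h.mem_edge] at hx
    rw [h.r2 x (by tauto) (by tauto) (by tauto) (by tauto)]

/-- Cutting the edge increases the Euler characteristic by one more than the number of vertices. -/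
theorem chi_eq [Finite F] : N.chi + numC M.vs = M.chi + numC N.vs + 1 := by
  obtain ⟨n1, n2, n3, n4, n5, n6⟩ := h.ne
  have e2 : numC (step N.r2) = numC (step M.r2) := by
    have k1 := two_mul_numC_step N.i2
    have k2 := two_mul_numC_step M.i2
    simp only [h.r2_fixed_iff] at k1
    omega
  -- the edge falls into two edges
  have ee : numC N.es = numC M.es + 1 := by
    set t := step M.r0 ⊔ step (off M.r2 (M.edge a)) with ht
    have l0 : step M.r0 ≤ t := le_sup_left
    have hab : t a b := by rw [← h.ab]; exact l0 (step_rel _ _)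
    have hcd : t c d := by rw [← h.cd]; exact l0 (step_rel _ _)
    have hac : ¬ t a c := by
      intro k
      have := rel_mem (T := {x | x = a ∨ x = b}) ht (fun x => ?_) (fun x => ?_) k
      · rcases this.1 (Or.inl rfl) with e | e
        · exact n2 e.symm
        · exact n4 e.symm
      · have := M.i0 x
        have e1 := h.ab
        have e2 := h.ba
        change (M.r0 x = a ∨ M.r0 x = b) ↔ (x = a ∨ x = b)
        grind
      · change (off M.r2 (M.edge a) x = a ∨ off M.r2 (M.edge a) x = b) ↔ (x = a ∨ x = b)
        by_cases hx : x ∈ M.edge a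
        · rw [off_mem hx]
        · rw [off_notMem hx]
          have : M.r2 x ∉ M.edge a := fun k => hx (by simpa [M.i2 x] using h.r2_mem_edge k)
          rw [h.mem_edge] at hx this
          tauto
    have e1 : M.es = t ⊔ pair a c := by
      have : M.es = t ⊔ pair a c ⊔ pair b d := by
        rw [es, h.step_m, ht, sup_assoc, sup_assoc, sup_assoc]
      rw [this, sup_pair_eq]
      exact sup_pair_iff.2 (Or.inr (Or.inl ⟨Setoid.symm' _ hab, hcd⟩))
    have e2 : N.es = t := by
      have : N.es = t ⊔ pair a b ⊔ pair c d := by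
        rw [es, h.step_n, h.r0, ht, sup_assoc, sup_assoc, sup_assoc]
      rw [this, sup_pair_eq hab, sup_pair_eq hcd]
    rw [e1, e2]
    exact (numC_sup_pair hac).symm
  have ef : N.fs = M.fs := by rw [fs, fs, h.r0, h.r1]
  rw [chi, chi, ee, ef, e2, h.r0, h.r1]
  push_cast
  ring

end Cut

end PMap

namespace PMap

variable {F A B : Type}

/-! ### Disjoint unions and the cut edge -/

/-- The disjoint union of two maps. -/
def sum (M : PMap A) (N : PMap B) : PMap (A ⊕ B) where
  r0 := Sum.map M.r0 N.r0
  r1 := Sum.map M.r1 N.r1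
  r2 := Sum.map M.r2 N.r2
  i0 := by rintro (x | x) <;> simp [M.i0 _, N.i0 _]
  i1 := by rintro (x | x) <;> simp [M.i1 _, N.i1 _]
  i2 := by rintro (x | x) <;> simp [M.i2 _, N.i2 _]
  comm := by rintro (x | x) <;> simp [M.comm, N.comm]
  nofix := by
    rintro (x | x) <;> simp
    · exact M.nofix x
    · exact N.nofix x

theorem hom_inl (M : PMap A) (N : PMap B) : Hom M (M.sum N) Sum.inl :=
  ⟨fun _ => rfl, fun _ => rfl, fun _ => rfl⟩

theorem hom_inr (M : PMap A) (N : PMap B) : Hom N (M.sum N) Sum.inr :=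
  ⟨fun _ => rfl, fun _ => rfl, fun _ => rfl⟩

theorem sum_chi [Finite A] [Finite B] (M : PMap A) (N : PMap B) :
    (M.sum N).chi = M.chi + N.chi := by
  let X := M.sum N
  have s := fun {σ τ : A ⊕ B → A ⊕ B} (hσ : Involutive σ) (hτ : Involutive τ) {σ₁ τ₁ : A → A}
    {σ₂ τ₂ : B → B} => numC_sum hσ hτ (σ₁ := σ₁) (τ₁ := τ₁) (σ₂ := σ₂) (τ₂ := τ₂) (Equiv.refl _)
  have hv : numC X.vs = numC M.vs + numC N.vs :=
    s X.i1 X.i2 (fun _ => rfl) (fun _ => rfl) (fun _ => rfl) (fun _ => rfl)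
  have he : numC X.es = numC M.es + numC N.es :=
    s X.i0 X.i2 (fun _ => rfl) (fun _ => rfl) (fun _ => rfl) (fun _ => rfl)
  have hf : numC X.fs = numC M.fs + numC N.fs :=
    s X.i0 X.i1 (fun _ => rfl) (fun _ => rfl) (fun _ => rfl) (fun _ => rfl)
  have h0 : numC (step X.r0) = numC (step M.r0) + numC (step N.r0) := by
    have := s X.i0 X.i0 (σ₁ := M.r0) (τ₁ := M.r0) (σ₂ := N.r0) (τ₂ := N.r0)
      (fun _ => rfl) (fun _ => rfl) (fun _ => rfl) (fun _ => rfl)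
    rwa [sup_idem, sup_idem, sup_idem] at this
  have h1 : numC (step X.r1) = numC (step M.r1) + numC (step N.r1) := by
    have := s X.i1 X.i1 (σ₁ := M.r1) (τ₁ := M.r1) (σ₂ := N.r1) (τ₂ := N.r1)
      (fun _ => rfl) (fun _ => rfl) (fun _ => rfl) (fun _ => rfl)
    rwa [sup_idem, sup_idem, sup_idem] at this
  have h2 : numC (step X.r2) = numC (step M.r2) + numC (step N.r2) := by
    have := s X.i2 X.i2 (σ₁ := M.r2) (τ₁ := M.r2) (σ₂ := N.r2) (τ₂ := N.r2)
      (fun _ => rfl) (fun _ => rfl) (fun _ => rfl) (fun _ => rfl)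
    rwa [sup_idem, sup_idem, sup_idem] at this
  change X.chi = _
  rw [chi, chi, chi, hv, he, hf, h0, h1, h2, Nat.card_sum]
  push_cast
  ring

theorem Hom.sum {A' B' : Type} {M : PMap A} {N : PMap B} {M' : PMap A'} {N' : PMap B'}
    {e : A ≃ A'} {d : B ≃ B'} (h : Hom M M' e) (k : Hom N N' d) :
    Hom (M.sum N) (M'.sum N') (Equiv.sumCongr e d) := by
  refine ⟨?_, ?_, ?_⟩ <;> rintro (x | x)
  · exact congrArg Sum.inl (h.h0 x)
  · exact congrArg Sum.inr (k.h0 x)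
  · exact congrArg Sum.inl (h.h1 x)
  · exact congrArg Sum.inr (k.h1 x)
  · exact congrArg Sum.inl (h.h2 x)
  · exact congrArg Sum.inr (k.h2 x)

/-- A map on `A ⊕ B` in which no flag of `A` is connected with a flag of `B` is a disjoint union. -/
theorem exists_eq_sum (X : PMap (A ⊕ B)) (hX : ∀ x y, ¬ X.cs (.inl x) (.inr y)) :
    ∃ M N, X = sum M N := by
  have key : ∀ r : A ⊕ B → A ⊕ B, Involutive r → (∀ x, X.cs x (r x)) →
      (∀ x, ∃ y, r (.inl x) = .inl y) ∧ ∀ x, ∃ y, r (.inr x) = .inr y := by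
    intro r _ h
    refine ⟨fun x => ?_, fun x => ?_⟩
    · have := h (.inl x)
      rcases e : r (.inl x) with y | y
      · exact ⟨y, rfl⟩
      · exact absurd (e ▸ this) (hX x y)
    · have := h (.inr x)
      rcases e : r (.inr x) with y | y
      · exact absurd (Setoid.symm' _ (e ▸ this)) (hX y x)
      · exact ⟨y, rfl⟩
  obtain ⟨k0, l0⟩ := key X.r0 X.i0 X.cs_r0
  obtain ⟨k1, l1⟩ := key X.r1 X.i1 X.cs_r1
  obtain ⟨k2, l2⟩ := key X.r2 X.i2 X.cs_r2
  choose a0 ha0 using k0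
  choose a1 ha1 using k1
  choose a2 ha2 using k2
  choose b0 hb0 using l0
  choose b1 hb1 using l1
  choose b2 hb2 using l2
  let M : PMap A :=
    { r0 := a0
      r1 := a1
      r2 := a2
      i0 := fun x => Sum.inl_injective (by rw [← ha0, ← ha0, X.i0])
      i1 := fun x => Sum.inl_injective (by rw [← ha1, ← ha1, X.i1])
      i2 := fun x => Sum.inl_injective (by rw [← ha2, ← ha2, X.i2])
      comm := fun x => Sum.inl_injective (by rw [← ha0, ← ha2, X.comm, ha0, ha2])
      nofix := fun x hx e => X.nofix (.inl x) (by rw [ha0, hx]) (by rw [ha2, e]) }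
  let N : PMap B :=
    { r0 := b0
      r1 := b1
      r2 := b2
      i0 := fun x => Sum.inr_injective (by rw [← hb0, ← hb0, X.i0])
      i1 := fun x => Sum.inr_injective (by rw [← hb1, ← hb1, X.i1])
      i2 := fun x => Sum.inr_injective (by rw [← hb2, ← hb2, X.i2])
      comm := fun x => Sum.inr_injective (by rw [← hb0, ← hb2, X.comm, hb0, hb2])
      nofix := fun x hx e => X.nofix (.inr x) (by rw [hb0, hx]) (by rw [hb2, e]) }
  refine ⟨M, N, PMap.ext (funext ?_) (funext ?_) (funext ?_)⟩ <;> rintro (x | x)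
  · exact ha0 x
  · exact hb0 x
  · exact ha1 x
  · exact hb1 x
  · exact ha2 x
  · exact hb2 x

theorem sum_cs_inl (M : PMap A) (N : PMap B) (hM : M.Conn) (a : A) (x : A ⊕ B) :
    (M.sum N).cs (.inl a) x ↔ ∃ y, x = .inl y := by
  rw [(hom_inl M N).cs_iff]
  exact ⟨fun ⟨z, hz, _⟩ => ⟨z, hz.symm⟩, fun ⟨y, hy⟩ => ⟨y, hy.symm, hM _ _⟩⟩

theorem sum_cs_inr (M : PMap A) (N : PMap B) (hN : N.Conn) (b : B) (x : A ⊕ B) :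
    (M.sum N).cs (.inr b) x ↔ ∃ y, x = .inr y := by
  rw [(hom_inr M N).cs_iff]
  exact ⟨fun ⟨z, hz, _⟩ => ⟨z, hz.symm⟩, fun ⟨y, hy⟩ => ⟨y, hy.symm, hN _ _⟩⟩

/-- An isomorphism of disjoint unions of two connected maps that respects one flag of each component
is a pair of isomorphisms. -/
theorem Hom.of_sum {A' B' : Type} {M : PMap A} {N : PMap B} {M' : PMap A'} {N' : PMap B'}
    {d : A ⊕ B ≃ A' ⊕ B'} (h : Hom (M.sum N) (M'.sum N') d) (hM : M.Conn) (hN : N.Conn)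
    (hM' : M'.Conn) (hN' : N'.Conn) {a : A} {b : B} {a' : A'} {b' : B'}
    (ha : d (.inl a) = .inl a') (hb : d (.inr b) = .inr b') :
    (∃ e : A ≃ A', Hom M M' e ∧ e a = a') ∧ ∃ e : B ≃ B', Hom N N' e ∧ e b = b' := by
  have g : ∀ x, ∃ y, d (.inl x) = .inl y := fun x => by
    rw [← sum_cs_inl M' N' hM' a', ← ha, h.cs_iff' d.injective]
    exact (sum_cs_inl M N hM a _).2 ⟨x, rfl⟩
  have g' : ∀ x, ∃ y, d (.inr x) = .inr y := fun x => by
    rw [← sum_cs_inr M' N' hN' b', ← hb, h.cs_iff' d.injective]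
    exact (sum_cs_inr M N hN b _).2 ⟨x, rfl⟩
  choose f hf using g
  choose f' hf' using g'
  have bij : Bijective f := by
    constructor
    · intro x y k
      exact Sum.inl_injective (d.injective (by rw [hf, hf, k]))
    · intro y
      obtain ⟨x | x, hx⟩ := d.surjective (.inl y)
      · exact ⟨x, Sum.inl_injective (by rw [← hf, hx])⟩
      · rw [hf'] at hx; cases hx
  have bij' : Bijective f' := by
    constructor
    · intro x y k
      exact Sum.inr_injective (d.injective (by rw [hf', hf', k]))
    · intro y
      obtain ⟨x | x, hx⟩ := d.surjective (.inr y)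
      · rw [hf] at hx; cases hx
      · exact ⟨x, Sum.inr_injective (by rw [← hf', hx])⟩
  constructor
  · refine ⟨Equiv.ofBijective f bij, ⟨fun x => ?_, fun x => ?_, fun x => ?_⟩,
      Sum.inl_injective ((hf a).symm.trans ha)⟩
    · have := h.h0 (.inl x); rw [hf] at this; exact Sum.inl_injective ((hf _).symm.trans this)
    · have := h.h1 (.inl x); rw [hf] at this; exact Sum.inl_injective ((hf _).symm.trans this)
    · have := h.h2 (.inl x); rw [hf] at this; exact Sum.inl_injective ((hf _).symm.trans this)
  · refine ⟨Equiv.ofBijective f' bij', ⟨fun x => ?_, fun x => ?_, fun x => ?_⟩,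
      Sum.inr_injective ((hf' b).symm.trans hb)⟩
    · have := h.h0 (.inr x); rw [hf'] at this; exact Sum.inr_injective ((hf' _).symm.trans this)
    · have := h.h1 (.inr x); rw [hf'] at this; exact Sum.inr_injective ((hf' _).symm.trans this)
    · have := h.h2 (.inr x); rw [hf'] at this; exact Sum.inr_injective ((hf' _).symm.trans this)

section CutHom

variable {M N : PMap A} {M' N' : PMap B} {a b c d : A} {a' b' c' d' : B} {e : A ≃ B}

/-- Cutting and gluing are natural. -/
theorem Cut.hom_iff (h : Cut M N a b c d) (h' : Cut M' N' a' b' c' d') (ha : e a = a')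
    (hc : e c = c') : Hom M M' e ↔ Hom N N' e := by
  have key : (∀ x, e (M.r0 x) = M'.r0 (e x)) →
      ((∀ x, e (M.r2 x) = M'.r2 (e x)) ↔ ∀ x, e (N.r2 x) = N'.r2 (e x)) := by
    intro h0
    have hb : e b = b' := by rw [← h.ab, h0, ha, h'.ab]
    have hd : e d = d' := by rw [← h.cd, h0, hc, h'.cd]
    refine forall_congr' fun x => ?_
    by_cases k1 : x = a
    · subst k1
      rw [h.ac, h.nab, ha, h'.ac, h'.nab]; exact iff_of_true hc hb
    by_cases k2 : x = b
    · subst k2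
      rw [h.bd, h.nba, hb, h'.bd, h'.nba]; exact iff_of_true hd ha
    by_cases k3 : x = c
    · subst k3
      rw [h.ca, h.ncd, hc, h'.ca, h'.ncd]; exact iff_of_true ha hd
    by_cases k4 : x = d
    · subst k4
      rw [h.db, h.ndc, hd, h'.db, h'.ndc]; exact iff_of_true hb hc
    rw [h.r2 x k1 k2 k3 k4, h'.r2 (e x)]
    · rw [← ha]; exact e.injective.ne k1
    · rw [← hb]; exact e.injective.ne k2
    · rw [← hc]; exact e.injective.ne k3
    · rw [← hd]; exact e.injective.ne k4
  constructor
  · intro k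
    exact ⟨fun x => by rw [h.r0, h'.r0]; exact k.h0 x, fun x => by rw [h.r1, h'.r1]; exact k.h1 x,
      (key k.h0).1 k.h2⟩
  · intro k
    have k0 := k.h0
    have k1 := k.h1
    rw [h.r0, h'.r0] at k0
    rw [h.r1, h'.r1] at k1
    exact ⟨k0, k1, (key k0).2 k.h2⟩

theorem Cut.map (h : Cut M N a b c d) (e : A ≃ B) :
    Cut (M.map e) (N.map e) (e a) (e b) (e c) (e d) := by
  have ne := h.ne
  refine ⟨?_, ?_, ?_, ?_, ?_, ?_, ?_, ?_, ?_, ?_⟩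
  · simp [PMap.map, h.r0]
  · simp [PMap.map, h.r1]
  · simp [PMap.map, h.ab]
  · simp [PMap.map, h.cd]
  · simp [PMap.map, h.ac]
  · simp [PMap.map, h.bd]
  · simp [PMap.map, h.nab]
  · simp [PMap.map, h.ncd]
  · intro x k1 k2 k3 k4
    simp only [PMap.map]
    rw [h.r2]
    · rwa [Ne, Equiv.symm_apply_eq]
    · rwa [Ne, Equiv.symm_apply_eq]
    · rwa [Ne, Equiv.symm_apply_eq]
    · rwa [Ne, Equiv.symm_apply_eq]
  · simpa using ne

end CutHom

/-- The edge of `f` is a complete edge; if it is cut lengthwise, its sides get disconnected, and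
the component of `f` has `m` darts. -/
def Sep (m : ℕ) (L : PMap F) (f : F) : Prop :=
  (L.r0 f ≠ f ∧ L.r2 f ≠ f ∧ L.r0 f ≠ L.r2 f) ∧ ¬ L.gs f f (L.r2 f) ∧
    {x | L.gs f f x}.ncard = 2 * m

/-- Pairs of connected maps with marked folded edges correspond to maps with a root edge
that is separated by cutting the edge lengthwise. -/
theorem cnt_glue {m l : ℕ} {P Q Y : ∀ {F : Type}, PMap F → F → Prop}
    (hY : Inv Y) (P1 : ∀ {F : Type} {M : PMap F} {f : F}, P M f → M.Conn ∧ M.r0 f = M.r2 f)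
    (Q1 : ∀ {F : Type} {M : PMap F} {f : F}, Q M f → M.Conn ∧ M.r0 f = M.r2 f)
    (Y1 : ∀ {F : Type} {M : PMap F} {f : F}, Y M f → M.Conn)
    (h : ∀ {A B : Type} [Finite A] [Finite B] {M : PMap A} {N : PMap B} {L : PMap (A ⊕ B)} {a b : A}
      {c d : B}, M.Conn → N.Conn → Cut L (M.sum N) (.inl a) (.inl b) (.inr c) (.inr d) →
      (P M a ∧ Q N c ↔ Y L (.inl a))) :
    cnt m P * cnt l Q = cnt (m + l) fun L f => Y L f ∧ Sep m L f := by
  have hc : Nat.card (Fin (2 * m) ⊕ Fin (2 * l)) = Nat.card (Fin (2 * (m + l))) := by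
    simp [mul_add]
  have E : Fin (2 * m) ⊕ Fin (2 * l) ≃ Fin (2 * (m + l)) := (Finite.card_eq.1 hc).some
  rw [cnt, cnt, ← ncard_image_prod]
  refine ncard_transfer (fun x y => ∃ j : Fin (2 * m) ⊕ Fin (2 * l) ≃ Fin (2 * (m + l)),
    ∃ X, Hom (x.1.1.sum x.2.1) X j ∧
      Cut y.1 X y.2 (y.1.r0 y.2) (y.1.r2 y.2) (y.1.r0 (y.1.r2 y.2)) ∧
      j (.inl x.1.2) = y.2 ∧ j (.inr x.2.2) = y.1.r2 y.2) ?_ ?_ ?_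
  · rintro ⟨⟨M, a⟩, ⟨N, c⟩⟩ ⟨hM, hN⟩
    change P M a at hM
    change Q N c at hN
    obtain ⟨M1, M2⟩ := P1 hM
    obtain ⟨N1, N2⟩ := Q1 hN
    obtain ⟨L, hL⟩ := exists_glue (M.sum N) (.inl a) (.inr c)
      (congrArg Sum.inl M2) (congrArg Sum.inr N2) (by simp) (by simp [sum])
    have hYL := (h M1 N1 hL).1 ⟨hM, hN⟩
    have hL' := hL.map E
    have e1 : (L.map E).r0 (E (.inl a)) = E ((M.sum N).r0 (.inl a)) := hL'.ab
    have e2 : (L.map E).r2 (E (.inl a)) = E (.inr c) := hL'.ac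
    have e3 : (L.map E).r0 (E (.inr c)) = E ((M.sum N).r0 (.inr c)) := hL'.cd
    have hcs : ∀ x, ((M.sum N).map E).cs (E (.inl a)) (E x) ↔ ∃ y, x = .inl y := fun x => by
      rw [(hom_map _ _).cs_iff' E.injective, sum_cs_inl _ _ M1]
    refine ⟨(L.map E, E (.inl a)), ⟨hY (hom_map _ _) _ hYL, ⟨?_, ?_⟩, ?_, ?_⟩,
      E, (M.sum N).map E, hom_map _ _, ?_, rfl, ?_⟩
    · rw [e1]; exact hL'.ne.1.symm
    · rw [e1, e2]; exact ⟨hL'.ne.2.1.symm, hL'.ne.2.2.2.1⟩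
    · rw [← hL'.n_cs, e2, hcs]; simp
    · rw [← hL'.n_cs]
      have : {x | ((M.sum N).map E).cs (E (.inl a)) x} =
          (fun y => E (Sum.inl y)) '' (Set.univ : Set (Fin (2 * m))) := by
        ext x
        obtain ⟨x, rfl⟩ := E.surjective x
        rw [Set.mem_ofPred_eq, hcs]
        simp [eq_comm]
      have inj : Injective fun y => E (Sum.inl y) := E.injective.comp Sum.inl_injective
      rw [this, Set.ncard_image_of_injective _ inj,
        Set.ncard_univ, Nat.card_eq_fintype_card, Fintype.card_fin]
    · dsimp only
      rw [e1, e2, e3]; exact hL'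
    · exact e2.symm
  · rintro ⟨L, f⟩ ⟨hYL, ⟨k0, k2, k⟩, k3, k4⟩
    dsimp only at hYL k0 k2 k k3 k4
    obtain ⟨X, hX⟩ := exists_cut L f k0 k2 k
    rw [← hX.n_cs] at k3 k4
    -- number the flags of the two components
    classical
    have hc1 : Nat.card {x // X.cs f x} = Nat.card (Fin (2 * m)) := by
      rw [← Nat.card_coe_set_eq] at k4
      rw [Nat.card_eq_fintype_card (α := Fin _), Fintype.card_fin, ← k4]
      rfl
    have hc2 : Nat.card {x // ¬ X.cs f x} = Nat.card (Fin (2 * l)) := by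
      have := Nat.card_congr (Equiv.sumCompl fun x => X.cs f x)
      rw [Nat.card_sum, hc1] at this
      simp only [Nat.card_eq_fintype_card (α := Fin _), Fintype.card_fin] at this ⊢
      omega
    have E1 : {x // X.cs f x} ≃ Fin (2 * m) := (Finite.card_eq.1 hc1).some
    have E2 : {x // ¬ X.cs f x} ≃ Fin (2 * l) := (Finite.card_eq.1 hc2).some
    let j : Fin (2 * m) ⊕ Fin (2 * l) ≃ Fin (2 * (m + l)) :=
      (Equiv.sumCongr E1.symm E2.symm).trans (Equiv.sumCompl fun x => X.cs f x)
    have j1 : ∀ x, X.cs f (j (.inl x)) := fun x => (E1.symm x).2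
    have j2 : ∀ x, ¬ X.cs f (j (.inr x)) := fun x => (E2.symm x).2
    have hj := hom_map X j.symm
    obtain ⟨M, N, hS⟩ := exists_eq_sum (X.map j.symm) (by
      intro x y
      rw [← hj.symm.cs_iff' j.injective]
      exact fun H => j2 y (Setoid.trans' _ (j1 x) H))
    rw [hS] at hj
    have inl_of : ∀ x, X.cs f x → ∃ a, j (.inl a) = x := by
      intro x hx
      obtain ⟨a | a, rfl⟩ := j.surjective x
      · exact ⟨a, rfl⟩
      · exact absurd hx (j2 a)
    have inr_of : ∀ x, ¬ X.cs f x → ∃ a, j (.inr a) = x := by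
      intro x hx
      obtain ⟨a | a, rfl⟩ := j.surjective x
      · exact absurd (j1 a) hx
      · exact ⟨a, rfl⟩
    have hLc := hX.conn_iff.1 (Y1 hYL)
    obtain ⟨a, ha⟩ := inl_of f (Setoid.refl' _ _)
    obtain ⟨b, hb⟩ := inl_of (L.r0 f) (by rw [← hX.r0]; exact X.cs_r0 f)
    obtain ⟨c, hc⟩ := inr_of (L.r2 f) k3
    obtain ⟨d, hd⟩ := inr_of (L.r0 (L.r2 f)) (fun H => k3 (by
      have := X.cs_r0 (L.r2 f)
      rw [hX.r0] at this
      exact Setoid.trans' _ H (Setoid.symm' _ this)))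
    have M1 : M.Conn := by
      have : ∀ x, M.cs a x := fun x => by
        rw [← (hom_inl M N).cs_iff' Sum.inl_injective, ← hj.symm.cs_iff' j.injective]
        change X.cs (j (.inl a)) (j (.inl x))
        rw [ha]; exact j1 x
      exact fun x y => Setoid.trans' _ (Setoid.symm' _ (this x)) (this y)
    have N1 : N.Conn := by
      have : ∀ x, N.cs c x := fun x => by
        rw [← (hom_inr M N).cs_iff' Sum.inr_injective, ← hj.symm.cs_iff' j.injective]
        change X.cs (j (.inr c)) (j (.inr x))
        rw [hc]; exact (hLc _).resolve_left (j2 x)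
      exact fun x y => Setoid.trans' _ (Setoid.symm' _ (this x)) (this y)
    have hcut := hX.map j.symm
    rw [hS, ← hd, ← hc, ← hb] at hcut
    have hf : j.symm f = .inl a := by rw [← ha, j.symm_apply_apply]
    rw [hf] at hcut
    simp only [j.symm_apply_apply] at hcut
    have hYL' := hY (hom_map L j.symm) _ hYL
    rw [hf] at hYL'
    obtain ⟨hM, hN⟩ := (h M1 N1 hcut).2 hYL'
    exact ⟨((M, a), (N, c)), ⟨hM, hN⟩, j, X, hj.symm, hX, ha, hc⟩
  · rintro ⟨⟨M, a⟩, ⟨N, c⟩⟩ ⟨hM, hN⟩ ⟨⟨M', a'⟩, ⟨N', c'⟩⟩ ⟨hM', hN'⟩ ⟨L, f⟩ - ⟨L', f'⟩ -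
      ⟨j, X, hj, hX, ha, hc⟩ ⟨j', X', hj', hX', ha', hc'⟩
    dsimp only at hj hX ha hc hj' hX' ha' hc'
    constructor
    · rintro ⟨⟨e, he, ea⟩, ⟨d, hd, dc⟩⟩
      dsimp only at ea dc he hd
      let g : Fin (2 * (m + l)) ≃ Fin (2 * (m + l)) := (j.symm.trans (Equiv.sumCongr e d)).trans j'
      have g1 : g f = f' := by
        change j' (Equiv.sumCongr e d (j.symm f)) = f'
        rw [← ha, j.symm_apply_apply, ← ha', ← ea]; rfl
      have g2 : g (L.r2 f) = L'.r2 f' := by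
        change j' (Equiv.sumCongr e d (j.symm (L.r2 f))) = L'.r2 f'
        rw [← hc, j.symm_apply_apply, ← hc', ← dc]; rfl
      exact ⟨g, (hX.hom_iff hX' g1 g2).2 ((hj.symm.comp (he.sum hd)).comp hj'), g1⟩
    · rintro ⟨g, hg, g1⟩
      dsimp only at g1
      have g2 : g (L.r2 f) = L'.r2 f' := by rw [hg.h2, g1]
      have := (hX.hom_iff hX' g1 g2).1 hg
      have := Hom.of_sum (d := (j.trans g).trans j'.symm) ((hj.comp this).comp hj'.symm)
        (P1 hM).1 (Q1 hN).1 (P1 hM').1 (Q1 hN').1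
        (a := a) (b := c) (a' := a') (b' := c') ?_ ?_
      · exact this
      · change j'.symm (g (j (.inl a))) = _
        rw [ha, g1, ← ha', j'.symm_apply_apply]
      · change j'.symm (g (j (.inr c))) = _
        rw [hc, g2, ← hc', j'.symm_apply_apply]

end PMap

/-! ### The vertex of a flag next to the boundary -/

namespace PMap

variable {F A B : Type}

theorem vs_set_eq {M : PMap F} {f g : F} (h : M.vs f g) (x : F) : M.vs f x ↔ M.vs g x :=
  ⟨fun k => Setoid.trans' _ (Setoid.symm' _ h) k, fun k => Setoid.trans' _ h k⟩

theorem be_congr {M : PMap F} {f g : F} (h : M.vs f g) : M.be f = M.be g := by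
  simp only [be, vs_set_eq h]

theorem inn_congr {M : PMap F} {f g : F} (h : M.vs f g) : M.inn f = M.inn g := by
  simp only [inn, vs_set_eq h]

theorem be_add_inn [Finite F] (M : PMap F) (f : F) : M.be f + M.inn f = {g | M.vs f g}.ncard :=
  Set.ncard_inter_add_ncard_sdiff_eq_ncard {g | M.vs f g} {g | M.r2 g = g}

theorem inn_le [Finite F] (M : PMap F) (f : F) : M.inn f ≤ Nat.card F := by
  rw [← Set.ncard_univ]
  exact Set.ncard_le_ncard (Set.subset_univ _)

/-- The flags at a vertex on the boundary form a path; `f` is one of its ends. -/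
theorem vertex_path [Finite F] {M : PMap F} {f : F} (h : M.r1 f = f) :
    Even (M.inn f) ∧
    (M.be f = 1 ∧ (∀ y, M.vs f y → (M.r1 y = y ↔ y = f)) ∨
      M.be f = 0 ∧ ∃ z, M.vs f z ∧ z ≠ f ∧ (∀ y, M.vs f y → (M.r1 y = y ↔ y = f ∨ y = z)) ∧
        ∀ c, M.IsCol c → c z ≠ c f) := by
  have hs := M.be_add_inn f
  rcases path_ends M.i1 M.i2 h with ⟨z, hz, ho, H⟩ | ⟨z, hz, hn, he, H, hc⟩
  · have h1 : M.be f = 1 := by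
      have : {g | M.vs f g ∧ M.r2 g = g} = {z} := by
        ext y
        constructor
        · exact fun hy => ((H y hy.1).2).1 hy.2
        · rintro rfl; exact ⟨hz, ((H _ hz).2).2 rfl⟩
      rw [be, this, Set.ncard_singleton]
    change Odd {g | M.vs f g}.ncard at ho
    refine ⟨?_, Or.inl ⟨h1, fun y hy => (H y hy).1⟩⟩
    rw [← hs, h1] at ho
    rw [Nat.even_iff]; rw [Nat.odd_iff] at ho; omega
  · have h0 : M.be f = 0 := by
      have : {g | M.vs f g ∧ M.r2 g = g} = ∅ := by
        ext y
        exact iff_of_false (fun hy => (H y hy.1).2 hy.2) id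
      rw [be, this, Set.ncard_empty]
    change Even {g | M.vs f g}.ncard at he
    refine ⟨?_, Or.inr ⟨h0, z, hz, hn, fun y hy => (H y hy).1, fun c k => hc c fun y => (k y).2⟩⟩
    rwa [← hs, h0, zero_add] at he

theorem be_le_one [Finite F] {M : PMap F} {f : F} (h : M.r1 f = f) : M.be f < 2 := by
  rcases (vertex_path h).2 with h | h <;> omega

theorem r2_ne_of_be [Finite F] {M : PMap F} {f x : F} (h : M.be f = 0) (hx : M.vs f x) :
    M.r2 x ≠ x := by
  intro k
  rw [be, Set.ncard_eq_zero] at h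
  exact (Set.eq_empty_iff_forall_notMem.1 h x) ⟨hx, k⟩

/-! ### The classes of marked maps that are counted -/

/-- Disks without folded edge, whose root flag is next to the boundary; at the root vertex there are
`i` ends of boundary edges and `k` inner darts. -/
def D (i k : ℕ) (M : PMap F) (f : F) : Prop :=
  M.Disk ∧ M.fold = ∅ ∧ M.r1 f = f ∧ M.be f = i ∧ M.inn f = 2 * k

/-- Spheres without folded edge, whose root vertex has degree `k`. -/
def S (k : ℕ) (M : PMap F) (f : F) : Prop :=
  M.Sph ∧ M.fold = ∅ ∧ M.inn f = 2 * k

/-- Disks whose only folded edge contains the root flag, which is next to the boundary; the other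
darts at the root vertex are `i` boundary darts and `k` inner ones. -/
def G (i k : ℕ) (M : PMap F) (p : F) : Prop :=
  M.Disk ∧ M.fold = {p, M.r2 p} ∧ M.r1 p = p ∧ M.be p = i ∧ M.inn p = 2 * (k + 1)

/-- Spheres whose only folded edge contains the root flag; there are `k` other darts at the root
vertex. -/
def GS (k : ℕ) (M : PMap F) (p : F) : Prop :=
  M.Sph ∧ M.fold = {p, M.r2 p} ∧ M.inn p = 2 * (k + 1)

theorem Hom.fold_empty {M : PMap A} {N : PMap B} {e : A ≃ B} (h : Hom M N e) :
    N.fold = ∅ ↔ M.fold = ∅ := by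
  simp only [Set.eq_empty_iff_forall_notMem]
  constructor
  · intro k x hx; exact k (e x) ((h.mem_fold e.injective x).2 hx)
  · intro k x hx
    obtain ⟨x, rfl⟩ := e.surjective x
    exact k x ((h.mem_fold e.injective x).1 hx)

theorem Hom.fold_pair {M : PMap A} {N : PMap B} {e : A ≃ B} (h : Hom M N e) (p : A) :
    N.fold = {e p, N.r2 (e p)} ↔ M.fold = {p, M.r2 p} := by
  have : (∀ x, e x ∈ N.fold ↔ e x ∈ ({e p, N.r2 (e p)} : Set B)) ↔ M.fold = {p, M.r2 p} := by
    rw [Set.ext_iff]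
    refine forall_congr' fun x => ?_
    rw [h.mem_fold e.injective x, ← h.h2]
    simp
  rw [← this, Set.ext_iff]
  exact ⟨fun k x => k _, fun k x => by simpa using k (e.symm x)⟩

theorem inv_D (i k : ℕ) : Inv (fun {F} (M : PMap F) f => D i k M f) := by
  rintro A B M N e h a ⟨h1, h2, h3, h4, h5⟩
  exact ⟨h.disk_iff.2 h1, h.fold_empty.2 h2, by rw [← h.h1, h3], by rw [h.be_eq e.injective, h4],
    by rw [h.inn_eq e.injective, h5]⟩

theorem inv_G (i k : ℕ) : Inv (fun {F} (M : PMap F) f => G i k M f) := by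
  rintro A B M N e h a ⟨h1, h2, h3, h4, h5⟩
  exact ⟨h.disk_iff.2 h1, (h.fold_pair a).2 h2, by rw [← h.h1, h3],
    by rw [h.be_eq e.injective, h4], by rw [h.inn_eq e.injective, h5]⟩

theorem inv_GS (k : ℕ) : Inv (fun {F} (M : PMap F) f => GS k M f) := by
  rintro A B M N e h a ⟨h1, h2, h5⟩
  exact ⟨h.sph_iff.2 h1, (h.fold_pair a).2 h2, by rw [h.inn_eq e.injective, h5]⟩

end PMap

open PMap

/-! ### The numbers in the statement count maps without folded edge -/

theorem diskCount0_eq {n : ℕ} (hn : n ≠ 0) (k : ℕ) :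
    diskCount0 n k = cnt n fun M f => D 0 k M f := by
  rw [diskCount0, if_neg hn]
  refine numRooted_eq_cnt n _ _ (fun M f => ?_) fun M f h => ⟨h.1.1, h.2.1⟩
  simp only [D, Disk, M.toPMap_conn, M.toPMap_fold, M.toPMap_be, M.toPMap_inn, M.toPMap_chi,
    M.toPMap_ori, FlagMap.OnDisk, true_and]
  constructor
  · rintro ⟨⟨-, h2⟩, h⟩; exact ⟨h2, h⟩
  · rintro ⟨h2, h⟩; exact ⟨⟨fun k => (k f).2.1 h.1, h2⟩, h⟩

/-- The root flag of a boundary edge is one end of the path of flags at the root vertex; it is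
replaced by the other end, which is next to the boundary. -/
theorem diskCount1_eq (n k : ℕ) : diskCount1 n k = cnt n fun M f => D 1 k M f := by
  have : diskCount1 n k = cnt n fun M f => M.Disk ∧ M.fold = ∅ ∧ M.r2 f = f ∧ M.be f = 1 ∧
      M.inn f = 2 * k := by
    refine numRooted_eq_cnt n _ _ (fun M f => ?_) fun M f h => ⟨h.1.1, h.2.1⟩
    simp only [Disk, M.toPMap_conn, M.toPMap_fold, M.toPMap_be, M.toPMap_inn, M.toPMap_chi,
      M.toPMap_ori, FlagMap.OnDisk, true_and]
    constructor
    · rintro ⟨⟨-, h2⟩, h⟩; exact ⟨h2, h⟩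
    · rintro ⟨h2, h⟩; exact ⟨⟨fun k => (k f).2.2 h.1, h2⟩, h⟩
  rw [this]
  have uniq : ∀ (M : PMap (Fin (2 * n))) f g g', M.be f = 1 → M.vs f g → M.vs f g' → M.r2 g = g →
      M.r2 g' = g' → g = g' := by
    intro M f g g' h k1 k2 k3 k4
    obtain ⟨z, hz⟩ := Set.ncard_eq_one.1 h
    have e1 : g ∈ {g | M.vs f g ∧ M.r2 g = g} := ⟨k1, k3⟩
    have e2 : g' ∈ {g | M.vs f g ∧ M.r2 g = g} := ⟨k2, k4⟩
    rw [hz] at e1 e2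
    exact e1.trans e2.symm
  refine cnt_reroot (fun M f g => M.vs f g) (fun M N f g e h => (h.vs_iff' e.injective f g).2)
    ?_ ?_ ?_ ?_ ?_ ?_
  · rintro M f ⟨h1, h2, h3, h4, h5⟩
    rcases path_ends M.i2 M.i1 h3 with ⟨z, hz, -, H⟩ | ⟨z, hz, hn, -, H, -⟩
    all_goals
      rw [sup_comm] at hz
      change M.vs f z at hz
    · refine ⟨z, ⟨h1, h2, ?_, ?_, ?_⟩, hz⟩
      · exact (H z (by rw [sup_comm]; exact hz)).2.2 rfl
      · rw [← be_congr hz, h4]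
      · rw [← inn_congr hz, h5]
    · exact absurd (uniq M f z f h4 hz (Setoid.refl' _ _)
        ((H z (by rw [sup_comm]; exact hz)).1.2 (Or.inr rfl)) h3) hn
  · rintro M g ⟨h1, h2, h3, h4, h5⟩
    have : {x | M.vs g x ∧ M.r2 x = x}.Nonempty := by
      rw [← Set.ncard_pos, ← be, h4]; exact one_pos
    obtain ⟨x, hx, hx'⟩ := this
    exact ⟨x, ⟨h1, h2, hx', by rw [← be_congr hx, h4], by rw [← inn_congr hx, h5]⟩,
      Setoid.symm' _ hx⟩
  · rintro M f g g' - k1 k2 ⟨h1, h2, h3, h4, h5⟩ hg'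
    rcases (vertex_path h3).2 with ⟨-, H⟩ | ⟨h, -⟩
    · exact ((H g' (Setoid.trans' _ (Setoid.symm' _ k1) k2)).1 hg'.2.2.1).symm
    · omega
  · rintro M f f' g hg k1 k2 h1 h2
    exact uniq M g f f' hg.2.2.2.1 (Setoid.symm' _ k1) (Setoid.symm' _ k2) h1.2.2.1 h2.2.2.1
  · rintro M N f e h ⟨h1, h2, h3, h4, h5⟩
    exact ⟨h.disk_iff.2 h1, h.fold_empty.2 h2, by rw [← h.h2, h3],
      by rw [h.be_eq e.injective, h4], by rw [h.inn_eq e.injective, h5]⟩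
  · intro M N f e h; exact inv_D 1 k h f

theorem diskCount_eq (i : Fin 2) {n : ℕ} (hn : n ≠ 0) (k : ℕ) :
    diskCount i n k = cnt n fun M f => D i k M f := by
  rw [diskCount]
  fin_cases i
  · exact (if_pos rfl).trans (diskCount0_eq hn k)
  · exact (if_neg (by decide)).trans (diskCount1_eq n k)

theorem cnt_zero (P : PMap (Fin (2 * 0)) → Fin (2 * 0) → Prop) : cnt 0 P = 0 :=
  cnt_eq_zero fun _ f => f.elim0

theorem diskCount_zero (i : Fin 2) (k : ℕ) :
    diskCount i 0 k = if i = 0 ∧ k = 0 then 1 else 0 := by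
  rw [diskCount]
  fin_cases i
  · simp [diskCount0]
  · simp only [diskCount1_eq]
    exact cnt_zero _

theorem sphereCount_eq {n : ℕ} (hn : n ≠ 0) (k : ℕ) :
    sphereCount n k = cnt n fun M f => S k M f := by
  rw [sphereCount, if_neg hn]
  refine numRooted_eq_cnt n _ _ (fun M f => ?_) fun M f h => ⟨h.1.1, h.2.1⟩
  simp only [S, Sph, M.toPMap_conn, M.toPMap_fold, M.toPMap_inn, M.toPMap_chi,
    M.toPMap_ori, FlagMap.OnSphere, true_and]
  constructor
  · rintro ⟨⟨-, h2⟩, h⟩; exact ⟨h2, h⟩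
  · rintro ⟨h2, h⟩
    refine ⟨⟨?_, h2⟩, h⟩
    by_contra k
    have := (chi_le M.toPMap M.toPMap_conn f).2 (by
      simp only [FlagMap.Closed] at k
      push Not at k
      obtain ⟨g, hg⟩ := k
      refine ⟨g, ?_⟩
      change M.r0 g = g ∨ M.r1 g = g ∨ M.r2 g = g
      tauto)
    rw [M.toPMap_chi, h2.2] at this
    omega

/-- There are at most `n` darts at a vertex. -/
theorem diskCount_eq_zero (i : Fin 2) {n k : ℕ} (h : n < k) : diskCount i n k = 0 := by
  rcases eq_or_ne n 0 with rfl | hn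
  · rw [diskCount_zero, if_neg (by omega)]
  · rw [diskCount_eq i hn]
    refine cnt_eq_zero fun M f hM => ?_
    have := M.inn_le f
    rw [hM.2.2.2.2, Nat.card_eq_fintype_card, Fintype.card_fin] at this
    omega

/-! ### A folded edge marks a corner -/

namespace PMap

variable {F A B : Type}

/-- The folded edge containing `p` is a whole connected component if `r1` leaves it invariant. -/
theorem eq_or_eq_of_conn {M : PMap F} (hM : M.Conn) {p : F} (h : M.r0 p = M.r2 p)
    (h1 : M.r1 p = p ∨ M.r1 p = M.r2 p) (h2 : M.r1 (M.r2 p) = p ∨ M.r1 (M.r2 p) = M.r2 p) (x : F) :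
    x = p ∨ x = M.r2 p := by
  have h' : M.r0 (M.r2 p) = p := by rw [M.comm, h, M.i2]
  refine (cs_mem (T := {p, M.r2 p}) ?_ ?_ ?_ (hM p x)).1 (Or.inl rfl) <;> rintro x (rfl | rfl)
  · exact Or.inr h
  · exact Or.inl h'
  · exact h1
  · exact h2
  · exact Or.inr rfl
  · exact Or.inl (M.i2 _)

theorem r2_ne_of_fold {M : PMap F} {p : F} (h : M.r0 p = M.r2 p) : M.r2 p ≠ p :=
  fun e => M.nofix p (h.trans e) e

theorem card_le_two {n : ℕ} {p q : Fin (2 * n)} (h : ∀ x, x = p ∨ x = q) : n ≤ 1 := by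
  have : (Set.univ : Set (Fin (2 * n))).ncard ≤ 2 := by
    rw [show (Set.univ : Set (Fin (2 * n))) = {p, q} from (Set.eq_univ_of_forall h).symm]
    exact (Set.ncard_insert_le _ _).trans (by rw [Set.ncard_singleton])
  rw [Set.ncard_univ, Nat.card_eq_fintype_card, Fintype.card_fin] at this
  omega

theorem exists_hom_of_two {M : PMap (Fin (2 * 1))} {N : PMap (Fin (2 * 1))} {p q : Fin (2 * 1)}
    (hM : M.r0 p = M.r2 p) (hN : N.r0 q = N.r2 q)
    (h1 : M.r1 p = p ∧ N.r1 q = q ∨ M.r1 p = M.r2 p ∧ N.r1 q = N.r2 q) :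
    ∃ e : Fin (2 * 1) ≃ Fin (2 * 1), Hom M N e ∧ e p = q := by
  have kM := r2_ne_of_fold hM
  have kN := r2_ne_of_fold hN
  have two : ∀ x y z : Fin (2 * 1), y ≠ x → z = x ∨ z = y := by decide
  let e := Equiv.swap p q
  have e1 : e p = q := Equiv.swap_apply_left p q
  have e2 : e (M.r2 p) = N.r2 q :=
    (two q _ _ kN).resolve_left fun k => kM (e.injective (k.trans e1.symm))
  have hM' : M.r0 (M.r2 p) = p := by rw [M.comm, hM, M.i2]
  have hN' : N.r0 (N.r2 q) = q := by rw [N.comm, hN, N.i2]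
  refine ⟨e, ⟨fun x => ?_, fun x => ?_, fun x => ?_⟩, e1⟩ <;>
    rcases two p (M.r2 p) x kM with rfl | rfl
  · rw [hM, e1, e2, hN]
  · rw [hM', e1, e2, hN']
  · rcases h1 with ⟨a, b⟩ | ⟨a, b⟩
    · rw [a, e1, b]
    · rw [a, e1, e2, b]
  · rcases h1 with ⟨a, b⟩ | ⟨a, b⟩
    · have a' : M.r1 (M.r2 p) = M.r2 p := (two p _ _ kM).resolve_left fun k => kM (by
        rw [← M.i1 (M.r2 p), k, a])
      have b' : N.r1 (N.r2 q) = N.r2 q := (two q _ _ kN).resolve_left fun k => kN (by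
        rw [← N.i1 (N.r2 q), k, b])
      rw [a', e2, b']
    · rw [← a, M.i1, e1, a, e2, ← b, N.i1]
  · rw [e1, e2]
  · rw [M.i2, e1, e2, N.i2]

theorem cnt_eq_one {n : ℕ} {P : PMap (Fin (2 * n)) → Fin (2 * n) → Prop} (h : ∃ M f, P M f)
    (h' : ∀ M f N g, P M f → P N g → ∃ e : Fin (2 * n) ≃ Fin (2 * n), Hom M N e ∧ e f = g) :
    cnt n P = 1 := by
  obtain ⟨M, f, hM⟩ := h
  rw [cnt, Set.ncard_eq_one]
  refine ⟨Quotient.mk _ (M, f), ?_⟩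
  ext q
  constructor
  · rintro ⟨⟨N, g⟩, hN, rfl⟩
    exact Quotient.sound (h' _ _ _ _ hN hM)
  · rintro rfl
    exact ⟨(M, f), hM, rfl⟩

/-- The maps consisting of a single folded edge. -/
def single (r : Bool → Bool) (hr : Involutive r) : PMap Bool where
  r0 := not
  r1 := r
  r2 := not
  i0 := Bool.involutive_not
  i1 := hr
  i2 := Bool.involutive_not
  comm _ := rfl
  nofix f h := by simp at h

theorem numC_eq_one [Nonempty F] {s : Setoid F} (h : ∀ x y, s x y) : numC s = 1 := by
  have : Subsingleton (Quotient s) := ⟨fun p q => by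
    induction p using Quotient.inductionOn with | _ x => ?_
    induction q using Quotient.inductionOn with | _ y => ?_
    exact Quotient.sound (h x y)⟩
  have : Nonempty (Quotient s) := ⟨Quotient.mk s (Classical.arbitrary F)⟩
  exact Nat.card_unique

section Single

variable (r : Bool → Bool) (hr : Involutive r)

theorem step_not (x y : Bool) : step not x y := by
  rw [step_iff Bool.involutive_not]
  revert x y; decide

theorem single_vs (x y : Bool) : (single r hr).vs x y :=
  (le_sup_right : step not ≤ (single r hr).vs) (step_not x y)

theorem single_conn : (single r hr).Conn := fun x y => vs_le_cs _ (single_vs r hr x y)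

theorem single_ori : (single r hr).Ori := by
  refine ⟨id, fun x => ⟨fun h => h, fun h => h, fun h => h⟩⟩

theorem single_chi : (single r hr).chi = 3 - numC (step r) := by
  have hv : numC (single r hr).vs = 1 := numC_eq_one (single_vs r hr)
  have he : numC (single r hr).es = 1 := numC_eq_one fun x y =>
    (le_sup_left : step not ≤ (single r hr).es) (step_not x y)
  have hf : numC (single r hr).fs = 1 := numC_eq_one fun x y =>
    (le_sup_left : step not ≤ (single r hr).fs) (step_not x y)
  have hn : numC (step not) = 1 := numC_eq_one step_not
  change ((numC (single r hr).vs : ℤ) + numC (single r hr).es + numC (single r hr).fs) -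
    ((numC (step not) : ℤ) + numC (step r) + numC (step not)) + Nat.card Bool = _
  rw [hv, he, hf, hn]
  simp
  ring

theorem single_fold : (single r hr).fold = {true, (single r hr).r2 true} := by
  ext x
  refine iff_of_true rfl ?_
  cases x
  · exact Or.inr rfl
  · exact Or.inl rfl

theorem single_be : (single r hr).be true = 0 := by
  have : {g | (single r hr).vs true g ∧ (single r hr).r2 g = g} = ∅ := by
    ext x; simp [single]
  rw [be, this, Set.ncard_empty]

theorem single_inn : (single r hr).inn true = 2 := by
  have : {g | (single r hr).vs true g ∧ (single r hr).r2 g ≠ g} = Set.univ := by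
    ext x; exact iff_of_true ⟨single_vs r hr _ _, by simp [single]⟩ trivial
  rw [inn, this, Set.ncard_univ]; simp

end Single

theorem id_involutive : Involutive (id : Bool → Bool) := fun _ => rfl

theorem single_G : G 0 0 (single id id_involutive) true := by
  refine ⟨⟨single_conn _ _, single_ori _ _, ?_⟩, single_fold _ _, rfl, single_be _ _, single_inn _ _⟩
  have := two_mul_numC_step (F := Bool) (σ := id) id_involutive
  have h1 : {x : Bool | id x = x} = Set.univ := by ext x; simp
  rw [h1, Set.ncard_univ] at this
  simp at this
  rw [single_chi]; omega

theorem single_GS : GS 0 (single not Bool.involutive_not) true := by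
  refine ⟨⟨single_conn _ _, single_ori _ _, ?_⟩, single_fold _ _, single_inn _ _⟩
  rw [single_chi, numC_eq_one step_not]; norm_num

/-- In a map with two flags that form a folded edge, this edge is the only dart at its vertex. -/
theorem two_inv {M : PMap (Fin (2 * 1))} {p : Fin (2 * 1)} (h : M.fold = {p, M.r2 p}) :
    M.r0 p = M.r2 p ∧ M.inn p = 2 := by
  have h0 : M.r0 p = M.r2 p := by
    have : p ∈ M.fold := by rw [h]; exact Or.inl rfl
    exact this
  have k := r2_ne_of_fold h0
  refine ⟨h0, ?_⟩
  have two : ∀ x y z : Fin (2 * 1), y ≠ x → z = x ∨ z = y := by decide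
  have : {g | M.vs p g ∧ M.r2 g ≠ g} = Set.univ := by
    ext x
    refine iff_of_true ?_ trivial
    rcases two p _ x k with rfl | rfl
    · exact ⟨Setoid.refl' _ _, k⟩
    · exact ⟨M.vs_r2 p, by rw [M.i2]; exact k.symm⟩
  rw [inn, this, Set.ncard_univ]; simp

theorem exists_two {P : ∀ {F : Type}, PMap F → F → Prop} (hP : Inv P) {M : PMap Bool} {f : Bool}
    (h : P M f) : ∃ (N : PMap (Fin (2 * 1))) (g : Fin (2 * 1)), P N g := by
  have E : Bool ≃ Fin (2 * 1) := (Finite.card_eq.1 (by simp)).some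
  exact ⟨M.map E, E f, hP (hom_map M E) f h⟩

theorem mem_fold_left {M : PMap F} {p : F} (h : M.fold = {p, M.r2 p}) : M.r0 p = M.r2 p := by
  have : p ∈ M.fold := by rw [h]; exact Or.inl rfl
  exact this

/-- Deleting the folded edge at the root, which leaves a single vertex if `n = 0`. -/
theorem cnt_G (i : Fin 2) (n k : ℕ) : cnt (n + 1) (fun M f => G i k M f) = diskCount i n k := by
  rcases eq_or_ne n 0 with rfl | hn
  · rw [diskCount_zero]
    split_ifs with h
    · obtain ⟨rfl, rfl⟩ := h
      exact cnt_eq_one (exists_two (inv_G 0 0) single_G) fun M f N g hM hN =>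
        exists_hom_of_two (mem_fold_left hM.2.1) (mem_fold_left hN.2.1)
          (Or.inl ⟨hM.2.2.1, hN.2.2.1⟩)
    · refine cnt_eq_zero fun M f hM => h ?_
      obtain ⟨-, h2, h3, h4, h5⟩ := hM
      obtain ⟨h6, h7⟩ := two_inv h2
      have hk : k = 0 := by omega
      refine ⟨?_, hk⟩
      have hs := M.be_add_inn f
      have : {g | M.vs f g}.ncard ≤ 2 := by
        refine (Set.ncard_le_ncard (Set.subset_univ _)).trans ?_
        rw [Set.ncard_univ]; simp
      apply Fin.ext
      change (i : ℕ) = 0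
      omega
  · rw [diskCount_eq i hn]
    symm
    have := cnt_ins (n := n) (P := fun {F} (M : PMap F) f => D i k M f)
      (Q := fun {F} (M : PMap F) p => M.Disk ∧ M.fold = {p, M.r2 p} ∧
        M.r1 (M.r2 p) = M.r2 p ∧ M.be p = i ∧ M.inn p = 2 * (k + 1)) ?_ ?_
    · rw [this]
      refine cnt_reroot (fun M f g => M.r2 f = g) (fun M N f g e h => ?_) ?_ ?_ ?_ ?_ ?_ ?_
      · rintro rfl; exact (h.h2 f).symm
      · rintro M f ⟨⟨h1, h2, h3, h4, h5⟩, -⟩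
        refine ⟨_, ⟨h1, ?_, h3, ?_, ?_⟩, rfl⟩
        · rw [M.i2, h2, Set.pair_comm]
        · rw [← be_congr (M.vs_r2 f), h4]
        · rw [← inn_congr (M.vs_r2 f), h5]
      · rintro M g ⟨h1, h2, h3, h4, h5⟩
        have h0 := mem_fold_left h2
        have h6 : ∀ x, M.r1 (M.r2 g) = x → x = g ∨ x = M.r2 g → False := by
          rintro x rfl hx
          have := card_le_two (eq_or_eq_of_conn h1.1 h0 (Or.inl h3) hx)
          omega
        refine ⟨M.r2 g, ⟨⟨h1, ?_, ?_, ?_, ?_⟩, ?_, ?_, ?_⟩, M.i2 g⟩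
        · rw [M.i2, h2, Set.pair_comm]
        · rw [M.i2, h3]
        · rw [← be_congr (M.vs_r2 g), h4]
        · rw [← inn_congr (M.vs_r2 g), h5]
        · rw [M.comm, h0]
        · exact fun k => h6 _ k (Or.inr rfl)
        · rw [M.i2]; exact fun k => h6 _ k (Or.inl rfl)
      · rintro M f g g' - rfl rfl - -; rfl
      · rintro M f f' g - h h' - -; exact M.i2.injective (h.trans h'.symm)
      · rintro M N f e h ⟨⟨h1, h2, h3, h4, h5⟩, h6, h7, h8⟩
        refine ⟨⟨h.disk_iff.2 h1, (h.fold_pair f).2 h2, ?_, ?_, ?_⟩, ?_, ?_, ?_⟩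
        · rw [← h.h2, ← h.h1, h3]
        · rw [h.be_eq e.injective, h4]
        · rw [h.inn_eq e.injective, h5]
        · rw [← h.h0, ← h.h2, h6]
        · rw [← h.h1]; exact e.injective.ne h7
        · rw [← h.h1, ← h.h2]; exact e.injective.ne h8
      · intro M N f e h; exact inv_G i k h f
    · rintro A B M N e h a ⟨h1, h2, h3, h4, h5⟩
      refine ⟨h.disk_iff.2 h1, (h.fold_pair a).2 h2, ?_, ?_, ?_⟩
      · rw [← h.h2, ← h.h1, h3]
      · rw [h.be_eq e.injective, h4]
      · rw [h.inn_eq e.injective, h5]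
    · intro F _ M u
      have key : (M.ins u).r1 ((M.ins u).r2 (.inr true)) = (M.ins u).r2 (.inr true) ↔ M.r1 u = u := by
        change (M.ins u).r1 (.inr false) = .inr false ↔ _
        constructor
        · intro k
          by_contra h
          rw [ins_r1_of_ne _ _ h] at k; cases k
        · exact ins_r1_of_fixed M u
      rw [D, ins_disk, ins_fold, key, ins_be, ins_inn, mul_add, Nat.add_right_cancel_iff]

/-- On a sphere, the folded edge marks one of the corners of the map; the map without edges has a
single corner. -/
theorem cnt_GS (n k : ℕ) : cnt (n + 1) (fun M f => GS k M f) = sphereCount n k := by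
  have ne : ∀ {F : Type} [Finite F] {M : PMap F}, M.Sph → ∀ f, M.r1 f ≠ f := by
    intro F _ M h f k
    have := (chi_le M h.1 f).2 ⟨f, Or.inr (Or.inl k)⟩
    rw [h.2.2] at this; omega
  rcases eq_or_ne n 0 with rfl | hn
  · rw [sphereCount, if_pos rfl]
    split_ifs with h
    · subst h
      have two : ∀ x y z : Fin (2 * 1), y ≠ x → z ≠ x → z = y := by decide
      exact cnt_eq_one (exists_two (inv_GS 0) single_GS) fun M f N g hM hN => by
        have h1 := mem_fold_left hM.2.1
        have h2 := mem_fold_left hN.2.1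
        exact exists_hom_of_two h1 h2 (Or.inr
          ⟨two f _ _ (r2_ne_of_fold h1) (ne hM.1 f), two g _ _ (r2_ne_of_fold h2) (ne hN.1 g)⟩)
    · refine cnt_eq_zero fun M f hM => h ?_
      have := (two_inv hM.2.1).2
      have := hM.2.2
      omega
  · rw [sphereCount_eq hn]
    symm
    rw [cnt_ins (n := n) (P := fun {F} (M : PMap F) f => S k M f) (inv_GS k)]
    · refine cnt_congr fun M f => ⟨fun h => h.1, fun h => ?_⟩
      have h0 := mem_fold_left h.2.1
      refine ⟨h, h0, ne h.1 f, fun e => ?_⟩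
      have := card_le_two (eq_or_eq_of_conn h.1.1 h0 (Or.inr e) (Or.inl (by rw [← e, M.i1])))
      omega
    · intro F _ M u
      rw [S, GS, ins_sph, ins_fold, ins_inn, mul_add, Nat.add_right_cancel_iff]

/-- Disks whose only folded edge contains the root flag, which is next to the boundary; there are
`i` boundary darts at the root vertex. -/
def GB (i : ℕ) (M : PMap F) (p : F) : Prop :=
  M.Disk ∧ M.fold = {p, M.r2 p} ∧ M.r1 p = p ∧ M.be p = i

theorem cnt_GB (i : Fin 2) (n : ℕ) : cnt (n + 1) (fun M f => GB i M f) =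
    ∑ l ∈ Finset.range (n + 1), diskCount i n l := by
  rw [cnt_sum (Finset.range (n + 1)) _ (fun M f => M.inn f / 2 - 1)]
  · refine Finset.sum_congr rfl fun l _ => ?_
    rw [← cnt_G]
    refine cnt_congr fun M f => ?_
    constructor
    · rintro ⟨⟨h1, h2, h3, h4⟩, h5⟩
      have hp : 0 < M.inn f := by
        rw [inn, Set.ncard_pos]
        exact ⟨f, Setoid.refl' _ _, r2_ne_of_fold (mem_fold_left h2)⟩
      have := (vertex_path h3).1
      rw [Nat.even_iff] at this
      exact ⟨h1, h2, h3, h4, by omega⟩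
    · rintro ⟨h1, h2, h3, h4, h5⟩
      exact ⟨⟨h1, h2, h3, h4⟩, by omega⟩
  · rintro M f ⟨h1, h2, h3, h4⟩
    have := M.inn_le f
    rw [Nat.card_eq_fintype_card, Fintype.card_fin] at this
    rw [Finset.mem_range]; omega
  · intro M N f e h _
    rw [h.inn_eq e.injective]

end PMap

/-! ### Arcs of a path -/

section Arc

variable {F A B : Type}

/-- The orbits of two involutions after disconnecting `u` and `σ u`. -/
noncomputable def arc (σ τ : F → F) (u : F) : Setoid F := step (off σ {u, σ u}) ⊔ step τ

variable {σ τ : F → F}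

theorem off_pair_invol (hσ : Involutive σ) (u : F) : Involutive (off σ {u, σ u}) := by
  refine off_invol hσ ?_
  rintro x (rfl | rfl)
  · exact Or.inr rfl
  · exact Or.inl (hσ u)

theorem off_self {S : Set F} {x : F} (h : σ x = x) : off σ S x = x := by
  by_cases hx : x ∈ S
  · exact off_mem hx
  · rw [off_notMem hx, h]

theorem walk_map {σ' τ' : B → B} {σ τ : A → A} {j : A → B} (h1 : ∀ x, j (σ x) = σ' (j x))
    (h2 : ∀ x, j (τ x) = τ' (j x)) (x : A) (t : ℕ) :
    j (walk σ τ x t) = walk σ' τ' (j x) t := by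
  induction t with
  | zero => rfl
  | succ t ih =>
    by_cases h : Even t
    · rw [walk_even _ _ _ h, walk_even _ _ _ h, h2, ih]
    · rw [walk_odd _ _ _ h, walk_odd _ _ _ h, h1, ih]

variable [Finite F]

/-- Disconnecting the `2 j`-th flag of a path from its successor leaves an arc of length `2 j`. -/
theorem arc_of_walk (hσ : Involutive σ) (hτ : Involutive τ) {g u : F} (hg : σ g = g) {j : ℕ}
    (hj : j ≠ 0) (hw : ∀ t < 2 * j - 1, walk σ τ g (t + 1) ≠ walk σ τ g t)
    (hu : u = walk σ τ g (2 * j - 1)) :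
    {x | arc σ τ u u x}.ncard = 2 * j ∧ (σ u = u ∨ ¬ arc σ τ u u (σ u)) ∧ arc σ τ u u g ∧ g ≠ u := by
  have ne := walk_ne hσ hτ hg hw
  have hgu : g ≠ u := by rw [hu]; exact ne 0 _ (by omega) le_rfl
  have hS := off_pair_invol hσ u
  have hg' : off σ {u, σ u} g = g := off_self hg
  have eq : ∀ t, t ≤ 2 * j - 1 → walk (off σ {u, σ u}) τ g t = walk σ τ g t := by
    intro t
    induction t with
    | zero => exact fun _ => rfl
    | succ t ih =>
      intro ht
      by_cases h : Even t
      · rw [walk_even _ _ _ h, walk_even _ _ _ h, ih (by omega)]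
      · rw [walk_odd _ _ _ h, walk_odd _ _ _ h, ih (by omega), off_notMem]
        rintro (k | k)
        · exact ne t _ (by omega) le_rfl (k.trans hu)
        · have : walk σ τ g (t + 1) = walk σ τ g (2 * j - 1) := by
            rw [walk_odd _ _ _ h, k, hσ, hu]
          rcases ht.eq_or_lt with e | e
          · rw [Nat.not_even_iff] at h; omega
          · exact ne _ _ e le_rfl this
  have odd : ¬ Even (2 * j - 1) := by rw [Nat.not_even_iff]; omega
  have halt : walk (off σ {u, σ u}) τ g (2 * j - 1 + 1) = walk (off σ {u, σ u}) τ g (2 * j - 1) := by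
    rw [walk_odd _ _ _ odd, eq _ le_rfl, ← hu]
    exact off_mem (Or.inl rfl)
  have hug : arc σ τ u g u := (rel_iff_walk hS hτ hg' halt u).2 ⟨_, le_rfl, by rw [eq _ le_rfl, hu]⟩
  have hc : {x | arc σ τ u g x}.ncard = 2 * j := by
    have := walk_ncard hS hτ hg' halt fun t ht => by
      rw [eq _ (by omega), eq _ (by omega)]; exact hw t ht
    rw [show 2 * j = 2 * j - 1 + 1 by omega]
    exact this
  have hset : {x | arc σ τ u u x} = {x | arc σ τ u g x} := by
    ext x
    exact ⟨fun k => Setoid.trans' _ hug k, fun k => Setoid.trans' _ (Setoid.symm' _ hug) k⟩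
  refine ⟨hset ▸ hc, ?_, Setoid.symm' _ hug, hgu⟩
  by_contra! k
  rcases path_ends hS hτ hg' with ⟨z, -, ho, -⟩ | ⟨z, -, -, -, H, -⟩
  · change Odd {x | arc σ τ u g x}.ncard at ho
    rw [hc, Nat.odd_iff] at ho
    omega
  · have h1 := (H u hug).1.1 (off_mem (Or.inl rfl))
    have h2 := (H (σ u) (Setoid.trans' _ hug k.2)).1.1 (off_mem (Or.inr rfl))
    rcases h1 with h1 | rfl
    · exact hgu h1.symm
    · rcases h2 with h2 | h2
      · apply hgu; rw [← h2, hσ] at hg; rw [← h2, ← hg]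
      · exact k.1 h2

/-- The converse of `arc_of_walk`. -/
theorem walk_of_arc (hσ : Involutive σ) (hτ : Involutive τ) {u : F} {j : ℕ}
    (h1 : {x | arc σ τ u u x}.ncard = 2 * j) (h2 : σ u = u ∨ ¬ arc σ τ u u (σ u)) :
    ∃ g, σ g = g ∧ (∀ t < 2 * j - 1, walk σ τ g (t + 1) ≠ walk σ τ g t) ∧
      u = walk σ τ g (2 * j - 1) := by
  have hS := off_pair_invol hσ u
  have hu : off σ {u, σ u} u = u := off_mem (Or.inl rfl)
  rcases path_ends hS hτ hu with ⟨z, -, ho, -⟩ | ⟨z, hz, hn, -, H, -⟩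
  · change Odd {x | arc σ τ u u x}.ncard at ho
    rw [h1, Nat.odd_iff] at ho
    omega
  have notMem : ∀ x, arc σ τ u u x → x ≠ u → x ∉ ({u, σ u} : Set F) := by
    rintro x hx hxu (rfl | rfl)
    · exact hxu rfl
    · exact h2.elim hxu fun h => h hx
  have hz' := (H z hz).1.2 (Or.inr rfl)
  have hset : {x | arc σ τ u z x} = {x | arc σ τ u u x} := by
    ext x
    exact ⟨fun k => Setoid.trans' _ hz k, fun k => Setoid.trans' _ (Setoid.symm' _ hz) k⟩
  obtain ⟨m, hm, hm'⟩ := exists_walk_stop (τ := τ) hS hτ hz'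
  have hc : {x | arc σ τ u z x}.ncard = m + 1 := walk_ncard hS hτ hz' hm hm'
  rw [hset, h1] at hc
  obtain rfl : m = 2 * j - 1 := by omega
  have ne := walk_ne hS hτ hz' hm'
  have mem : ∀ t ≤ 2 * j - 1, arc σ τ u u (walk (off σ {u, σ u}) τ z t) := fun t ht =>
    Setoid.trans' _ hz ((rel_iff_walk hS hτ hz' hm _).2 ⟨t, ht, rfl⟩)
  have last : walk (off σ {u, σ u}) τ z (2 * j - 1) = u := by
    have odd : ¬ Even (2 * j - 1) := by rw [Nat.not_even_iff]; omega
    rw [walk_odd _ _ _ odd] at hm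
    exact ((H _ (mem _ le_rfl)).1.1 hm).resolve_right fun k => ne 0 _ (by omega) le_rfl k.symm
  have eq : ∀ t, t ≤ 2 * j - 1 → walk (off σ {u, σ u}) τ z t = walk σ τ z t := by
    intro t
    induction t with
    | zero => exact fun _ => rfl
    | succ t ih =>
      intro ht
      by_cases h : Even t
      · rw [walk_even _ _ _ h, walk_even _ _ _ h, ih (by omega)]
      · rw [walk_odd _ _ _ h, walk_odd _ _ _ h, ← ih (by omega), off_notMem]
        refine notMem _ (mem t (by omega)) fun k => ?_
        exact ne t _ (by omega) le_rfl (k.trans last.symm)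
  refine ⟨z, ?_, fun t ht => ?_, ?_⟩
  · rwa [off_notMem (notMem z hz hn)] at hz'
  · rw [← eq _ (by omega), ← eq _ (by omega)]; exact hm' t ht
  · rw [← eq _ le_rfl, last]

end Arc

namespace PMap

variable {F A B : Type}

/-- There are at least `j` inner darts at a vertex on the boundary iff the walk around this vertex does
not end before it has met `2 j` flags. -/
theorem two_mul_le_inn_iff [Finite F] {M : PMap F} {g : F} (hg : M.r1 g = g) (j : ℕ) :
    2 * j ≤ M.inn g ↔ ∀ t < 2 * j - 1, walk M.r1 M.r2 g (t + 1) ≠ walk M.r1 M.r2 g t := by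
  obtain ⟨m, hm, hm'⟩ := exists_walk_stop (τ := M.r2) M.i1 M.i2 hg
  have hc : {x | M.vs g x}.ncard = m + 1 := walk_ncard M.i1 M.i2 hg hm hm'
  rw [← be_add_inn] at hc
  have h1 := be_le_one hg
  have h2 := (vertex_path hg).1
  rw [Nat.even_iff] at h2
  constructor
  · exact fun h t ht => hm' t (by omega)
  · intro h
    have : 2 * j - 1 ≤ m := by
      by_contra! k
      exact h m k hm
    omega

/-- The part of the path of flags around the vertex of `c` that starts with `c` and ends before
`r2 c` or at the boundary. -/
noncomputable def ms (M : PMap F) (c : F) : Setoid F := step M.r1 ⊔ step (off M.r2 {c, M.r2 c})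

/-- Disks whose only folded edge contains the root flag `c`, such that there are `k - 1` inner darts
between `c` and the boundary, and `i` boundary darts at the root vertex. The `2 (k - 1)` flags of the
inner darts are counted together with `c` itself. -/
def Pos (i k : ℕ) (M : PMap F) (c : F) : Prop :=
  M.Disk ∧ M.fold = {c, M.r2 c} ∧ M.be c = i ∧ {x | M.ms c c x}.ncard + 1 = 2 * k

/-- Disks without folded edge, in which the root flag is the second flag of the `j`-th dart from one
side at a vertex on the boundary. -/
def U (i j : ℕ) (M : PMap F) (u : F) : Prop :=
  M.Disk ∧ M.fold = ∅ ∧ M.be u = i ∧ {x | arc M.r1 M.r2 u u x}.ncard = 2 * j ∧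
    (M.r1 u = u ∨ ¬ arc M.r1 M.r2 u u (M.r1 u))

/-- An odd number of flags between the root edge and another end of their path: this end is on
the boundary, next to an inner dart. -/
theorem odd_piece [Finite F] {M : PMap F} {S : Set F} {c : F}
    (hS : ∀ x ∈ S, M.r2 x ∈ S ∧ M.r2 x ≠ x) (hc : c ∈ S)
    (ho : Odd {x | (step M.r1 ⊔ step (off M.r2 S)) c x}.ncard) :
    ∃ z, (step M.r1 ⊔ step (off M.r2 S)) c z ∧ M.r1 z = z ∧
      ∀ y, (step M.r1 ⊔ step (off M.r2 S)) c y → M.r2 y ≠ y ∧ (y ∈ S → y = c) := by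
  have i := off_invol M.i2 fun x hx => (hS x hx).1
  rcases path_ends i M.i1 (off_mem hc) with ⟨z, hz, -, H⟩ | ⟨z, -, -, he, -⟩
  · rw [sup_comm] at hz H
    refine ⟨z, hz, (H z hz).2.2 rfl, fun y hy => ⟨fun k => ?_, fun k => ((H y hy).1).1 (off_mem k)⟩⟩
    have := ((H y hy).1).1 (off_self k)
    subst this
    exact (hS y hc).2 k
  · rw [sup_comm] at he
    exact absurd ho (Nat.not_odd_iff_even.2 he)

/-- If both ends of the path of `c` belong to the root edge, no flag between them is next to
the boundary. -/
theorem even_piece [Finite F] {M : PMap F} {S : Set F} {c d : F}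
    (hS : ∀ x ∈ S, M.r2 x ∈ S ∧ M.r2 x ≠ x) (hc : c ∈ S) (hd : d ∈ S) (hcd : d ≠ c)
    (h : (step M.r1 ⊔ step (off M.r2 S)) c d) :
    Even {x | (step M.r1 ⊔ step (off M.r2 S)) c x}.ncard ∧
      ∀ y, (step M.r1 ⊔ step (off M.r2 S)) c y → M.r1 y ≠ y ∧ M.r2 y ≠ y ∧
        (y ∈ S → y = c ∨ y = d) := by
  have i := off_invol M.i2 fun x hx => (hS x hx).1
  rcases path_ends i M.i1 (off_mem hc) with ⟨z, -, -, H⟩ | ⟨z, -, -, he, H, -⟩ <;>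
    rw [sup_comm] at H
  · exact absurd (((H d h).1).1 (off_mem hd)) hcd
  · rw [sup_comm] at he
    have hz : d = z := ((H d h).1.1 (off_mem hd)).resolve_left hcd
    subst hz
    refine ⟨he, fun y hy => ⟨(H y hy).2, fun k => ?_, fun k => (H y hy).1.1 (off_mem k)⟩⟩
    rcases (H y hy).1.1 (off_self k) with rfl | rfl
    · exact (hS _ hc).2 k
    · exact (hS _ hd).2 k

theorem pair_r2 {M : PMap F} {c : F} (h : M.r2 c ≠ c) :
    ∀ x ∈ ({c, M.r2 c} : Set F), M.r2 x ∈ ({c, M.r2 c} : Set F) ∧ M.r2 x ≠ x := by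
  rintro x (rfl | rfl)
  · exact ⟨Or.inr rfl, h⟩
  · rw [M.i2]; exact ⟨Or.inl rfl, h.symm⟩

/-- The flag `u` next to the marked corner starts an arc that ends at the boundary. -/
theorem ins_pos [Finite F] (i j : ℕ) (M : PMap F) (u : F) :
    Pos i (j + 1) (M.ins u) (.inr true) ↔ U i j M u := by
  set N := M.ins u with hN
  have hr2 : N.r2 (.inr true) ≠ .inr true := by simp [hN, ins]
  have incl : ∀ x y, arc M.r1 M.r2 u x y → N.ms (.inr true) (.inl x) (.inl y) := by
    have : arc M.r1 M.r2 u ≤ Setoid.comap Sum.inl (N.ms (.inr true)) := by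
      refine sup_le (step_le.2 fun x => ?_) (step_le.2 fun x => ?_)
      · by_cases hx : x ∈ ({u, M.r1 u} : Set F)
        · rw [off_mem hx]
        · rw [off_notMem hx]
          have := rel_left N.r1 (off N.r2 {.inr true, N.r2 (.inr true)}) (.inl x)
          rw [hN, ins_r1_inl _ _ (fun k => hx (Or.inl k)) (fun k => hx (Or.inr k))] at this
          exact this
      · have := rel_right N.r1 (off N.r2 {.inr true, N.r2 (.inr true)}) (.inl x)
        rw [off_notMem (by simp [hN, ins])] at this
        exact this
    exact fun x y k => this k
  have root : N.ms (.inr true) (.inr true) (.inl u) := by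
    have := rel_left N.r1 (off N.r2 {.inr true, N.r2 (.inr true)}) (.inr true)
    rw [hN, ins_r1_root] at this
    exact this
  rw [Pos, U, hN, ins_disk, ins_fold, ins_be, ← hN]
  refine and_congr_right fun _ => and_congr_right fun _ => and_congr_right fun _ => ?_
  by_cases h : M.r1 u = u ∨ ¬ arc M.r1 M.r2 u u (M.r1 u)
  · rw [and_iff_left h]
    have hset : {x | N.ms (.inr true) (.inr true) x} =
        insert (.inr true) (Sum.inl '' {x | arc M.r1 M.r2 u u x}) := by
      ext y
      constructor
      · intro hy
        let T : Set (F ⊕ Bool) := insert (.inr true) (Sum.inl '' {x | arc M.r1 M.r2 u u x})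
        have T1 : ∀ x, N.r1 x ∈ T ↔ x ∈ T := by
          have : ∀ x ∈ T, N.r1 x ∈ T := by
            rintro _ (rfl | ⟨x, hx, rfl⟩)
            · rw [hN, ins_r1_root]; exact Or.inr ⟨u, (arc M.r1 M.r2 u).refl' u, rfl⟩
            · by_cases k1 : x = u
              · subst k1; rw [hN, ins_r1_u]; exact Or.inl rfl
              · have k2 : x ≠ M.r1 u := by
                  rintro rfl
                  exact h.elim k1 fun k => k hx
                rw [hN, ins_r1_inl _ _ k1 k2]
                have := rel_left (off M.r1 {u, M.r1 u}) M.r2 x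
                rw [off_notMem (by simp [k1, k2])] at this
                exact Or.inr ⟨_, (arc M.r1 M.r2 u).trans' hx this, rfl⟩
          exact fun x => ⟨fun k => by simpa [N.i1 x] using this _ k, this x⟩
        have T2 : ∀ x, off N.r2 {.inr true, N.r2 (.inr true)} x ∈ T ↔ x ∈ T := by
          have i : Involutive (off N.r2 {.inr true, N.r2 (.inr true)}) := off_pair_invol N.i2 _
          have : ∀ x ∈ T, off N.r2 {.inr true, N.r2 (.inr true)} x ∈ T := by
            rintro _ (rfl | ⟨x, hx, rfl⟩)
            · rw [off_mem (Set.mem_insert _ _)]; exact Or.inl rfl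
            · rw [off_notMem (by simp [hN, ins])]
              exact Or.inr ⟨M.r2 x, (arc M.r1 M.r2 u).trans' hx (rel_right _ _ x), rfl⟩
          exact fun x => ⟨fun k => by simpa [i x] using this _ k, this x⟩
        exact (rel_mem rfl T1 T2 hy).1 (Or.inl rfl)
      · rintro (rfl | ⟨x, hx, rfl⟩)
        · exact (N.ms (.inr true)).refl' _
        · exact (N.ms (.inr true)).trans' root (incl _ _ hx)
    rw [hset, Set.ncard_insert_of_notMem (by simp), Set.ncard_image_of_injective _ Sum.inl_injective]
    omega
  · refine iff_of_false (fun k => ?_) fun k => h k.2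
    push Not at h
    have : N.ms (.inr true) (.inr true) (N.r2 (.inr true)) := by
      refine Setoid.trans' _ root (Setoid.trans' _ (incl _ _ h.2) ?_)
      have := rel_left N.r1 (off N.r2 {.inr true, N.r2 (.inr true)}) (.inl (M.r1 u))
      rw [hN, ins_r1_neighbour _ _ h.1] at this
      exact this
    have := (even_piece (pair_r2 hr2) (Or.inl rfl) (Or.inr rfl) hr2 this).1
    change Even {x | N.ms (.inr true) (.inr true) x}.ncard at this
    rw [Nat.even_iff] at this
    omega

theorem inv_Pos (i k : ℕ) : Inv (fun {F} (M : PMap F) f => Pos i k M f) := by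
  rintro A B M N e h a ⟨h1, h2, h3, h4⟩
  refine ⟨h.disk_iff.2 h1, (h.fold_pair a).2 h2, by rw [h.be_eq e.injective, h3], ?_⟩
  have : {x | N.ms (e a) (e a) x} = e '' {x | M.ms a a x} := by
    ext y
    have := rel_map_iff (σ := M.r1) (τ := off M.r2 {a, M.r2 a}) (j := e) N.i1
      (off_pair_invol N.i2 (e a)) h.h1 (off_map h.h2 fun x => by
        rw [← h.h2]; simp) a y
    refine this.trans ?_
    exact ⟨fun ⟨z, hz, k⟩ => ⟨z, k, hz⟩, fun ⟨z, hz, k⟩ => ⟨z, k, hz⟩⟩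
  rw [this, Set.ncard_image_of_injective _ e.injective, h4]

theorem inv_U (i j : ℕ) : Inv (fun {F} (M : PMap F) f => U i j M f) := by
  rintro A B M N e h a ⟨h1, h2, h3, h4, h5⟩
  have key := rel_map_iff (σ := off M.r1 {a, M.r1 a}) (τ := M.r2) (j := e)
      (off_pair_invol N.i1 (e a)) N.i2 (off_map h.h1 fun x => by rw [← h.h1]; simp) h.h2 a
  refine ⟨h.disk_iff.2 h1, h.fold_empty.2 h2, by rw [h.be_eq e.injective, h3], ?_, ?_⟩
  · have : {x | arc N.r1 N.r2 (e a) (e a) x} = e '' {x | arc M.r1 M.r2 a a x} := by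
      ext y
      refine (key y).trans ?_
      exact ⟨fun ⟨z, hz, k⟩ => ⟨z, k, hz⟩, fun ⟨z, hz, k⟩ => ⟨z, k, hz⟩⟩
    rw [this, Set.ncard_image_of_injective _ e.injective, h4]
  · rw [← h.h1, e.injective.eq_iff]
    refine h5.imp_right fun k k' => k ?_
    obtain ⟨z, hz, k'⟩ := (key _).1 k'
    rwa [← e.injective hz]

theorem arc_le_vs (M : PMap F) (u : F) : arc M.r1 M.r2 u ≤ M.vs :=
  sup_le_sup_right step_off_le _

/-- Disks without folded edge whose root flag is next to the boundary, with `i` boundary darts and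
at least `j` inner darts at the root vertex. -/
def DB (i j : ℕ) (M : PMap F) (g : F) : Prop :=
  M.Disk ∧ M.fold = ∅ ∧ M.r1 g = g ∧ M.be g = i ∧ 2 * j ≤ M.inn g

theorem inv_DB (i j : ℕ) : Inv (fun {F} (M : PMap F) f => DB i j M f) := by
  rintro A B M N e h a ⟨h1, h2, h3, h4, h5⟩
  exact ⟨h.disk_iff.2 h1, h.fold_empty.2 h2, by rw [← h.h1, h3], by rw [h.be_eq e.injective, h4],
    by rwa [h.inn_eq e.injective]⟩

/-- The flag at the `j`-th dart and the end of the path from which the darts are counted determine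
each other. -/
theorem cnt_U {n j : ℕ} (i : ℕ) (hj : j ≠ 0) :
    cnt n (fun M f => U i j M f) = cnt n fun M f => DB i j M f := by
  have key : ∀ {M : PMap (Fin (2 * n))} {u g}, DB i j M g → u = walk M.r1 M.r2 g (2 * j - 1) →
      _ := fun {M u g} h k => arc_of_walk (u := u) M.i1 M.i2 h.2.2.1 hj
        ((two_mul_le_inn_iff h.2.2.1 j).1 h.2.2.2.2) k
  refine cnt_reroot (fun M u g => u = walk M.r1 M.r2 g (2 * j - 1)) (fun M N f g e h => ?_)
    ?_ ?_ ?_ ?_ ?_ ?_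
  · rintro rfl
    exact walk_map h.h1 h.h2 g _
  · rintro M u ⟨h1, h2, h3, h4, h5⟩
    obtain ⟨g, hg, hw, hu⟩ := walk_of_arc M.i1 M.i2 h4 h5
    have hug := arc_le_vs M u (arc_of_walk M.i1 M.i2 hg hj hw hu).2.2.1
    exact ⟨g, ⟨h1, h2, hg, by rw [← be_congr hug, h3], (two_mul_le_inn_iff hg j).2 hw⟩, hu⟩
  · rintro M g hg
    obtain ⟨k1, k2, k3, -⟩ := key hg rfl
    refine ⟨_, ⟨hg.1, hg.2.1, ?_, k1, k2⟩, rfl⟩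
    rw [be_congr (arc_le_vs M _ k3), hg.2.2.2.1]
  · rintro M u g g' hu k k' hg hg'
    obtain ⟨a1, -, a3, a4⟩ := key hg k
    obtain ⟨b1, -, b3, b4⟩ := key hg' k'
    rcases path_ends (off_pair_invol M.i1 u) M.i2 (off_mem (Or.inl rfl)) with
      ⟨z, -, ho, -⟩ | ⟨z, -, -, -, H, -⟩
    · change Odd {x | arc M.r1 M.r2 u u x}.ncard at ho
      rw [a1, Nat.odd_iff] at ho
      omega
    · rw [((H g a3).1.1 (off_self hg.2.2.1)).resolve_left a4,
        ((H g' b3).1.1 (off_self hg'.2.2.1)).resolve_left b4]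
  · rintro M f f' g - k k' - -
    exact k.trans k'.symm
  · intro M N f e h; exact inv_U i j h f
  · intro M N f e h; exact inv_DB i j h f

theorem cnt_DB (i : Fin 2) {n : ℕ} (hn : n ≠ 0) (j : ℕ) :
    cnt n (fun M f => DB i j M f) = ∑ m ∈ Finset.Ico j (n + 1), diskCount i n m := by
  rw [cnt_sum (Finset.Ico j (n + 1)) _ (fun M f => M.inn f / 2)]
  · refine Finset.sum_congr rfl fun m hm => ?_
    rw [diskCount_eq i hn]
    refine cnt_congr fun M f => ?_
    rw [Finset.mem_Ico] at hm
    constructor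
    · rintro ⟨⟨h1, h2, h3, h4, h5⟩, h6⟩
      have := (vertex_path h3).1
      rw [Nat.even_iff] at this
      exact ⟨h1, h2, h3, h4, by omega⟩
    · rintro ⟨h1, h2, h3, h4, h5⟩
      exact ⟨⟨h1, h2, h3, h4, by omega⟩, by omega⟩
  · rintro M f ⟨h1, h2, h3, h4, h5⟩
    have := M.inn_le f
    rw [Nat.card_eq_fintype_card, Fintype.card_fin] at this
    rw [Finset.mem_Ico]; omega
  · intro M N f e h _
    rw [h.inn_eq e.injective]

/-- If no dart precedes the marked corner, the folded edge is next to the boundary. -/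
theorem pos_one_iff [Finite F] (i : ℕ) (M : PMap F) (c : F) : Pos i 1 M c ↔ GB i M c := by
  have : {x | M.ms c c x}.ncard + 1 = 2 * 1 ↔ M.r1 c = c := by
    constructor
    · intro h
      obtain ⟨z, hz⟩ := Set.ncard_eq_one.1 (by omega : {x | M.ms c c x}.ncard = 1)
      have h1 : c ∈ {x | M.ms c c x} := (M.ms c).refl' c
      have h2 : M.r1 c ∈ {x | M.ms c c x} := rel_left _ _ _
      rw [hz] at h1 h2
      exact h2.trans h1.symm
    · intro h
      have : {x | M.ms c c x} = {c} := by
        ext y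
        constructor
        · intro hy
          refine (rel_mem (T := {c}) rfl (fun x => ?_) (fun x => ?_) hy).1 rfl
          · exact ⟨fun k => M.i1.injective (k.trans h.symm), by rintro rfl; exact h⟩
          · have e : off M.r2 {c, M.r2 c} c = c := off_mem (Or.inl rfl)
            exact ⟨fun k => (off_pair_invol M.i2 c).injective (k.trans e.symm),
              by rintro rfl; exact e⟩
        · rintro rfl; exact (M.ms _).refl' _
      rw [this, Set.ncard_singleton]
  rw [Pos, GB, this]
  tauto

/-- Marking the corner after the first `k - 1` inner darts is possible iff there are at least that many. -/
theorem cnt_Pos (i : Fin 2) (n : ℕ) {k : ℕ} (hk : 1 ≤ k) :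
    cnt (n + 1) (fun M f => Pos i k M f) =
      ∑ m ∈ Finset.Ico (k - 1) (n + 1), diskCount i n m := by
  obtain ⟨j, rfl⟩ : ∃ j, k = j + 1 := ⟨k - 1, by omega⟩
  rw [Nat.add_sub_cancel]
  rcases eq_or_ne j 0 with rfl | hj
  · rw [← Finset.range_eq_Ico, ← cnt_GB]
    exact cnt_congr fun M f => pos_one_iff i M f
  have h : cnt (n + 1) (fun M f => Pos i (j + 1) M f) = cnt n fun M f => U i j M f := by
    rw [cnt_ins (n := n) (P := fun {F} (M : PMap F) f => U i j M f) (inv_Pos i (j + 1))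
      fun M u => (ins_pos i j M u).symm]
    refine cnt_congr fun M c => ⟨fun h => ?_, fun h => h.1⟩
    have h0 := mem_fold_left h.2.1
    have h2 := r2_ne_of_fold h0
    refine ⟨h, h0, fun k => ?_, fun k => ?_⟩
    · have := ((pos_one_iff i M c).2 ⟨h.1, h.2.1, k, h.2.2.1⟩).2.2.2
      have := h.2.2.2
      omega
    · have e := (even_piece (pair_r2 h2) (Or.inl rfl) (Or.inr rfl) h2
        (by rw [← k]; exact rel_left _ _ _)).1
      change Even {x | M.ms c c x}.ncard at e
      have := h.2.2.2
      rw [Nat.even_iff] at e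
      omega
  rw [h, cnt_U _ hj]
  rcases eq_or_ne n 0 with rfl | hn
  · rw [cnt_zero, Finset.Ico_eq_empty (by omega), Finset.sum_empty]
  · exact cnt_DB i hn j

end PMap

/-! ### Linking two fixed points of an involution -/

/-- The involution `σ'` agrees with `σ`, except that it swaps the fixed points `b`, `u` of `σ`. -/
structure Link {F : Type} (σ σ' : F → F) (b u : F) : Prop where
  fb : σ b = b
  fu : σ u = u
  bu : σ' b = u
  ub : σ' u = b
  ne : b ≠ u
  eq : ∀ x, x ≠ b → x ≠ u → σ' x = σ x

section Link

variable {F A B : Type} {σ σ' : F → F} {b u : F}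

open Classical in
theorem exists_link (hσ : Involutive σ) (hb : σ b = b) (hu : σ u = u) (h : b ≠ u) :
    ∃ σ', Involutive σ' ∧ Link σ σ' b u := by
  have e : ∀ x, x ≠ b → x ≠ u → σ x ≠ b ∧ σ x ≠ u := fun x h1 h2 =>
    ⟨fun k => h1 (hσ.injective (k.trans hb.symm)), fun k => h2 (hσ.injective (k.trans hu.symm))⟩
  refine ⟨fun x => if x = b then u else if x = u then b else σ x, fun x => ?_,
    hb, hu, by simp, by simp [h.symm], h, fun x h1 h2 => by simp [h1, h2]⟩
  by_cases h1 : x = b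
  · simp [h1, h.symm]
  by_cases h2 : x = u
  · simp [h2, h.symm]
  simp [h1, h2, e x h1 h2, hσ x]

theorem exists_unlink (hσ : Involutive σ') (h : σ' b = u) (hn : u ≠ b) :
    ∃ σ, Involutive σ ∧ Link σ σ' b u := by
  subst h
  refine ⟨off σ' {b, σ' b}, off_pair_invol hσ b, off_mem (Or.inl rfl), off_mem (Or.inr rfl), rfl,
    hσ b, hn.symm, fun x h1 h2 => (off_notMem (by simp [h1, h2])).symm⟩

namespace Link

variable (h : Link σ σ' b u)
include h

theorem step_eq : step σ' = step σ ⊔ pair b u := by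
  apply le_antisymm
  · refine step_le.2 fun x => ?_
    have k : (step σ ⊔ pair b u) b u := (le_sup_right : pair b u ≤ _) (pair_rel b u)
    by_cases h1 : x = b
    · subst h1; rw [h.bu]; exact k
    by_cases h2 : x = u
    · subst h2; rw [h.ub]; exact Setoid.symm' _ k
    rw [h.eq x h1 h2]
    exact (le_sup_left : step σ ≤ _) (step_rel σ x)
  · refine sup_le (step_le.2 fun x => ?_) (pair_le.2 ?_)
    · by_cases h1 : x = b
      · subst h1; rw [h.fb]
      by_cases h2 : x = u
      · subst h2; rw [h.fu]
      rw [← h.eq x h1 h2]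
      exact step_rel σ' x
    · rw [← h.bu]; exact step_rel σ' b

theorem numC_step [Finite F] (hσ : Involutive σ) : numC (step σ') + 1 = numC (step σ) := by
  rw [h.step_eq]
  refine numC_sup_pair ?_
  rw [step_iff hσ, h.fb]
  have := h.ne
  tauto

theorem comm_iff {τ τ' : B → B} {b' u' : B} (k : Link τ τ' b' u') {e : F ≃ B} (hb : e b = b')
    (hu : e u = u') : (∀ x, e (σ x) = τ (e x)) ↔ ∀ x, e (σ' x) = τ' (e x) := by
  refine forall_congr' fun x => ?_
  by_cases h1 : x = b
  · subst h1; rw [h.fb, h.bu, hb, hu, k.fb, k.bu]; simp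
  by_cases h2 : x = u
  · subst h2; rw [h.fu, h.ub, hb, hu, k.fu, k.ub]; simp
  rw [h.eq x h1 h2, k.eq (e x)]
  · rw [← hb]; exact e.injective.ne h1
  · rw [← hu]; exact e.injective.ne h2

theorem col_iff {c : F → Bool} (hc : c u ≠ c b) :
    (∀ x, σ' x ≠ x → c (σ' x) ≠ c x) ↔ ∀ x, σ x ≠ x → c (σ x) ≠ c x := by
  refine forall_congr' fun x => ?_
  by_cases h1 : x = b
  · subst h1; rw [h.fb, h.bu]; tauto
  by_cases h2 : x = u
  · subst h2; rw [h.fu, h.ub]; have := hc.symm; tauto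
  rw [h.eq x h1 h2]

end Link

end Link

namespace PMap

variable {F A B : Type}

theorem isCol_iff (M : PMap F) (c : F → Bool) : M.IsCol c ↔
    (∀ x, M.r0 x ≠ x → c (M.r0 x) ≠ c x) ∧ (∀ x, M.r1 x ≠ x → c (M.r1 x) ≠ c x) ∧
      ∀ x, M.r2 x ≠ x → c (M.r2 x) ≠ c x :=
  ⟨fun h => ⟨fun x => (h x).1, fun x => (h x).2.1, fun x => (h x).2.2⟩,
    fun h x => ⟨h.1 x, h.2.1 x, h.2.2 x⟩⟩

theorem be_eq_of_vs {M N : PMap F} (h : M.vs = N.vs) (h2 : M.r2 = N.r2) (x : F) :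
    M.be x = N.be x := by rw [be, be, h, h2]

theorem inn_eq_of_vs {M N : PMap F} (h : M.vs = N.vs) (h2 : M.r2 = N.r2) (x : F) :
    M.inn x = N.inn x := by rw [inn, inn, h, h2]

/-! ### The root edge is a halfedge -/

section Half

variable {M N : PMap F} {f : F} (hl : Link M.r0 N.r0 f (M.r2 f)) (h2 : M.r2 = N.r2)
include hl h2

theorem half_fold : M.fold = ∅ ↔ N.fold = {f, N.r2 f} := by
  rw [← h2]
  simp only [Set.ext_iff]
  refine forall_congr' fun x => ?_
  change (M.r0 x = M.r2 x ↔ False) ↔ (N.r0 x = N.r2 x ↔ (x = f ∨ x = M.r2 f))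
  rw [← h2]
  by_cases k1 : x = f
  · subst k1; rw [hl.fb, hl.bu]; have := hl.ne; tauto
  by_cases k2 : x = M.r2 f
  · subst k2; rw [hl.fu, hl.ub, M.i2]; have := hl.ne.symm; tauto
  rw [hl.eq x k1 k2]
  tauto

variable (h1 : M.r1 = N.r1)
include h1

theorem half_cs : M.cs = N.cs := by
  have : N.cs = M.cs ⊔ pair f (M.r2 f) := by
    rw [cs, cs, hl.step_eq, h1, h2]
    ac_rfl
  rw [this, sup_pair_eq (M.cs_r2 f)]

theorem half_chi [Finite F] (hf : M.r1 f = f) : M.chi = N.chi := by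
  have ev : M.vs = N.vs := by rw [vs, vs, h1, h2]
  have ee : M.es = N.es := by
    have : N.es = M.es ⊔ pair f (M.r2 f) := by
      rw [es, es, hl.step_eq, h2]
      ac_rfl
    have k : M.es f (M.r2 f) := rel_right _ _ f
    rw [this, sup_pair_eq k]
  have ef : numC N.fs + 1 = numC M.fs := by
    have : N.fs = M.fs ⊔ pair f (M.r2 f) := by
      rw [fs, fs, hl.step_eq, h1]
      ac_rfl
    rw [this]
    refine numC_sup_pair fun k => hl.ne ?_
    refine ((rel_mem (T := {f}) rfl (fun x => ?_) (fun x => ?_) k).1 rfl).symm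
    · exact ⟨fun e => M.i0.injective (e.trans hl.fb.symm), by rintro rfl; exact hl.fb⟩
    · exact ⟨fun e => M.i1.injective (e.trans hf.symm), by rintro rfl; exact hf⟩
  have e0 := hl.numC_step M.i0
  rw [chi, chi, ev, ee, ← ef, ← e0, h1, h2]
  push_cast
  ring

theorem half_disk [Finite F] (hf : M.r1 f = f) : M.Disk ↔ N.Disk := by
  refine and_congr (by rw [Conn, Conn, half_cs hl h2 h1]) (and_congr ?_ (by
    rw [half_chi hl h2 h1 hf]))
  refine exists_congr fun c => ?_
  rw [isCol_iff, isCol_iff, ← h1, ← h2]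
  constructor
  · rintro ⟨k0, k1, k2⟩
    exact ⟨(hl.col_iff (k2 f hl.ne.symm)).2 k0, k1, k2⟩
  · rintro ⟨k0, k1, k2⟩
    exact ⟨(hl.col_iff (k2 f hl.ne.symm)).1 k0, k1, k2⟩

end Half

/-- Linking the two flags of the root halfedge by `r0` turns it into a folded edge without changing
the surface. -/
theorem cnt_half {n k : ℕ} : cnt n (fun M f => D 0 (k + 1) M f ∧ M.r0 f = f) =
    cnt n fun M f => G 0 k M f := by
  have key : ∀ {M N : PMap (Fin (2 * n))} {f}, Link M.r0 N.r0 f (M.r2 f) → M.r1 = N.r1 →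
      M.r2 = N.r2 → (D 0 (k + 1) M f ↔ G 0 k N f) := by
    intro M N f hl h1 h2
    have ev : M.vs = N.vs := by rw [vs, vs, h1, h2]
    rw [D, G, ← half_fold hl h2, ← be_eq_of_vs ev h2, ← inn_eq_of_vs ev h2, ← h1]
    by_cases hf : M.r1 f = f
    · rw [half_disk hl h2 h1 hf]
    · simp only [hf, false_and, and_false]
  refine cnt_transfer (fun M f N g => f = g ∧ Link M.r0 N.r0 f (M.r2 f) ∧ M.r1 = N.r1 ∧
    M.r2 = N.r2) ?_ ?_ ?_
  · rintro M f ⟨hM, h0⟩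
    have hn := M.nofix f h0
    have h0' : M.r0 (M.r2 f) = M.r2 f := by rw [M.comm, h0]
    obtain ⟨r0, i0, hl⟩ := exists_link M.i0 h0 h0' hn.symm
    let N : PMap (Fin (2 * n)) :=
      { r0 := r0
        r1 := M.r1
        r2 := M.r2
        i0 := i0
        i1 := M.i1
        i2 := M.i2
        comm := fun x => by
          by_cases k1 : x = f
          · subst k1; rw [hl.ub, hl.bu, M.i2]
          by_cases k2 : x = M.r2 f
          · subst k2; rw [hl.ub, M.i2, hl.bu]
          rw [hl.eq x k1 k2, hl.eq _ (fun k => k2 (by rw [← k, M.i2]))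
            (fun k => k1 (M.i2.injective k)), M.comm]
        nofix := fun x hx => by
          by_cases k1 : x = f
          · subst k1; exact hn
          by_cases k2 : x = M.r2 f
          · subst k2; rw [M.i2]; exact hn.symm
          exact M.nofix x (by rw [← hl.eq x k1 k2, hx]) }
    exact ⟨N, f, (key (N := N) hl rfl rfl).1 hM, rfl, hl, rfl, rfl⟩
  · rintro N f hN
    have h0 := mem_fold_left hN.2.1
    have hn := r2_ne_of_fold h0
    obtain ⟨r0, i0, hl⟩ := exists_unlink N.i0 h0 hn
    let M : PMap (Fin (2 * n)) :=
      { r0 := r0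
        r1 := N.r1
        r2 := N.r2
        i0 := i0
        i1 := N.i1
        i2 := N.i2
        comm := fun x => by
          by_cases k1 : x = f
          · subst k1; rw [hl.fu, hl.fb]
          by_cases k2 : x = N.r2 f
          · subst k2; rw [hl.fu, N.i2, hl.fb]
          rw [← hl.eq x k1 k2, ← hl.eq _ (fun k => k2 (by rw [← k, N.i2]))
            (fun k => k1 (N.i2.injective k)), N.comm]
        nofix := fun x hx => by
          by_cases k1 : x = f
          · subst k1; exact hn
          by_cases k2 : x = N.r2 f
          · subst k2; rw [N.i2]; exact hn.symm
          exact N.nofix x (by rw [hl.eq x k1 k2, hx]) }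
    exact ⟨M, f, ⟨(key (M := M) hl rfl rfl).2 hN, hl.fb⟩, rfl, hl, rfl, rfl⟩
  · rintro M f M' f' N _ N' _ - - - - ⟨rfl, hl, h1, h2⟩ ⟨rfl, hl', h1', h2'⟩ e
    refine and_congr_left fun he => ?_
    constructor
    · intro h
      exact ⟨(hl.comm_iff hl' he (by rw [h.h2, he])).1 h.h0, by rw [← h1, ← h1']; exact h.h1,
        by rw [← h2, ← h2']; exact h.h2⟩
    · intro h
      exact ⟨(hl.comm_iff hl' he (by rw [h2, h2', h.h2, he])).2 h.h0,
        by rw [h1, h1']; exact h.h1, by rw [h2, h2']; exact h.h2⟩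

/-! ### The root edge ends at an inner vertex -/

/-- The edge of `f` is a complete edge. -/
def Full (M : PMap F) (f : F) : Prop := M.r0 f ≠ f ∧ M.r2 f ≠ f ∧ M.r0 f ≠ M.r2 f

theorem bs_le_vs (M : PMap F) (f : F) : M.bs f ≤ M.vs := sup_le_sup_left step_off_le _

/-- A flag of the root edge next to the boundary is alone in its piece. -/
theorem Cut.bs_alone {M N : PMap F} {a b c d : F} (h : Cut M N a b c d) {y : F}
    (hy : y ∈ M.edge a) (h1 : M.r1 y = y) {x : F} : M.bs a y x ↔ x = y := by
  constructor
  · intro k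
    have e : off M.r2 (M.edge a) y = y := off_mem hy
    refine (rel_mem (T := {y}) rfl (fun x => ?_) (fun x => ?_) k).1 rfl
    · exact ⟨fun k => M.i1.injective (k.trans h1.symm), by rintro rfl; exact h1⟩
    · exact ⟨fun k => h.off_inv.injective (k.trans e.symm), by rintro rfl; exact e⟩
  · rintro rfl; exact Setoid.refl' _ _

theorem Cut.edge_r2 {M N : PMap F} {a b c d : F} (h : Cut M N a b c d) :
    ∀ x ∈ M.edge a, M.r2 x ∈ M.edge a ∧ M.r2 x ≠ x := by
  intro x hx
  refine ⟨h.r2_mem_edge hx, ?_⟩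
  have ne := h.ne
  rcases h.mem_edge.1 hx with rfl | rfl | rfl | rfl
  · rw [h.ac]; exact ne.2.1.symm
  · rw [h.bd]; exact ne.2.2.2.2.1.symm
  · rw [h.ca]; exact ne.2.1
  · rw [h.db]; exact ne.2.2.2.2.1

section Unzip

variable {M N : PMap F} {b u : F} (hl : Link N.r1 M.r1 b u) (h2 : M.r2 = N.r2)
include hl h2

theorem unzip_vs (hv : N.vs b u) : M.vs = N.vs := by
  have : M.vs = N.vs ⊔ pair b u := by
    rw [vs, vs, hl.step_eq, h2]
    ac_rfl
  rw [this, sup_pair_eq hv]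

variable (h0 : M.r0 = N.r0)
include h0

theorem unzip_bs (f : F) : M.bs f = N.bs f ⊔ pair b u := by
  have : M.edge f = N.edge f := by rw [edge, edge, h0, h2]
  rw [bs, bs, hl.step_eq, h2, this]
  ac_rfl

variable (hv : N.vs b u)
include hv

/-- The map `M` arises from `N` by sewing together the boundary arcs next to the flags `b`, `u` at
their common vertex: the half-disk that consists of `b` and `r0 b` merges with the face of `u`, and
two boundary sides become one inner side. -/
theorem unzip_chi [Finite F] (hb : N.r1 (N.r0 b) = N.r0 b) (hu : u ≠ N.r0 b) :
    M.chi = N.chi := by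
  have ee : M.es = N.es := by rw [es, es, h0, h2]
  have ef : numC M.fs + 1 = numC N.fs := by
    have : M.fs = N.fs ⊔ pair b u := by
      rw [fs, fs, hl.step_eq, h0]
      ac_rfl
    rw [this]
    refine numC_sup_pair fun k => ?_
    have k' := (rel_mem (T := {x | x = b ∨ x = N.r0 b}) rfl (fun x => ?_) (fun x => ?_) k).1
      (Or.inl rfl)
    · exact k'.elim hl.ne.symm hu
    · change N.r0 x = b ∨ N.r0 x = N.r0 b ↔ x = b ∨ x = N.r0 b
      rw [N.i0.injective.eq_iff, N.i0.eq_iff, or_comm]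
    · change N.r1 x = b ∨ N.r1 x = N.r0 b ↔ x = b ∨ x = N.r0 b
      rw [N.i1.eq_iff, N.i1.eq_iff, hb, hl.fb]
  have e1 := hl.numC_step N.i1
  rw [chi, chi, unzip_vs hl h2 hv, ee, ← ef, ← e1, h0, h2]
  push_cast
  ring

theorem unzip_conn : M.Conn ↔ N.Conn := by
  have : M.cs = N.cs := by
    change step M.r0 ⊔ M.vs = step N.r0 ⊔ N.vs
    rw [unzip_vs hl h2 hv, h0]
  rw [Conn, Conn, this]

end Unzip

/-- The root edge is complete and ends at an inner vertex. -/
def Inner (M : PMap F) (f : F) : Prop :=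
  M.Full f ∧ M.bs f (M.r0 f) (M.r0 (M.r2 f))

/-- The root edge is complete and ends at a boundary vertex, being the first dart there;
on the other side this vertex is not incident to a boundary edge. -/
def FirstOuter (M : PMap F) (f : F) : Prop :=
  (M.Full f ∧ ¬ M.bs f (M.r0 f) (M.r0 (M.r2 f)) ∧ ¬ M.bs f (M.r2 f) (M.r0 (M.r2 f))) ∧
    M.r1 (M.r0 f) = M.r0 f ∧ M.be (M.r0 f) = 0

/-- If the face on the first side of the root edge is slit open from the boundary to the end of the
root edge, an inner vertex at this end becomes one on the boundary. -/
theorem cnt_unzip {n k : ℕ} : cnt n (fun M f => D 0 k M f ∧ Inner M f) =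
    cnt n fun M f => D 0 k M f ∧ FirstOuter M f := by
  refine cnt_transfer (fun M f N g => f = g ∧ ∃ u, Link N.r1 M.r1 (M.r0 f) u ∧ M.r0 = N.r0 ∧
    M.r2 = N.r2 ∧ N.vs (N.r0 f) u) ?_ ?_ ?_
  · rintro M f ⟨⟨⟨m1, ⟨col, m2⟩, m3⟩, hfold, hf, hbe, hinn⟩, ⟨h0, h2, h⟩, hbd⟩
    obtain ⟨X, hX⟩ := exists_cut M f h0 h2 h
    obtain ⟨ab, ac, ad, bc, bd, cd⟩ := hX.ne
    have hb : M.r0 f ∈ M.edge f := Or.inr (Or.inl rfl)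
    have hc : M.r2 f ∈ M.edge f := Or.inr (Or.inr (Or.inl rfl))
    have hd : M.r0 (M.r2 f) ∈ M.edge f := Or.inr (Or.inr (Or.inr rfl))
    have ha : f ∈ M.edge f := Or.inl rfl
    have ev := (even_piece hX.edge_r2 hb hd bd.symm hbd).2
    change ∀ y, M.bs f (M.r0 f) y → _ at ev
    have nbc : ¬ M.bs f (M.r0 f) (M.r2 f) := fun k => by
      rcases (ev _ k).2.2 hc with e | e
      · exact bc e.symm
      · exact cd e
    have nba : ¬ M.bs f (M.r0 f) f := fun k => by
      rcases (ev _ k).2.2 ha with e | e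
      · exact ab e
      · exact ad e
    have hbe' : ∀ x, M.vs (M.r0 f) x → M.r2 x ≠ x := by
      intro x hx
      have k : (M.bs f ⊔ pair f (M.r2 f)) (M.r0 f) (M.r0 (M.r2 f)) :=
        (le_sup_left : M.bs f ≤ M.bs f ⊔ pair f (M.r2 f)) hbd
      rw [hX.m_vs, sup_pair_eq k, sup_pair_iff] at hx
      exact (ev x (by tauto)).2.1
    obtain ⟨r1, i1, hl⟩ := exists_unlink M.i1 rfl (ev _ (Setoid.refl' _ _)).1
    have ub : M.bs f (M.r0 f) (M.r1 (M.r0 f)) := rel_left _ _ _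
    have ua : M.r1 (M.r0 f) ≠ f := fun k => nba (by rw [k] at ub; exact ub)
    let N : PMap (Fin (2 * n)) :=
      { r0 := M.r0
        r1 := r1
        r2 := M.r2
        i0 := M.i0
        i1 := i1
        i2 := M.i2
        comm := M.comm
        nofix := M.nofix }
    have hl' : Link N.r1 M.r1 (M.r0 f) (M.r1 (M.r0 f)) := hl
    have hbs := unzip_bs (M := M) (N := N) hl' rfl rfl f
    obtain ⟨X', hX'⟩ := exists_cut N f h0 h2 h
    have al : ∀ {x}, N.bs f (M.r0 f) x ↔ x = M.r0 f := hX'.bs_alone hb hl.fb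
    have hv : N.vs (M.r0 f) (M.r1 (M.r0 f)) := by
      have k := hbd
      rw [hbs, sup_pair_iff] at k
      simp only [al] at k
      have k : N.bs f (M.r1 (M.r0 f)) (M.r0 (M.r2 f)) := by
        have := bd.symm
        have := hl.ne.symm
        tauto
      have k1 := N.bs_le_vs f k
      have k2 := N.vs_r2 (N.r0 f)
      rw [← N.comm] at k2
      exact Setoid.trans' _ k2 (Setoid.symm' _ k1)
    have hr1 : N.r1 f = f := by
      rw [← hl'.eq f ab ua.symm, hf]
    have ha' : N.r0 (M.r0 f) = f := M.i0 f
    have evs := unzip_vs (M := M) hl' rfl hv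
    refine ⟨N, f, ⟨⟨⟨(unzip_conn (M := M) hl' rfl rfl hv).1 m1, ⟨col, ?_⟩, ?_⟩, hfold, hr1, ?_, ?_⟩,
      ⟨⟨h0, h2, h⟩, ?_, ?_⟩, hl.fb, ?_⟩, rfl, _, hl', rfl, rfl, hv⟩
    · rw [isCol_iff] at m2 ⊢
      exact ⟨m2.1, (hl'.col_iff (m2.2.1 _ hl.ne.symm)).1 m2.2.1, m2.2.2⟩
    · rw [← unzip_chi (M := M) hl' rfl rfl hv (by rw [ha', hr1]) (by rw [ha']; exact ua), m3]
    · rw [← be_eq_of_vs (M := M) evs rfl, hbe]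
    · rw [← inn_eq_of_vs (M := M) evs rfl, hinn]
    · change ¬ N.bs f (M.r0 f) _
      rw [al]; exact bd.symm
    · intro k
      have k : M.bs f (M.r2 f) (M.r0 (M.r2 f)) := by
        rw [hbs]; exact (le_sup_left : N.bs f ≤ _) k
      exact nbc (Setoid.trans' _ hbd (Setoid.symm' _ k))
    · change N.be (M.r0 f) = 0
      rw [← be_eq_of_vs (M := M) evs rfl, be, Set.ncard_eq_zero, Set.eq_empty_iff_forall_notMem]
      exact fun x hx => hbe' x hx.1 hx.2
  · rintro N f ⟨⟨⟨m1, ⟨col, m2⟩, m3⟩, hfold, hf, hbe, hinn⟩, ⟨⟨h0, h2, h⟩, nbd, ncd⟩, hb, hb0⟩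
    obtain ⟨X, hX⟩ := exists_cut N f h0 h2 h
    obtain ⟨ab, ac, ad, bc, bd, cd⟩ := hX.ne
    rcases (vertex_path hb).2 with ⟨k, -⟩ | ⟨-, u, hv, hu, H, hcol⟩
    · omega
    have alb : ∀ {x}, N.bs f (N.r0 f) x ↔ x = N.r0 f := hX.bs_alone (Or.inr (Or.inl rfl)) hb
    have ala : ∀ {x}, N.bs f f x ↔ x = f := hX.bs_alone (Or.inl rfl) hf
    have nda : ¬ N.bs f (N.r0 (N.r2 f)) f := fun k => by
      have := ala.1 (Setoid.symm' _ k)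
      exact ad this.symm
    have hdu : N.bs f (N.r0 (N.r2 f)) u := by
      have k := hv
      rw [hX.m_vs] at k
      simp only [sup_pair_iff, alb] at k
      have e1 : ¬ N.bs f (N.r0 (N.r2 f)) (N.r2 f) := fun k => ncd (Setoid.symm' _ k)
      have := ab.symm
      have := bc.symm
      have := bd.symm
      tauto
    have ua : u ≠ f := fun k => nda (by rw [k] at hdu; exact hdu)
    obtain ⟨r1, i1, hl⟩ := exists_link N.i1 hb ((H u hv).2 (Or.inr rfl)) hu.symm
    let M : PMap (Fin (2 * n)) :=
      { r0 := N.r0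
        r1 := r1
        r2 := N.r2
        i0 := N.i0
        i1 := i1
        i2 := N.i2
        comm := N.comm
        nofix := N.nofix }
    have hl' : Link N.r1 M.r1 (N.r0 f) u := hl
    have ha' : N.r0 (N.r0 f) = f := N.i0 f
    have evs := unzip_vs (M := M) hl' rfl hv
    refine ⟨M, f, ⟨⟨⟨(unzip_conn (M := M) hl' rfl rfl hv).2 m1, ⟨col, ?_⟩, ?_⟩, hfold, ?_, ?_, ?_⟩,
      ⟨h0, h2, h⟩, ?_⟩, rfl, u, hl', rfl, rfl, hv⟩
    · have := hcol col m2
      rw [isCol_iff] at m2 ⊢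
      exact ⟨m2.1, (hl'.col_iff this).2 m2.2.1, m2.2.2⟩
    · rw [unzip_chi (M := M) hl' rfl rfl hv (by rw [ha', hf]) (by rw [ha']; exact ua), m3]
    · change r1 f = f
      rw [hl.eq f ab ua.symm, hf]
    · rw [be_eq_of_vs (M := M) evs rfl, hbe]
    · rw [inn_eq_of_vs (M := M) evs rfl, hinn]
    · rw [unzip_bs (M := M) (N := N) hl' rfl rfl f, sup_pair_iff]
      exact Or.inr (Or.inl ⟨Setoid.refl' _ _, Setoid.symm' _ hdu⟩)
  · rintro M f M' f' N _ N' _ - - hN hN' ⟨rfl, u, hl, h0, h2, hv⟩ ⟨rfl, u', hl', h0', h2', hv'⟩ e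
    refine and_congr_left fun he => ?_
    constructor
    · intro h
      have hb : e (M.r0 f) = M'.r0 f' := by rw [h.h0, he]
      refine ⟨by rw [← h0, ← h0']; exact h.h0, ?_, by rw [← h2, ← h2']; exact h.h2⟩
      exact (hl.comm_iff hl' hb (by rw [← hl.bu, h.h1, hb, hl'.bu])).2 h.h1
    · intro h
      have hb : e (M.r0 f) = M'.r0 f' := by rw [h0, h.h0, he, h0']
      refine ⟨by rw [h0, h0']; exact h.h0, ?_, by rw [h2, h2']; exact h.h2⟩
      -- the flag to be linked with `r0 f` is the other end of its vertex
      refine (hl.comm_iff hl' hb ?_).1 h.h1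
      rcases (vertex_path hN'.2.2.1).2 with ⟨k, -⟩ | ⟨-, z, -, -, H, -⟩
      · have := hN'.2.2.2; omega
      have hv2 : N'.vs (N'.r0 f') (e u) := by
        rw [← h0', ← hb, h0]; exact (h.vs_iff' e.injective _ _).2 hv
      have e1 := ((H _ hv').1 hl'.fu).resolve_left (by rw [← h0']; exact hl'.ne.symm)
      have e2 := ((H _ hv2).1 (by rw [← h.h1, hl.fu])).resolve_left (by
        rw [← h0', ← hb]; exact e.injective.ne hl.ne.symm)
      rw [e1, e2]

end PMap

/-! ### The root edge separates the map when it is cut lengthwise -/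

namespace PMap

variable {F A B : Type}

namespace Cut

variable {M N : PMap F} {a b c d : F} (h : Cut M N a b c d)
include h

theorem mem_a : a ∈ M.edge a := h.mem_edge.2 (Or.inl rfl)
theorem mem_b : b ∈ M.edge a := h.mem_edge.2 (Or.inr (Or.inl rfl))
theorem mem_c : c ∈ M.edge a := h.mem_edge.2 (Or.inr (Or.inr (Or.inl rfl)))
theorem mem_d : d ∈ M.edge a := h.mem_edge.2 (Or.inr (Or.inr (Or.inr rfl)))

theorem bs_le_n_vs : M.bs a ≤ N.vs := by
  rw [h.n_vs]; exact le_sup_left.trans le_sup_left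

variable (ha : M.r1 a = a)
include ha

/-- The number of vertices compared with the number of pieces. -/
theorem numC_m [Finite F] (hbd : ¬ M.bs a b d) : numC M.vs + 2 = numC (M.bs a) := by
  obtain ⟨ab, ac, ad, bc, bd, cd⟩ := h.ne
  have al : ∀ {x}, M.bs a a x ↔ x = a := h.bs_alone h.mem_a ha
  have al' : ∀ {x}, M.bs a x a ↔ x = a := by intro x; rw [Setoid.comm', al]
  have k1 : ¬ M.bs a a c := by rw [al]; exact ac.symm
  have k2 : ¬ (M.bs a ⊔ pair a c) b d := by
    rw [sup_pair_iff, al, al']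
    have := ab.symm
    have := ad.symm
    tauto
  have e1 := numC_sup_pair k1
  have e2 := numC_sup_pair k2
  rw [h.m_vs]
  omega

theorem numC_n [Finite F] : (M.bs a c d → numC N.vs + 1 = numC (M.bs a)) ∧
    (¬ M.bs a c d → numC N.vs + 2 = numC (M.bs a)) := by
  obtain ⟨ab, ac, ad, bc, bd, cd⟩ := h.ne
  have al : ∀ {x}, M.bs a a x ↔ x = a := h.bs_alone h.mem_a ha
  have al' : ∀ {x}, M.bs a x a ↔ x = a := by intro x; rw [Setoid.comm', al]
  have k1 : ¬ M.bs a a b := by rw [al]; exact ab.symm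
  have e1 := numC_sup_pair k1
  rw [h.n_vs]
  constructor
  · intro k
    rw [sup_pair_eq ((le_sup_left : M.bs a ≤ M.bs a ⊔ pair a b) k), e1]
  · intro k
    have k2 : ¬ (M.bs a ⊔ pair a b) c d := by
      rw [sup_pair_iff, al, al']
      have := ac.symm
      have := ad.symm
      tauto
    have e2 := numC_sup_pair k2
    omega

theorem chi_n [Finite F] (hbd : ¬ M.bs a b d) :
    (M.bs a c d → N.chi = M.chi + 2) ∧ (¬ M.bs a c d → N.chi = M.chi + 1) := by
  have h1 := h.numC_m ha hbd
  have h2 := h.numC_n ha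
  have h3 := h.chi_eq
  exact ⟨fun k => by have := h2.1 k; omega, fun k => by have := h2.2 k; omega⟩

/-- The vertices after cutting, in terms of the pieces. -/
theorem n_vs_iff (hbc : ¬ M.bs a b c) (hbd : ¬ M.bs a b d) (x : F) :
    (N.vs a x ↔ x = a ∨ M.bs a b x) ∧ (N.vs c x ↔ M.bs a c x ∨ M.bs a d x) := by
  obtain ⟨ab, ac, ad, bc, bd, cd⟩ := h.ne
  have al : ∀ {x}, M.bs a a x ↔ x = a := h.bs_alone h.mem_a ha
  have al' : ∀ {x}, M.bs a x a ↔ x = a := by intro x; rw [Setoid.comm', al]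
  have s1 : ¬ M.bs a c b := fun k => hbc (Setoid.symm' _ k)
  have s2 : ¬ M.bs a d b := fun k => hbd (Setoid.symm' _ k)
  have r : ∀ y, M.bs a y y := fun y => Setoid.refl' _ y
  have t1 : M.bs a c d → M.bs a d x → M.bs a c x := fun k k' => Setoid.trans' _ k k'
  have t2 : M.bs a c d → M.bs a c x → M.bs a d x := fun k k' =>
    Setoid.trans' _ (Setoid.symm' _ k) k'
  rw [h.n_vs]
  simp only [sup_pair_iff, al, al', hbc, hbd, s1, s2, ab.symm, ac.symm, ad.symm, r,
    true_and, false_and, and_false, or_false]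
  clear al al' r
  tauto

theorem m_vs_iff (hbc : ¬ M.bs a b c) (hbd : ¬ M.bs a b d) (x : F) :
    (M.vs a x ↔ x = a ∨ M.bs a c x ∨ (M.bs a c d ∧ M.bs a b x)) ∧
      (¬ M.bs a c d → (M.vs b x ↔ M.bs a b x ∨ M.bs a d x)) := by
  obtain ⟨ab, ac, ad, bc, bd, cd⟩ := h.ne
  have al : ∀ {x}, M.bs a a x ↔ x = a := h.bs_alone h.mem_a ha
  have al' : ∀ {x}, M.bs a x a ↔ x = a := by intro x; rw [Setoid.comm', al]
  have s1 : ¬ M.bs a c b := fun k => hbc (Setoid.symm' _ k)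
  have s3 : M.bs a d c ↔ M.bs a c d := ⟨fun k => Setoid.symm' _ k, fun k => Setoid.symm' _ k⟩
  have r : ∀ y, M.bs a y y := fun y => Setoid.refl' _ y
  rw [h.m_vs]
  simp only [sup_pair_iff, al, al', hbc, hbd, s1, s3, ab.symm, ac.symm, ad.symm, r,
    true_and, false_and, and_false, or_false, false_or]
  clear al al' r
  tauto

/-- The root edge separates the map. -/
theorem not_cs [Finite F] (hM : M.Conn) (hchi : M.chi = 1) (hbd : ¬ M.bs a b d) :
    ¬ N.cs a c := by
  intro k
  have hN : N.Conn := by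
    have h1 := h.conn_iff.1 hM
    have h2 : ∀ x, N.cs a x := fun x => (h1 x).elim id fun k' => Setoid.trans' _ k k'
    exact fun x y => Setoid.trans' _ (Setoid.symm' _ (h2 x)) (h2 y)
  have h1 := (chi_le N hN a).2 ⟨a, Or.inr (Or.inl (by rw [h.r1, ha]))⟩
  have h2 := h.chi_n ha hbd
  by_cases k : M.bs a c d
  · have := h2.1 k; omega
  · have := h2.2 k; omega

end Cut

theorem even_ncard_cs [Finite F] (M : PMap F) (a : F) : Even {x | M.cs a x}.ncard := by
  classical
  let θ : {x // M.cs a x} → {x // M.cs a x} := fun x =>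
    if M.r2 x.1 = x.1 then ⟨M.r0 x.1, Setoid.trans' _ x.2 (M.cs_r0 _)⟩
    else ⟨M.r2 x.1, Setoid.trans' _ x.2 (M.cs_r2 _)⟩
  have h1 : ∀ x, M.r2 x.1 = x.1 → (θ x).1 = M.r0 x.1 := fun x h => by simp only [θ, if_pos h]
  have h2 : ∀ x, M.r2 x.1 ≠ x.1 → (θ x).1 = M.r2 x.1 := fun x h => by simp only [θ, if_neg h]
  have hθ : Involutive θ := by
    intro x
    apply Subtype.ext
    by_cases h : M.r2 x.1 = x.1
    · rw [h1 (θ x) (by rw [h1 x h, ← M.comm, h]), h1 x h, M.i0]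
    · rw [h2 (θ x) (by rw [h2 x h, M.i2]; exact Ne.symm h), h2 x h, M.i2]
  have hf : {x | θ x = x} = ∅ := by
    ext x
    refine iff_of_false (fun k => ?_) id
    have k : (θ x).1 = x.1 := congrArg Subtype.val k
    by_cases h : M.r2 x.1 = x.1
    · rw [h1 x h] at k; exact M.nofix _ k h
    · rw [h2 x h] at k; exact h k
  have := two_mul_numC_step hθ
  rw [hf, Set.ncard_empty, add_zero] at this
  rw [← Nat.card_coe_set_eq]
  exact ⟨numC (step θ), by rw [← two_mul, this]; rfl⟩

/-- The number of darts on the first side of the root edge. -/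
theorem exists_sep {n k : ℕ} {M : PMap (Fin (2 * n))} {f : Fin (2 * n)} (hM : D 0 k M f)
    (hf : M.Full f) (hbd : ¬ M.bs f (M.r0 f) (M.r0 (M.r2 f))) :
    ∃ n' < n - 1, Sep (n' + 1) M f := by
  obtain ⟨X, hX⟩ := exists_cut M f hf.1 hf.2.1 hf.2.2
  have h := hX.not_cs hM.2.2.1 hM.1.1 hM.1.2.2 hbd
  obtain ⟨m, hm⟩ := X.even_ncard_cs f
  have hne := hX.ne
  have c1 : ({f, M.r0 f} : Set (Fin (2 * n))).ncard ≤ {x | X.cs f x}.ncard := by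
    refine Set.ncard_le_ncard ?_
    rintro x (rfl | rfl)
    · exact X.cs.refl' _
    · have := X.cs_r0 f
      rwa [hX.r0] at this
  have c2 : ({M.r2 f, M.r0 (M.r2 f)} : Set (Fin (2 * n))).ncard ≤ {x | X.cs f x}ᶜ.ncard := by
    refine Set.ncard_le_ncard ?_
    rintro x (rfl | rfl)
    · exact h
    · have := X.cs_r0 (M.r2 f)
      rw [hX.r0] at this
      exact fun k => h (X.cs.trans' k (X.cs.symm' this))
  rw [Set.ncard_pair hne.1] at c1
  rw [Set.ncard_pair hne.2.2.2.2.2] at c2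
  have c3 := Set.ncard_add_ncard_compl {x | X.cs f x}
  rw [Nat.card_eq_fintype_card, Fintype.card_fin] at c3
  refine ⟨m - 1, by omega, hf, ?_, ?_⟩
  · rw [← hX.n_cs]; exact h
  · rw [← hX.n_cs, hm]; omega

theorem Hom.bs_iff {M : PMap A} {N : PMap B} {e : A ≃ B} (h : Hom M N e) {f x y : A}
    (hf : M.Full f) : N.bs (e f) (e x) (e y) ↔ M.bs f x y := by
  obtain ⟨X, hX⟩ := exists_cut M f hf.1 hf.2.1 hf.2.2
  have hf' : N.Full (e f) := by
    refine ⟨?_, ?_, ?_⟩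
    · rw [← h.h0]; exact e.injective.ne hf.1
    · rw [← h.h2]; exact e.injective.ne hf.2.1
    · rw [← h.h0, ← h.h2]; exact e.injective.ne hf.2.2
  obtain ⟨Y, hY⟩ := exists_cut N (e f) hf'.1 hf'.2.1 hf'.2.2
  refine rel_map_iff' N.i1 hY.off_inv e.injective h.h1 (off_map h.h2 fun x => ?_) x y
  rw [edge, edge, ← h.h0, ← h.h2, ← h.h0]
  simp

theorem Hom.full {M : PMap A} {N : PMap B} {e : A ≃ B} (h : Hom M N e) {f : A}  :
    N.Full (e f) ↔ M.Full f := by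
  rw [Full, Full, ← h.h0, ← h.h2, e.injective.ne_iff, e.injective.ne_iff, e.injective.ne_iff]

theorem Hom.gs_ncard {M : PMap A} {N : PMap B} {e : A ≃ B} (h : Hom M N e) {f : A}
    (hf : M.Full f) : {x | N.gs (e f) (e f) x}.ncard = {x | M.gs f f x}.ncard := by
  obtain ⟨X, hX⟩ := exists_cut M f hf.1 hf.2.1 hf.2.2
  have hf' := h.full.2 hf
  obtain ⟨Y, hY⟩ := exists_cut N (e f) hf'.1 hf'.2.1 hf'.2.2
  have k := (hX.hom_iff hY rfl (h.h2 f)).1 h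
  rw [← hX.n_cs, ← hY.n_cs]
  have : {x | Y.cs (e f) x} = e '' {x | X.cs f x} := by
    ext y
    refine (k.cs_iff f y).trans ?_
    exact ⟨fun ⟨z, hz, k⟩ => ⟨z, k, hz⟩, fun ⟨z, hz, k⟩ => ⟨z, k, hz⟩⟩
  rw [this, Set.ncard_image_of_injective _ e.injective]

/-- Counting according to the number of darts on one side of the root edge. -/
theorem cnt_sep {n k : ℕ} {P : PMap (Fin (2 * n)) → Fin (2 * n) → Prop}
    (hP : ∀ M f, P M f → D 0 k M f ∧ M.Full f ∧ ¬ M.bs f (M.r0 f) (M.r0 (M.r2 f))) :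
    cnt n P = ∑ n' ∈ Finset.range (n - 1), cnt n fun M f => P M f ∧ Sep (n' + 1) M f := by
  rw [cnt_sum (Finset.range (n - 1)) P fun M f => {x | M.gs f f x}.ncard / 2 - 1]
  · refine Finset.sum_congr rfl fun n' _ => cnt_congr fun M f => and_congr_right fun h => ?_
    obtain ⟨h1, h2, h3⟩ := hP M f h
    obtain ⟨m, hm, k1, k2, k3⟩ := exists_sep h1 h2 h3
    rw [k3]
    constructor
    · intro e
      have e : m = n' := by omega
      subst e
      exact ⟨k1, k2, k3⟩
    · rintro ⟨-, -, e⟩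
      omega
  · intro M f h
    obtain ⟨h1, h2, h3⟩ := hP M f h
    obtain ⟨m, hm, k1, k2, k3⟩ := exists_sep h1 h2 h3
    rw [k3, Finset.mem_range]
    omega
  · intro M N f e h hM
    rw [h.gs_ncard (hP M f hM).2.1]

end PMap

/-! ### Gluing two maps along folded edges -/

namespace PMap

variable {F A B : Type}

theorem be_eq_zero_iff [Finite F] {M : PMap F} {f : F} :
    M.be f = 0 ↔ ∀ x, M.vs f x → M.r2 x ≠ x := by
  rw [be, Set.ncard_eq_zero, Set.eq_empty_iff_forall_notMem]
  exact ⟨fun h x k k' => h x ⟨k, k'⟩, fun h x k => h x k.1 k.2⟩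

theorem sum_be (M : PMap A) (N : PMap B) (a : A) (c : B) :
    (M.sum N).be (.inl a) = M.be a ∧ (M.sum N).be (.inr c) = N.be c :=
  ⟨(hom_inl M N).be_eq Sum.inl_injective a, (hom_inr M N).be_eq Sum.inr_injective c⟩

theorem sum_inn (M : PMap A) (N : PMap B) (a : A) (c : B) :
    (M.sum N).inn (.inl a) = M.inn a ∧ (M.sum N).inn (.inr c) = N.inn c :=
  ⟨(hom_inl M N).inn_eq Sum.inl_injective a, (hom_inr M N).inn_eq Sum.inr_injective c⟩

/-- Disks whose only folded edge contains the root flag, which is next to the boundary. -/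
def GA (M : PMap F) (p : F) : Prop := M.Disk ∧ M.fold = {p, M.r2 p} ∧ M.r1 p = p

/-- Disks whose only folded edge contains the root flag `c`, such that there are `k - 1` inner darts
between `c` and the boundary. They have `2 (k - 1)` flags, and `c` itself is counted, too. -/
def PosA (k : ℕ) (M : PMap F) (c : F) : Prop :=
  M.Disk ∧ M.fold = {c, M.r2 c} ∧ {x | M.ms c c x}.ncard + 1 = 2 * k

/-- The root edge ends at a boundary vertex other than the root vertex. -/
def Outer (M : PMap F) (f : F) : Prop :=
  ¬ M.bs f (M.r0 f) (M.r0 (M.r2 f)) ∧ ¬ M.bs f (M.r2 f) (M.r0 (M.r2 f))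

section Glue

variable {M : PMap A} {N : PMap B} {L : PMap (A ⊕ B)} {a b : A} {c d : B}
  (hM : M.Conn) (hN : N.Conn) (h : Cut L (M.sum N) (.inl a) (.inl b) (.inr c) (.inr d))

include h in
theorem glue_r2 : M.r2 a = b ∧ N.r2 c = d :=
  ⟨Sum.inl_injective h.nab, Sum.inr_injective h.ncd⟩

include hM hN h in
theorem glue_conn : L.Conn := by
  rw [h.conn_iff]
  rintro (x | x)
  · exact Or.inl ((sum_cs_inl M N hM a _).2 ⟨x, rfl⟩)
  · exact Or.inr ((sum_cs_inr M N hN c _).2 ⟨x, rfl⟩)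

include h in
theorem glue_ori : L.Ori ↔ M.Ori ∧ N.Ori := by
  constructor
  · rintro ⟨col, hcol⟩
    have := h.isCol hcol
    exact ⟨(hom_inl M N).ori Sum.inl_injective ⟨col, this⟩,
      (hom_inr M N).ori Sum.inr_injective ⟨col, this⟩⟩
  · rintro ⟨⟨c1, h1⟩, ⟨c2, h2⟩⟩
    -- swap the two colours on one of the components if necessary
    refine ⟨Sum.elim c1 fun x => c2 x ^^ (c2 c ^^ !c1 a), h.isCol' ?_ ?_⟩
    · have inl := fun {x y : A} => (Sum.inl_injective (β := B)).ne_iff (x := x) (y := y)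
      have inr := fun {x y : B} => (Sum.inr_injective (α := A)).ne_iff (x := x) (y := y)
      rintro (x | x)
      · obtain ⟨k0, k1, k2⟩ := h1 x
        exact ⟨fun k => k0 (inl.1 k), fun k => k1 (inl.1 k), fun k => k2 (inl.1 k)⟩
      · obtain ⟨k0, k1, k2⟩ := h2 x
        have e : ∀ y z w : Bool, y ≠ z → (y ^^ w) ≠ (z ^^ w) := by decide
        exact ⟨fun k => e _ _ _ (k0 (inr.1 k)), fun k => e _ _ _ (k1 (inr.1 k)),
          fun k => e _ _ _ (k2 (inr.1 k))⟩
    · change c1 a ≠ (c2 c ^^ (c2 c ^^ !c1 a))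
      cases c1 a <;> cases c2 c <;> decide

include h in
theorem glue_fold : L.fold = ∅ ↔ M.fold = {a, M.r2 a} ∧ N.fold = {c, N.r2 c} := by
  obtain ⟨e1, e2⟩ := glue_r2 h
  have hl : ∀ x, (.inl x ∈ (M.sum N).fold ↔ x ∈ M.fold) :=
    (hom_inl M N).mem_fold Sum.inl_injective
  have hr : ∀ x, (.inr x ∈ (M.sum N).fold ↔ x ∈ N.fold) :=
    (hom_inr M N).mem_fold Sum.inr_injective
  rw [e1, e2]
  have : L.fold = ∅ ↔ ∀ x, x ∈ (M.sum N).fold ↔ x = .inl a ∨ x = .inl b ∨ x = .inr c ∨ x = .inr d := by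
    rw [h.fold_eq]
    constructor
    · intro k x
      rw [k, Set.empty_union]
      rfl
    · intro k
      rw [Set.eq_empty_iff_forall_notMem]
      intro x hx
      have := (k x).1 (Or.inl hx)
      have := h.fold_disj hx
      tauto
  rw [this]
  simp only [Sum.forall, hl, hr, Set.ext_iff, Set.mem_insert_iff, Set.mem_singleton_iff,
    Sum.inl.injEq, Sum.inr.injEq, reduceCtorEq, false_or, or_false]

include hM h in
theorem glue_sep : ¬ L.bs (.inl a) (.inl b) (.inr c) ∧ ¬ L.bs (.inl a) (.inl b) (.inr d) := by
  have key : ∀ x, ¬ L.bs (.inl a) (.inl b) (.inr x) := fun x k => by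
    have := vs_le_cs _ (h.bs_le_n_vs k)
    rw [sum_cs_inl M N hM] at this
    obtain ⟨y, hy⟩ := this
    cases hy
  exact ⟨key c, key d⟩

include hN h in
theorem glue_inr {x : A ⊕ B} (k : L.bs (.inl a) (.inr c) x) : ∃ y, x = .inr y := by
  have := vs_le_cs _ (h.bs_le_n_vs k)
  rwa [sum_cs_inr M N hN] at this

include h in
theorem glue_r1 : L.r1 (.inl a) = .inl a ↔ M.r1 a = a := by
  rw [← h.r1]; exact Sum.inl_injective.eq_iff

include h in
/-- The piece of the second side at the root, seen in the second component. -/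
theorem glue_ms : {x | L.bs (.inl a) (.inr c) x}.ncard = {x | N.ms c c x}.ncard := by
  obtain ⟨-, e2⟩ := glue_r2 h
  have key := rel_map_iff (σ := N.r1) (τ := off N.r2 {c, N.r2 c}) (j := (Sum.inr : B → A ⊕ B)) L.i1
    h.off_inv (fun x => by rw [← h.r1]; rfl) (fun x => by
      have hx : (Sum.inr x : A ⊕ B) ∈ L.edge (.inl a) ↔ x ∈ ({c, N.r2 c} : Set B) := by
        rw [h.mem_edge, e2]; simp
      by_cases k : x ∈ ({c, N.r2 c} : Set B)
      · rw [off_mem k, off_mem (hx.2 k)]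
      · rw [off_notMem k, off_notMem (fun k' => k (hx.1 k'))]
        rw [h.mem_edge] at hx
        rw [← h.r2 _ (by tauto) (by tauto) (by tauto) (by tauto)]
        rfl) c
  have : {x | L.bs (.inl a) (.inr c) x} = Sum.inr '' {x | N.ms c c x} := by
    ext y
    refine (key y).trans ?_
    exact ⟨fun ⟨z, hz, k⟩ => ⟨z, k, hz⟩, fun ⟨z, hz, k⟩ => ⟨z, k, hz⟩⟩
  rw [this, Set.ncard_image_of_injective _ Sum.inr_injective]

include h in
theorem outer_iff : Outer L (.inl a) ↔
    ¬ L.bs (.inl a) (.inl b) (.inr d) ∧ ¬ L.bs (.inl a) (.inr c) (.inr d) := by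
  rw [Outer, h.ac, h.ab, h.cd]

variable [Finite A] [Finite B]

/-! #### The two sides of the root edge end at the same vertex -/

/-- Both ends of the root edge are at the same vertex: the flags `r2 f` and `r0 (r2 f)` of its second
side belong to the same piece. The flag `r0 f` belongs to another piece, which has `2 j + 1` flags:
`r0 f` itself and those of the `j` darts outside of the loop. -/
def Enclosing (j : ℕ) (M : PMap F) (f : F) : Prop :=
  M.bs f (M.r2 f) (M.r0 (M.r2 f)) ∧ ¬ M.bs f (M.r0 f) (M.r0 (M.r2 f)) ∧
    {x | M.bs f (M.r0 f) x}.ncard = 2 * j + 1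

include hM hN h in
/-- The component of the first side is a disk that keeps the boundary, that of the second side is a
sphere. By additivity their Euler characteristics sum to `3`, and `chi_le` determines both. -/
theorem glue_enclosing (j i : ℕ) :
    G 0 j M a ∧ GS i N c ↔ D 0 (j + i + 2) L (.inl a) ∧ Enclosing j L (.inl a) := by
  obtain ⟨nbc, nbd⟩ := glue_sep hM h
  obtain ⟨be1, be2⟩ := sum_be M N a c
  obtain ⟨in1, in2⟩ := sum_inn M N a c
  rw [G, GS, D, Enclosing, Disk, Disk, Sph, glue_ori h, glue_fold h, glue_r1 h, h.ac, h.ab, h.cd,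
    and_iff_right nbd]
  by_cases ha : M.r1 a = a
  swap
  · simp only [ha, false_and, and_false]
  have ha' := (glue_r1 h).2 ha
  have hchi := sum_chi M N
  -- the vertex at the root is composed of the vertices of the two parts
  have vert : L.bs (.inl a) (.inr c) (.inr d) →
      L.be (.inl a) = M.be a + N.be c ∧ L.inn (.inl a) = M.inn a + N.inn c ∧
        M.be a + M.inn a = {x | L.bs (.inl a) (.inl b) x}.ncard + 1 := by
    intro hcd
    have nv := fun x => h.n_vs_iff ha' nbc nbd x
    have mv : ∀ x, L.vs (.inl a) x ↔ (M.sum N).vs (.inl a) x ∨ (M.sum N).vs (.inr c) x := by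
      intro x
      rw [(h.m_vs_iff ha' nbc nbd x).1, (nv x).1, (nv x).2]
      have : L.bs (.inl a) (.inr d) x → L.bs (.inl a) (.inr c) x := fun k =>
        Setoid.trans' _ hcd k
      tauto
    have split : ∀ p : A ⊕ B → Prop, {x | L.vs (.inl a) x ∧ p x}.ncard =
        {x | (M.sum N).vs (.inl a) x ∧ p x}.ncard + {x | (M.sum N).vs (.inr c) x ∧ p x}.ncard := by
      intro p
      rw [← Set.ncard_union_eq]
      · congr 1
        ext x
        simp only [Set.mem_union, Set.mem_ofPred_eq, mv]
        tauto
      · rw [Set.disjoint_left]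
        rintro x ⟨k, -⟩ ⟨k', -⟩
        obtain ⟨y, rfl⟩ := (sum_cs_inl M N hM a _).1 (vs_le_cs _ k)
        obtain ⟨z, hz⟩ := (sum_cs_inr M N hN c _).1 (vs_le_cs _ k')
        cases hz
    refine ⟨?_, ?_, ?_⟩
    · rw [← be1, ← be2, be, be, be, ← split]
      simp only [h.r2_fixed_iff]
    · rw [← in1, ← in2, inn, inn, inn, ← split]
      simp only [ne_eq, h.r2_fixed_iff]
    · rw [← be1, ← in1, be_add_inn]
      have : {x | (M.sum N).vs (.inl a) x} = insert (.inl a) {x | L.bs (.inl a) (.inl b) x} := by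
        ext x; exact (nv x).1
      rw [this, Set.ncard_insert_of_notMem]
      intro k
      have := (h.bs_alone h.mem_a ha').1 (Setoid.symm' _ k)
      exact h.ne.1 this.symm
  constructor
  · rintro ⟨⟨⟨-, m2, m3⟩, m4, -, m5, m6⟩, ⟨-, n2, n3⟩, n4, n6⟩
    have nofix : ∀ x, N.r0 x ≠ x ∧ N.r1 x ≠ x ∧ N.r2 x ≠ x := by
      intro x
      by_contra k
      have := (chi_le N hN x).2 ⟨x, by tauto⟩
      omega
    have hcd : L.bs (.inl a) (.inr c) (.inr d) := by
      have k1 : ∀ x, L.bs (.inl a) (.inr c) x → L.r1 x ≠ x ∧ L.r2 x ≠ x := by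
        intro x hx
        obtain ⟨y, rfl⟩ := glue_inr hN h hx
        rw [← h.r1, ne_eq, ne_eq, ← h.r2_fixed_iff]
        exact ⟨fun k => (nofix y).2.1 (Sum.inr_injective k),
          fun k => (nofix y).2.2 (Sum.inr_injective k)⟩
      rcases path_ends h.off_inv L.i1 (off_mem h.mem_c) with ⟨z, hz, -, H⟩ | ⟨z, hz, hn, -, H, -⟩
      · have hz' : L.bs (.inl a) (.inr c) z := by rw [bs, sup_comm]; exact hz
        exact absurd ((H z hz).2.2 rfl) (k1 z hz').1
      · have hz' : L.bs (.inl a) (.inr c) z := by rw [bs, sup_comm]; exact hz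
        have k2 := (H z hz).1.2 (Or.inr rfl)
        by_cases k3 : z ∈ L.edge (.inl a)
        · obtain ⟨y, rfl⟩ := glue_inr hN h hz'
          rcases h.mem_edge.1 k3 with k | k | k | k
          · cases k
          · cases k
          · exact absurd k hn
          · rw [← k]; exact hz'
        · rw [off_notMem k3] at k2
          exact absurd k2 (k1 z hz').2
    obtain ⟨v1, v2, v3⟩ := vert hcd
    have hc := (h.chi_n ha' nbd).1 hcd
    have nb : N.be c = 0 := be_eq_zero_iff.2 fun x _ => (nofix x).2.2
    refine ⟨⟨⟨glue_conn hM hN h, ⟨m2, n2⟩, by omega⟩, ⟨m4, n4⟩, ha, by omega, by omega⟩, hcd,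
      by omega⟩
  · rintro ⟨⟨⟨-, ⟨m2, n2⟩, l3⟩, ⟨m4, n4⟩, -, l5, l6⟩, hcd, l7⟩
    obtain ⟨v1, v2, v3⟩ := vert hcd
    have hc := (h.chi_n ha' nbd).1 hcd
    have c1 := (chi_le M hM a).2 ⟨a, Or.inr (Or.inl ha)⟩
    have c2 := (chi_le N hN c).1
    exact ⟨⟨⟨hM, m2, by omega⟩, m4, ha, by omega, by omega⟩, ⟨hN, n2, by omega⟩, n4, by omega⟩

/-! #### The other end of the root edge is another vertex on the boundary -/

include hN h in
/-- If `c` belongs to a piece of odd size, the other end of this piece is on the boundary, and the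
piece consists of flags of inner darts. -/
theorem glue_outer_aux (ho : Odd {x | L.bs (.inl a) (.inr c) x}.ncard) :
    (∃ z, N.r1 z = z) ∧ (∀ x, L.bs (.inl a) (.inr c) x → L.r2 x ≠ x) ∧
      ¬ L.bs (.inl a) (.inr c) (.inr d) := by
  obtain ⟨z, hz, hz', H⟩ := odd_piece h.edge_r2 h.mem_c ho
  change L.bs (.inl a) (.inr c) z at hz
  refine ⟨?_, fun x hx => (H x hx).1, fun k => h.ne.2.2.2.2.2 ((H _ k).2 h.mem_d).symm⟩
  obtain ⟨y, rfl⟩ := glue_inr hN h hz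
  rw [← h.r1] at hz'
  exact ⟨y, Sum.inr_injective hz'⟩

include hM hN h in
/-- The piece of `c` ends at the boundary, so that both components are disks: by additivity their Euler
characteristics sum to `2`, and neither exceeds `1`. -/
theorem glue_outer (k : ℕ) :
    GA M a ∧ PosA k N c ↔ D 0 k L (.inl a) ∧ Outer L (.inl a) := by
  obtain ⟨nbc, nbd⟩ := glue_sep hM h
  rw [GA, PosA, D, outer_iff h, Disk, Disk, Disk, glue_ori h, glue_fold h, glue_r1 h,
    and_iff_right nbd, ← glue_ms h]
  by_cases ha : M.r1 a = a
  swap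
  · simp only [ha, false_and, and_false]
  have ha' := (glue_r1 h).2 ha
  have hchi := sum_chi M N
  have aux := glue_outer_aux hN h
  have mv : ¬ L.bs (.inl a) (.inr c) (.inr d) →
      ∀ x, L.vs (.inl a) x ↔ x = .inl a ∨ L.bs (.inl a) (.inr c) x := fun ncd x => by
    rw [(h.m_vs_iff ha' nbc nbd x).1]; tauto
  have card : ¬ L.bs (.inl a) (.inr c) (.inr d) → L.be (.inl a) + L.inn (.inl a) =
      {x | L.bs (.inl a) (.inr c) x}.ncard + 1 := fun ncd => by
    rw [be_add_inn]
    have : {x | L.vs (.inl a) x} = insert (.inl a) {x | L.bs (.inl a) (.inr c) x} := by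
      ext x; exact mv ncd x
    rw [this, Set.ncard_insert_of_notMem]
    intro k
    have := (h.bs_alone h.mem_a ha').1 (Setoid.symm' _ k)
    exact h.ne.2.1 this.symm
  constructor
  · rintro ⟨⟨⟨-, m2, m3⟩, m4, -⟩, ⟨-, n2, n3⟩, n4, n5⟩
    obtain ⟨-, n6, ncd⟩ := aux (by rw [Nat.odd_iff]; omega)
    have hc := (h.chi_n ha' nbd).2 ncd
    have l5 : L.be (.inl a) = 0 := by
      rw [be_eq_zero_iff]
      intro x hx
      rcases (mv ncd x).1 hx with rfl | hx
      · rw [h.ac]; exact h.ne.2.1.symm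
      · exact n6 x hx
    have := card ncd
    exact ⟨⟨⟨glue_conn hM hN h, ⟨m2, n2⟩, by omega⟩, ⟨m4, n4⟩, ha, l5, by omega⟩, ncd⟩
  · rintro ⟨⟨⟨-, ⟨m2, n2⟩, l3⟩, ⟨m4, n4⟩, -, l5, l6⟩, ncd⟩
    have hc := (h.chi_n ha' nbd).2 ncd
    have := card ncd
    obtain ⟨⟨z, hz⟩, -, -⟩ := aux (by rw [Nat.odd_iff]; omega)
    have c1 := (chi_le M hM a).2 ⟨a, Or.inr (Or.inl ha)⟩
    have c2 := (chi_le N hN c).2 ⟨z, Or.inr (Or.inl hz)⟩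
    exact ⟨⟨⟨hM, m2, by omega⟩, m4, ha⟩, ⟨hN, n2, by omega⟩, n4, by omega⟩

include hM hN h in
/-- If the first side of the root edge is next to the boundary at both ends, its component is a single
folded edge. -/
theorem glue_firstOuter (k : ℕ) : (GA M a ∧ M.r1 (M.r0 a) = M.r0 a) ∧ Pos 0 k N c ↔
    D 0 k L (.inl a) ∧ FirstOuter L (.inl a) := by
  obtain ⟨nbc, nbd⟩ := glue_sep hM h
  have eb : M.r0 a = b := Sum.inl_injective (by
    change (M.sum N).r0 (.inl a) = _; rw [h.r0]; exact h.ab)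
  have full : L.Full (.inl a) := by
    rw [Full, h.ab, h.ac]
    exact ⟨h.ne.1.symm, h.ne.2.1.symm, h.ne.2.2.2.1⟩
  have e1 : (GA M a ∧ M.r1 (M.r0 a) = M.r0 a) ∧ Pos 0 k N c ↔
      (GA M a ∧ PosA k N c) ∧ M.r1 b = b ∧ N.be c = 0 := by
    rw [Pos, PosA, eb]; tauto
  have e2 : D 0 k L (.inl a) ∧ FirstOuter L (.inl a) ↔
      (D 0 k L (.inl a) ∧ Outer L (.inl a)) ∧ M.r1 b = b ∧ L.be (.inl b) = 0 := by
    have : L.r1 (.inl b) = .inl b ↔ M.r1 b = b := by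
      rw [← h.r1]; exact Sum.inl_injective.eq_iff
    rw [FirstOuter, Outer, h.ab, this]; tauto
  rw [e1, e2, glue_outer hM hN h k]
  refine and_congr_right fun ⟨hD, ho⟩ => and_congr_right fun hb => ?_
  obtain ⟨⟨-, -, -⟩, hG⟩ := (glue_outer hM hN h k).2 ⟨hD, ho⟩
  have hb' : L.r1 (.inl b) = .inl b := by
    rw [← h.r1]; exact congrArg Sum.inl hb
  obtain ⟨-, n6, ncd⟩ := glue_outer_aux hN h (by
    have := hG.2.2
    rw [glue_ms h, Nat.odd_iff]; omega)
  rw [← (sum_be M N a c).2, be_eq_zero_iff, be_eq_zero_iff]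
  refine forall_congr' fun x => ?_
  rw [(h.n_vs_iff hD.2.2.1 nbc nbd x).2, (h.m_vs_iff hD.2.2.1 nbc nbd x).2 ncd,
    h.bs_alone h.mem_b hb', ne_eq, ne_eq, h.r2_fixed_iff]
  constructor
  · rintro k (rfl | hx)
    · rw [h.bd]; exact fun e => h.ne.2.2.2.2.1 e.symm
    · exact k (Or.inr hx)
  · rintro k (hx | hx)
    · exact n6 x hx
    · exact k (Or.inr hx)

end Glue

end PMap

namespace PMap

variable {F A B : Type}

/-! ### The four cases -/

theorem Hom.fullPieces {M : PMap A} {N : PMap B} {e : A ≃ B} (h : Hom M N e) {f : A}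
    (hf : M.Full f) :
    (N.bs (e f) (N.r0 (e f)) (N.r0 (N.r2 (e f))) ↔ M.bs f (M.r0 f) (M.r0 (M.r2 f))) ∧
    (N.bs (e f) (N.r2 (e f)) (N.r0 (N.r2 (e f))) ↔ M.bs f (M.r2 f) (M.r0 (M.r2 f))) ∧
    {x | N.bs (e f) (N.r0 (e f)) x}.ncard = {x | M.bs f (M.r0 f) x}.ncard := by
  rw [← h.h2, ← h.h0, ← h.h0, h.bs_iff hf, h.bs_iff hf]
  refine ⟨Iff.rfl, Iff.rfl, ?_⟩
  have : {x | N.bs (e f) (e (M.r0 f)) x} = e '' {x | M.bs f (M.r0 f) x} := by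
    ext y
    constructor
    · intro hy
      obtain ⟨y, rfl⟩ := e.surjective y
      exact ⟨y, (h.bs_iff hf).1 hy, rfl⟩
    · rintro ⟨y, hy, rfl⟩
      exact (h.bs_iff hf).2 hy
  rw [this, Set.ncard_image_of_injective _ e.injective]

theorem inv_enclosing (k j : ℕ) :
    Inv (fun {F} (M : PMap F) f => D 0 k M f ∧ M.Full f ∧ Enclosing j M f) := by
  rintro A B M N e h a ⟨h1, h2, h3⟩
  obtain ⟨k1, k2, k3⟩ := h.fullPieces h2
  refine ⟨inv_D 0 k h a h1, h.full.2 h2, ?_⟩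
  rwa [Enclosing, k1, k2, k3]

theorem inv_outer (k : ℕ) :
    Inv (fun {F} (M : PMap F) f => D 0 k M f ∧ M.Full f ∧ Outer M f) := by
  rintro A B M N e h a ⟨h1, h2, h3⟩
  obtain ⟨k1, k2, k3⟩ := h.fullPieces h2
  refine ⟨inv_D 0 k h a h1, h.full.2 h2, ?_⟩
  rwa [Outer, k1, k2]

theorem inv_firstOuter (k : ℕ) :
    Inv (fun {F} (M : PMap F) f => D 0 k M f ∧ FirstOuter M f) := by
  rintro A B M N e h a ⟨h1, ⟨h2, h3, h4⟩, h5, h6⟩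
  obtain ⟨k1, k2, k3⟩ := h.fullPieces h2
  refine ⟨inv_D 0 k h a h1, ⟨h.full.2 h2, ?_, ?_⟩, ?_, ?_⟩
  · rwa [k1]
  · rwa [k2]
  · rw [← h.h0, ← h.h1, h5]
  · rw [← h.h0, h.be_eq e.injective, h6]

theorem Cut.full {M N : PMap F} {a b c d : F} (h : Cut M N a b c d) : M.Full a := by
  rw [Full, h.ab, h.ac]
  exact ⟨h.ne.1.symm, h.ne.2.1.symm, h.ne.2.2.2.1⟩

theorem exists_add {n n' : ℕ} (h : n' ∈ Finset.range (n - 1)) : ∃ l, n = n' + 1 + (l + 1) :=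
  ⟨n - n' - 2, by rw [Finset.mem_range] at h; omega⟩

/-- The piece of `r0 f` runs from the loop to the boundary and consists of `r0 f` and flags of inner
darts. -/
theorem enclosing_card [Finite F] {k : ℕ} {M : PMap F} {f : F} (hD : D 0 k M f) (hf : M.Full f)
    (hbd : ¬ M.bs f (M.r0 f) (M.r0 (M.r2 f))) (hcd : M.bs f (M.r2 f) (M.r0 (M.r2 f))) :
    ∃ j < k - 1, {x | M.bs f (M.r0 f) x}.ncard = 2 * j + 1 := by
  obtain ⟨X, hX⟩ := exists_cut M f hf.1 hf.2.1 hf.2.2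
  have hbc : ¬ M.bs f (M.r0 f) (M.r2 f) := fun k => hbd (Setoid.trans' _ k hcd)
  have ne := hX.ne
  have he : Even {x | M.bs f (M.r2 f) x}.ncard :=
    (even_piece hX.edge_r2 hX.mem_c hX.mem_d ne.2.2.2.2.2.symm hcd).1
  have hp : 0 < {x | M.bs f (M.r2 f) x}.ncard :=
    (Set.ncard_pos).2 ⟨M.r2 f, (M.bs f).refl' _⟩
  have al : ∀ {x}, M.bs f f x ↔ x = f := hX.bs_alone hX.mem_a hD.2.2.1
  have hv : {x | M.vs f x} = insert f ({x | M.bs f (M.r2 f) x} ∪ {x | M.bs f (M.r0 f) x}) := by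
    ext x
    have := (hX.m_vs_iff hD.2.2.1 hbc hbd x).1
    simp only [hcd, true_and] at this
    exact this
  have hc := M.be_add_inn f
  rw [hv, Set.ncard_insert_of_notMem, Set.ncard_union_eq, hD.2.2.2.1, hD.2.2.2.2] at hc
  · rw [Nat.even_iff] at he
    exact ⟨{x | M.bs f (M.r0 f) x}.ncard / 2, by omega, by omega⟩
  · rw [Set.disjoint_left]
    exact fun x k k' => hbc ((M.bs f).trans' k' ((M.bs f).symm' k))
  · rintro (k | k)
    · exact ne.2.1 (al.1 ((M.bs f).symm' k)).symm
    · exact ne.1 (al.1 ((M.bs f).symm' k)).symm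

/-- A disk and a sphere are glued along folded edges that mark their root corners. -/
theorem cnt_enclosing {n k : ℕ} :
    cnt n (fun M f => (D 0 k M f ∧ M.Full f ∧ ¬ M.bs f (M.r0 f) (M.r0 (M.r2 f))) ∧
      M.bs f (M.r2 f) (M.r0 (M.r2 f))) =
    ∑ n' ∈ Finset.range (n - 1), ∑ k' ∈ Finset.range (k - 1),
      diskCount 0 n' k' * sphereCount (n - n' - 2) (k - k' - 2) := by
  rw [cnt_sep (k := k) fun M f h => h.1]
  refine Finset.sum_congr rfl fun n' hn' => ?_
  obtain ⟨l, rfl⟩ := exists_add hn'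
  rw [show n' + 1 + (l + 1) - n' - 2 = l by omega]
  rw [cnt_sum (Finset.range (k - 1)) _ fun M f => {x | M.bs f (M.r0 f) x}.ncard / 2]
  · refine Finset.sum_congr rfl fun k' hk' => ?_
    rw [Finset.mem_range] at hk'
    have glue := cnt_glue (m := n' + 1) (l := l + 1) (P := fun {F} (M : PMap F) f => G 0 k' M f)
      (Q := fun {F} (M : PMap F) f => GS (k - k' - 2) M f) (inv_enclosing k k')
      (fun h => ⟨h.1.1, mem_fold_left h.2.1⟩) (fun h => ⟨h.1.1, mem_fold_left h.2.1⟩)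
      (fun h => h.1.1.1) (by
        intro A B _ _ M N L a b c d hM hN h
        have := glue_enclosing hM hN h k' (k - k' - 2)
        rw [show k' + (k - k' - 2) + 2 = k by omega] at this
        refine this.trans ?_
        have := h.full
        tauto)
    have hG := cnt_G 0 n' k'
    rw [← hG, ← cnt_GS]
    refine Eq.trans (cnt_congr fun M f => ?_) glue.symm
    constructor
    · rintro ⟨⟨⟨⟨h1, h2, h3⟩, h4⟩, h5⟩, h6⟩
      obtain ⟨j, -, hj⟩ := enclosing_card h1 h2 h3 h4
      exact ⟨⟨h1, h2, h4, h3, by omega⟩, h5⟩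
    · rintro ⟨⟨h1, h2, h4, h3, h6⟩, h5⟩
      exact ⟨⟨⟨⟨h1, h2, h3⟩, h4⟩, h5⟩, by omega⟩
  · rintro M f ⟨⟨⟨h1, h2, h3⟩, h4⟩, -⟩
    obtain ⟨j, hj, hj'⟩ := enclosing_card h1 h2 h3 h4
    rw [Finset.mem_range]
    omega
  · intro M N f e h hM
    rw [(h.fullPieces hM.1.1.2.1).2.2]

/-- The degree of the root vertex is arbitrary; it is at most `n`. -/
theorem cnt_GA (n : ℕ) : cnt (n + 1) (fun M f => GA M f) =
    ∑ l ∈ Finset.range (n + 1), ∑ i : Fin 2, diskCount i n l := by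
  rw [cnt_sum (Finset.range 2) _ (fun M f => M.be f), Finset.sum_range, Finset.sum_comm]
  · refine Finset.sum_congr rfl fun i _ => ?_
    rw [← cnt_GB]
    refine cnt_congr fun M f => ?_
    rw [GA, GB]; tauto
  · exact fun M f h => Finset.mem_range.2 (be_le_one h.2.2)
  · exact fun M N f e h _ => h.be_eq e.injective f

theorem cnt_PosA (n : ℕ) {k : ℕ} (hk : 1 ≤ k) : cnt (n + 1) (fun M f => PosA k M f) =
    ∑ m ∈ Finset.Ico (k - 1) (n + 1), ∑ i : Fin 2, diskCount i n m := by
  rw [cnt_sum (Finset.range 2) _ (fun M f => M.be f), Finset.sum_range, Finset.sum_comm]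
  · refine Finset.sum_congr rfl fun i _ => ?_
    rw [← cnt_Pos i n hk]
    refine cnt_congr fun M f => ?_
    rw [PosA, Pos]; tauto
  · intro M f h
    have h2 := r2_ne_of_fold (mem_fold_left h.2.1)
    obtain ⟨z, hz, hz', -⟩ := odd_piece (pair_r2 h2) (Or.inl rfl) (by
      have := h.2.2
      change Odd {x | M.ms f f x}.ncard
      rw [Nat.odd_iff]; omega)
    have : M.vs f z := (sup_le_sup_left step_off_le _ : M.ms f ≤ M.vs) hz
    rw [be_congr this]
    exact Finset.mem_range.2 (be_le_one hz')
  · exact fun M N f e h _ => h.be_eq e.injective f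

/-- Two disks are glued along folded edges; that of the first is next to the boundary, that of the
second marks the corner after `k - 1` darts. -/
theorem cnt_outer {n k : ℕ} (hk : 1 ≤ k) :
    cnt n (fun M f => (D 0 k M f ∧ M.Full f ∧ ¬ M.bs f (M.r0 f) (M.r0 (M.r2 f))) ∧
      ¬ M.bs f (M.r2 f) (M.r0 (M.r2 f))) =
    ∑ n' ∈ Finset.range (n - 1), (∑ m ∈ Finset.Ico (k - 1) (n - n' - 1), ∑ i : Fin 2,
      diskCount i (n - 2 - n') m) *
      ∑ l ∈ Finset.range (n' + 1), ∑ i : Fin 2, diskCount i n' l := by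
  rw [cnt_sep (k := k) fun M f h => h.1]
  refine Finset.sum_congr rfl fun n' hn' => ?_
  obtain ⟨l, rfl⟩ := exists_add hn'
  rw [show n' + 1 + (l + 1) - 2 - n' = l by omega, show n' + 1 + (l + 1) - n' - 1 = l + 1 by omega,
    ← cnt_GA, ← cnt_PosA l hk]
  have glue := cnt_glue (m := n' + 1) (l := l + 1) (P := fun {F} (M : PMap F) f => GA M f)
    (Q := fun {F} (M : PMap F) f => PosA k M f) (inv_outer k)
    (fun h => ⟨h.1.1, mem_fold_left h.2.1⟩) (fun h => ⟨h.1.1, mem_fold_left h.2.1⟩)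
    (fun h => h.1.1.1) (by
      intro A B _ _ M N L a b c d hM hN h
      refine (glue_outer hM hN h k).trans ?_
      have := h.full
      tauto)
  refine Eq.trans (cnt_congr fun M f => ?_) (glue.symm.trans (mul_comm _ _))
  rw [Outer]; tauto

/-- The first disk of `cnt_outer` is a single vertex, and there are no boundary edges at the
other end of the root edge. -/
theorem cnt_firstOuter {n k : ℕ} (hk : 1 ≤ k) :
    cnt n (fun M f => D 0 k M f ∧ FirstOuter M f) =
      ∑ m ∈ Finset.Ico (k - 1) (n - 1), diskCount 0 (n - 2) m := by
  rw [cnt_sep (k := k) fun M f h => ⟨h.1, h.2.1.1, h.2.1.2.1⟩]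
  -- cutting the root edge, its first side becomes a component
  have key : ∀ (M : PMap (Fin (2 * n))) f n', FirstOuter M f → Sep (n' + 1) M f → M.r1 f = f →
      n' = 0 := by
    rintro M f n' ⟨⟨hf, -, -⟩, hb, -⟩ ⟨-, -, k⟩ ha
    obtain ⟨X, hX⟩ := exists_cut M f hf.1 hf.2.1 hf.2.2
    have : {x | M.gs f f x} ⊆ {f, M.r0 f} := by
      intro x hx
      rw [Set.mem_ofPred_eq, ← hX.n_cs] at hx
      refine (cs_mem (T := {f, M.r0 f}) ?_ ?_ ?_ hx).1 (Or.inl rfl) <;> rintro y (rfl | rfl)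
      · rw [hX.r0]; exact Or.inr rfl
      · rw [hX.r0, M.i0]; exact Or.inl rfl
      · rw [hX.r1, ha]; exact Or.inl rfl
      · rw [hX.r1, hb]; exact Or.inr rfl
      · rw [hX.nab]; exact Or.inr rfl
      · rw [hX.nba]; exact Or.inl rfl
    have := (Set.ncard_le_ncard this).trans (Set.ncard_insert_le _ _)
    rw [k, Set.ncard_singleton] at this
    omega
  rcases Nat.lt_or_ge n 2 with hn | hn
  · rw [show n - 1 = 0 by omega]; simp
  rw [Finset.sum_eq_single_of_mem 0 (Finset.mem_range.2 (by omega)) fun n' _ h0 =>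
    cnt_eq_zero fun M f h => h0 (key M f n' h.1.2 h.2 h.1.1.2.2.1)]
  obtain ⟨l, rfl⟩ : ∃ l, n = 0 + 1 + (l + 1) := ⟨n - 2, by omega⟩
  have e : cnt (0 + 1) (fun M f => GA M f ∧ M.r1 (M.r0 f) = M.r0 f) = 1 := by
    refine cnt_eq_one ?_ fun M f N g hM hN => exists_hom_of_two (mem_fold_left hM.1.2.1)
      (mem_fold_left hN.1.2.1) (Or.inl ⟨hM.1.2.2, hN.1.2.2⟩)
    obtain ⟨N, g, hN⟩ := exists_two (inv_G 0 0) single_G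
    refine ⟨N, g, ⟨hN.1, hN.2.1, hN.2.2.1⟩, ?_⟩
    have h0 := mem_fold_left hN.2.1
    have k := r2_ne_of_fold h0
    have two : ∀ x y z : Fin (2 * 1), y ≠ x → z = x ∨ z = y := by decide
    rw [h0]
    refine (two g _ _ k).resolve_left fun e => k ?_
    rw [← N.i1 (N.r2 g), e, hN.2.2.1]
  have hP := cnt_Pos 0 l hk
  have glue := cnt_glue (m := 0 + 1) (l := l + 1)
    (P := fun {F} (M : PMap F) f => GA M f ∧ M.r1 (M.r0 f) = M.r0 f)
    (Q := fun {F} (M : PMap F) f => Pos 0 k M f) (inv_firstOuter k)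
    (fun h => ⟨h.1.1.1, mem_fold_left h.1.2.1⟩) (fun h => ⟨h.1.1, mem_fold_left h.2.1⟩)
    (fun h => h.1.1.1) (fun hM hN h => glue_firstOuter hM hN h k)
  rw [show 0 + 1 + (l + 1) - 2 = l by omega, show 0 + 1 + (l + 1) - 1 = l + 1 by omega, ← hP]
  refine glue.symm.trans ?_
  rw [e, one_mul]
  rfl

end PMap

/-! ### The recursion -/

/-- A convolution of two finitely supported sequences. -/
theorem sum_convolution {K N₁ N₂ : ℕ} (A B : ℕ → ℕ) (hA : ∀ j, N₁ ≤ j → A j = 0)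
    (hB : ∀ j, N₂ ≤ j → B j = 0) (h : N₁ ≠ 0 → N₁ + N₂ ≤ K + 1) (h2 : 1 ≤ N₂) :
    ∑ m ∈ Finset.range K, ∑ j ∈ Finset.range (m + 1), A j * B (m - j) =
      (∑ j ∈ Finset.range N₁, A j) * ∑ l ∈ Finset.range N₂, B l := by
  rw [Finset.sum_range_diag_flip K fun j l => A j * B l, Finset.sum_mul_sum]
  have h1 : N₁ ≤ K := by
    by_cases k : N₁ = 0
    · omega
    · have := h k; omega
  rw [← Finset.sum_subset (Finset.range_subset_range.2 h1)]
  · refine Finset.sum_congr rfl fun j hj => ?_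
    rw [Finset.mem_range] at hj
    have := h (by omega)
    refine (Finset.sum_subset (Finset.range_subset_range.2 (by omega)) fun l _ hl => ?_).symm
    rw [hB l (by simpa using hl), mul_zero]
  · intro j _ hj
    rw [Finset.mem_range, not_lt] at hj
    simp [hA j hj]

open PMap

theorem mainTheorem9 (n k : ℕ) (hn : 1 ≤ n) (hk : 1 ≤ k) :
    diskCount 0 n k =
      diskCount 0 (n - 1) (k - 1)
      + ∑ k' ∈ Finset.range (n - k), diskCount 0 (n - 2) (k - 1 + k')
      + ∑ n' ∈ Finset.range (n - 1), ∑ k' ∈ Finset.range (k - 1),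
          diskCount 0 n' k' * sphereCount (n - n' - 2) (k - k' - 2)
      + ∑ n' ∈ Finset.range (n - 1), ∑ k' ∈ Finset.range (n - k),
          ∑ k'' ∈ Finset.range (k' + 1), ∑ i₁ : Fin 2, ∑ i₂ : Fin 2,
            diskCount i₁ (n - 2 - n') (k + k'' - 1) * diskCount i₂ n' (k' - k'') := by
  -- a root edge that is not a halfedge is complete
  have full : ∀ (M : PMap (Fin (2 * n))) f, D 0 k M f ∧ ¬ M.r0 f = f ↔ D 0 k M f ∧ M.Full f := by
    refine fun M f => and_congr_right fun h => ⟨fun h0 => ⟨h0, ?_, ?_⟩, fun h0 => h0.1⟩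
    · exact r2_ne_of_be h.2.2.2.1 (Setoid.refl' _ _)
    · intro e
      have : f ∈ M.fold := e
      rw [h.2.1] at this
      exact this
  have split : diskCount 0 n k =
      cnt n (fun M f => D 0 k M f ∧ M.r0 f = f) +
      (cnt n (fun M f => D 0 k M f ∧ M.Inner f) +
      (cnt n (fun M f => (D 0 k M f ∧ M.Full f ∧ ¬ M.bs f (M.r0 f) (M.r0 (M.r2 f))) ∧
        M.bs f (M.r2 f) (M.r0 (M.r2 f))) +
      cnt n (fun M f => (D 0 k M f ∧ M.Full f ∧ ¬ M.bs f (M.r0 f) (M.r0 (M.r2 f))) ∧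
        ¬ M.bs f (M.r2 f) (M.r0 (M.r2 f))))) := by
    rw [diskCount_eq 0 (by omega) k]
    change cnt n (fun M f => D 0 k M f) = _
    rw [cnt_add _ (fun M f => M.r0 f = f) fun M N f e h _ => by
      rw [← h.h0, e.injective.eq_iff], cnt_congr full,
      cnt_add (fun M f => D 0 k M f ∧ M.Full f) (fun M f => M.bs f (M.r0 f) (M.r0 (M.r2 f)))
        fun M N f e h hM => (h.fullPieces hM.2).1,
      cnt_add (fun M f => (D 0 k M f ∧ M.Full f) ∧ ¬ M.bs f (M.r0 f) (M.r0 (M.r2 f)))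
        (fun M f => M.bs f (M.r2 f) (M.r0 (M.r2 f))) fun M N f e h hM => (h.fullPieces hM.1.2).2.1]
    simp only [and_assoc, PMap.Inner]
  have half : cnt n (fun M f => D 0 k M f ∧ M.r0 f = f) = diskCount 0 (n - 1) (k - 1) := by
    obtain ⟨m, rfl⟩ : ∃ m, n = m + 1 := ⟨n - 1, by omega⟩
    obtain ⟨j, rfl⟩ : ∃ j, k = j + 1 := ⟨k - 1, by omega⟩
    rw [cnt_half]
    exact cnt_G 0 m j
  have inner : ∑ m ∈ Finset.Ico (k - 1) (n - 1), diskCount 0 (n - 2) m =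
      ∑ k' ∈ Finset.range (n - k), diskCount 0 (n - 2) (k - 1 + k') := by
    rw [Finset.sum_Ico_eq_sum_range, show n - 1 - (k - 1) = n - k by omega]
  rw [split, half, cnt_unzip, cnt_firstOuter hk, inner, cnt_enclosing, cnt_outer hk, ← add_assoc,
    ← add_assoc]
  congr 1
  refine Finset.sum_congr rfl fun n' hn' => ?_
  rw [Finset.mem_range] at hn'
  rw [Finset.sum_Ico_eq_sum_range, show n - n' - 1 - (k - 1) = n - n' - k by omega]
  rw [← sum_convolution (K := n - k) (fun j => ∑ i : Fin 2, diskCount i (n - 2 - n') (k - 1 + j))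
    (fun l => ∑ i : Fin 2, diskCount i n' l)]
  · refine Finset.sum_congr rfl fun k' _ => Finset.sum_congr rfl fun k'' _ => ?_
    rw [Finset.sum_mul_sum, show k - 1 + k'' = k + k'' - 1 by omega]
  · exact fun j hj => Finset.sum_eq_zero fun i _ => diskCount_eq_zero i (by omega)
  · exact fun j hj => Finset.sum_eq_zero fun i _ => diskCount_eq_zero i (by omega)
  · omega
  · omega
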